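/- For a real number $\gamma>2$ let $C_\gamma$ denote any compact convex set $C_\gamma\subset(-1/2,1/2)^2$ in the plane whose boundary $\partial C_\gamma$ coincides, in some open convex neighbourhood $U$ of the origin, with the graph of $x\mapsto|x|^\gamma$, and such that, outside $\frac12U$, $\partial C_\gamma$ is smooth with curvature bounded below by a positive constant. For $R>0$ and $t\in\mathbb{R}^2$ let \[ \mathcal{D}_R(t)=-R^2|C_\gamma|+\mathrm{card}\bigl((RC_\gamma+t)\cap\mathbb{Z}^2\bigr), \] where $|C_\gamma|$ is the area of $C_\gamma$, and, identifying $\mathbb{T}^2=\mathbb{R}^2/\mathbb{Z}^2$ with $[-1/2,1/2)^2$, let \[ \|\mathcal{D}_R\|_p=\Bigl\{\int_{\mathbb{T}^2}|\mathcal{D}_R(t)|^p\,dt\Bigr\}^{1/p}\quad(1\le p<\infty),\qquad \|\mathcal{D}_R\|_\infty=\sup_{t\in\mathbb{T}^2}|\mathcal{D}_R(t)| . \] Theorem. Let $\gamma>3$ and let $C_\gamma$ be as above. Then there is a constant $c>0$, depending only on $C_\gamma$ (and not on $p$ or $R$), such that for every $p$ with $1\le p\le\infty$ and every $R\ge 1$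 \[ \|\mathcal{D}_R\|_p\le c\,R^{1-1/\gamma}. \] -/

import Mathlib

open MeasureTheory
open scoped Pointwise ENNReal ContDiff

noncomputable section

/-- The (unsigned) Euclidean curvature `|x' y'' - y' x''| / (x'² + y'²)^(3/2)` at the parameter `s`
of the parametrized plane curve `g = (x, y)`. -/
def planeCurvature (g : ℝ → ℝ × ℝ) (s : ℝ) : ℝ :=
  |deriv (fun u => (g u).1) s * deriv (deriv fun u => (g u).2) s
      - deriv (fun u => (g u).2) s * deriv (deriv fun u => (g u).1) s|
    / (deriv (fun u => (g u).1) s ^ 2 + deriv (fun u => (g u).2) s ^ 2) ^ (3 / 2 : ℝ)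

/-- `g`, restricted to `(-δ, δ)`, is a smooth regular parametrization with `g 0 = p` of a
neighbourhood of `p` in the plane set `S`. -/
structure IsLocalSmoothParam (S : Set (ℝ × ℝ)) (p : ℝ × ℝ) (g : ℝ → ℝ × ℝ) (δ : ℝ) : Prop where
  pos : 0 < δ
  base : g 0 = p
  smooth : ContDiffOn ℝ ∞ g (Set.Ioo (-δ) δ)
  regular : ∀ s ∈ Set.Ioo (-δ) δ, deriv g s ≠ 0
  image : ∃ V : Set (ℝ × ℝ), IsOpen V ∧ p ∈ V ∧ S ∩ V = g '' Set.Ioo (-δ) δ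

/-- Near `p` the set `S` is a smooth curve, whose curvature at `p` is at least `κ`. -/
def SmoothWithCurvatureGE (S : Set (ℝ × ℝ)) (p : ℝ × ℝ) (κ : ℝ) : Prop :=
  ∃ (g : ℝ → ℝ × ℝ) (δ : ℝ), IsLocalSmoothParam S p g δ ∧ κ ≤ planeCurvature g 0

/-- The convex bodies `C_γ`: planar compact convex sets, contained in the open unit square centred
at the origin, whose boundary coincides with the graph of `x ↦ |x| ^ γ` in a neighbourhood `U` of
the origin and, outside `½ U`, is smooth with curvature bounded below by a positive constant. -/
structure IsFlatPointBody (γ : ℝ) (C : Set (ℝ × ℝ)) : Prop where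
  compact : IsCompact C
  convex : Convex ℝ C
  subset_square : C ⊆ Set.Ioo (-1 / 2 : ℝ) (1 / 2) ×ˢ Set.Ioo (-1 / 2 : ℝ) (1 / 2)
  boundary : ∃ U : Set (ℝ × ℝ), IsOpen U ∧ Convex ℝ U ∧ (0 : ℝ × ℝ) ∈ U ∧
    frontier C ∩ U = {z : ℝ × ℝ | z.2 = |z.1| ^ γ} ∩ U ∧
    ∃ κ : ℝ, 0 < κ ∧ ∀ p ∈ frontier C \ (1 / 2 : ℝ) • U, SmoothWithCurvatureGE (frontier C) p κ

/-- The integer points of the plane. -/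
def integerPoints : Set (ℝ × ℝ) := Set.range fun n : ℤ × ℤ => ((n.1 : ℝ), (n.2 : ℝ))

/-- The discrepancy function `t ↦ card ((R C + t) ∩ ℤ²) - R² |C|`. -/
def discrepancy (C : Set (ℝ × ℝ)) (R : ℝ) (t : ℝ × ℝ) : ℝ :=
  -(R ^ 2 * (volume C).toReal) + (((R • C + {t}) ∩ integerPoints).ncard : ℝ)

/-- The torus `ℝ² / ℤ²`, identified with the unit square `[-1/2, 1/2)²`. -/
def torusSquare : Set (ℝ × ℝ) := Set.Ico (-1 / 2 : ℝ) (1 / 2) ×ˢ Set.Ico (-1 / 2 : ℝ) (1 / 2)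

/-- The `L^p` norm over the torus of the discrepancy function; for `p = ∞` it is the supremum
over all translations (not only the essential supremum). -/
def discrepancyNorm (p : ℝ≥0∞) (C : Set (ℝ × ℝ)) (R : ℝ) : ℝ≥0∞ :=
  if p = ⊤ then ⨆ t ∈ torusSquare, ENNReal.ofReal |discrepancy C R t|
  else (∫⁻ t in torusSquare, ENNReal.ofReal |discrepancy C R t| ^ p.toReal) ^ (1 / p.toReal)

end

/-! The proof bounds the discrepancy pointwise, uniformly in `t`, by a multiple of R^(1-1/γ). Since
the torus has measure 1, this sup bound controls every L^p norm with the same constant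
(`discrepancyNorm_le`).

The body is the region between a convex graph `f` and a concave graph `h`. Counting lattice points
column by column and writing floors and ceilings through `sawtooth` splits the discrepancy into
three pieces: the error of the Riemann sum of the column lengths, and the sawtooth sums along the
dilated graphs of `f` and of `-h`. The column length is concave and vanishes like a square root at
both ends, because the boundary is curved where its tangent is vertical. So the first piece is
O(√R).

The sawtooth sums rest on a van der Corput estimate, `abs_sum_sawtooth_le_of_second_difference`: if
the second differences are at least λ and the slopes fill an interval of length L, the sum is O(L
λ^(-2/3) + λ^(-1/2)). It is proved without Fourier analysis. With λ = Q^(-3), the slopes are covered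
by one-sided Farey arcs of order Q. Inside the arc at a/q, a block of q consecutive terms runs
through a complete residue system, so by Hermite's identity it collapses to a single sawtooth of a
slowly varying sequence. One-sidedness makes that sequence monotone, and its uniform convexity gives
O((Q/q)^(3/2)) per arc. Summing over the O(qL + 1) fractions of each denominator q ≤ Q gives L Q² +
Q^(3/2).

Where the curvature is bounded below, f'' is at least a multiple of max(1, |f'|)³. A dyadic
decomposition by slope then yields O(R^(2/3)) (`abs_sum_sawtooth_le_of_curved`). Near the flat point
the decomposition is dyadic in |x|. At scale u the estimate costs R^(2/3) u + R^(1/2) u^(-(γ-2)/2),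
and below u = R^(-1/γ) the trivial bound by the number of columns, about R^(1-1/γ), takes over
(`abs_sum_sawtooth_rpow_le`). For γ > 3 this exponent dominates 2/3.

The curvature hypothesis, stated for local parametrizations, is first turned into local supporting
parabolas (`eventually_quadratic_support`). Convexity of `f - m₀ x²` then supplies the second
differences without any second derivative of the bounding functions. -/

/-! ### Sawtooth sums along convex sequences. -/

/-- The centred sawtooth function `y ↦ y - ⌈y⌉ + 1/2`. -/
noncomputable def sawtooth (y : ℝ) : ℝ := y - ⌈y⌉ + 1 / 2

/-- The periodic primitive of `sawtooth`. -/
noncomputable def sawtoothPrimitive (y : ℝ) : ℝ := ((y - ⌈y⌉) ^ 2 + (y - ⌈y⌉)) / 2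

lemma abs_sawtooth_le (y : ℝ) : |sawtooth y| ≤ 1 / 2 := by
  have h1 := Int.le_ceil y
  have h2 := Int.ceil_lt_add_one y
  unfold sawtooth
  rw [abs_le]; constructor <;> linarith

lemma abs_sum_sawtooth_le {ι : Type*} (s : Finset ι) (f : ι → ℝ) :
    |∑ i ∈ s, sawtooth (f i)| ≤ s.card / 2 := by
  calc |∑ i ∈ s, sawtooth (f i)| ≤ ∑ i ∈ s, |sawtooth (f i)| := Finset.abs_sum_le_sum_abs _ _
    _ ≤ ∑ _i ∈ s, (1 / 2 : ℝ) := Finset.sum_le_sum fun i _ => abs_sawtooth_le _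
    _ = s.card / 2 := by simp; ring

lemma abs_sawtoothPrimitive_le (y : ℝ) : |sawtoothPrimitive y| ≤ 1 / 8 := by
  have h1 := Int.le_ceil y
  have h2 := Int.ceil_lt_add_one y
  unfold sawtoothPrimitive
  rw [abs_le]; constructor
  · nlinarith [sq_nonneg (y - ⌈y⌉ + 1 / 2)]
  · nlinarith

/-- If no integer is crossed, the primitive is quadratic and the error is half the squared step.
Otherwise both terms are at most half the step while the ceiling jumps by at least 1. After division
by the step, both parts of the bound telescope along an increasing sequence. -/
lemma abs_sawtoothPrimitive_sub_le {y y' : ℝ} (h : y ≤ y') :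
    |sawtoothPrimitive y' - sawtoothPrimitive y - (y' - y) * sawtooth y|
      ≤ (y' - y) * ((y' - y) + (⌈y'⌉ - ⌈y⌉)) := by
  have h1 := Int.le_ceil y
  have h2 := Int.ceil_lt_add_one y
  have h1' := Int.le_ceil y'
  have h2' := Int.ceil_lt_add_one y'
  have hc : ⌈y⌉ ≤ ⌈y'⌉ := Int.ceil_mono h
  rcases hc.eq_or_lt with he | hlt
  · unfold sawtoothPrimitive sawtooth
    rw [← he]
    rw [abs_le]; constructor <;> nlinarith [sq_nonneg (y' - y)]
  · have h3 : (⌈y⌉ : ℝ) + 1 ≤ ⌈y'⌉ := by exact_mod_cast hlt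
    have hP : |sawtoothPrimitive y' - sawtoothPrimitive y| ≤ (y' - y) / 2 := by
      unfold sawtoothPrimitive
      have hk : (⌈y⌉ : ℝ) ≤ ⌈y'⌉ - 1 := by linarith
      set a := y - ⌈y⌉ with ha
      set b := y' - ⌈y'⌉ with hb
      have hab : b + 1 - a ≤ y' - y := by linarith
      have ha0 : a ≤ 0 := by linarith
      have ha1 : 0 ≤ 1 + a := by linarith
      have hb0 : b ≤ 0 := by linarith
      have hb1 : 0 ≤ 1 + b := by linarith
      rw [abs_le]; constructor <;> nlinarith
    have hr : |(y' - y) * sawtooth y| ≤ (y' - y) / 2 := by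
      rw [abs_mul, abs_of_nonneg (by linarith : 0 ≤ y' - y)]
      nlinarith [abs_sawtooth_le y]
    calc |sawtoothPrimitive y' - sawtoothPrimitive y - (y' - y) * sawtooth y|
        ≤ |sawtoothPrimitive y' - sawtoothPrimitive y| + |(y' - y) * sawtooth y| := abs_sub _ _
      _ ≤ (y' - y) * 1 := by linarith
      _ ≤ _ := by
        apply mul_le_mul_of_nonneg_left _ (by linarith)
        linarith

/-- Abel summation for a bounded sequence against decreasing weights `1 / v j`. -/
lemma abs_sum_sub_div_le {P v : ℕ → ℝ} {B : ℝ} (hP : ∀ j, |P j| ≤ B) (hv0 : 0 < v 0) (k : ℕ)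
    (hv : ∀ j, j < k → v j ≤ v (j + 1)) :
    |∑ j ∈ Finset.range (k + 1), (P (j + 1) - P j) / v j - P (k + 1) / v k|
      ≤ B * (2 / v 0 - 1 / v k) := by
  have hB : 0 ≤ B := (abs_nonneg _).trans (hP 0)
  have hpos : ∀ j, j ≤ k → v 0 ≤ v j := by
    intro j
    induction j with
    | zero => intro _; exact le_rfl
    | succ j ih => intro h; exact (ih (by omega)).trans (hv j (by omega))
  induction k with
  | zero =>
    have : ∑ j ∈ Finset.range (0 + 1), (P (j + 1) - P j) / v j - P (0 + 1) / v 0 = -(P 0 / v 0) := by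
      simp; ring
    rw [this, abs_neg, abs_div, abs_of_pos hv0]
    have : B * (2 / v 0 - 1 / v 0) = B / v 0 := by ring
    rw [this]
    exact div_le_div_of_nonneg_right (hP 0) hv0.le
  | succ k ih =>
    have ih' := ih (fun j hj => hv j (by omega)) (fun j hj => hpos j (by omega))
    have hk : 0 < v k := hv0.trans_le (hpos k (by omega))
    have hk1 : 0 < v (k + 1) := hv0.trans_le (hpos (k + 1) le_rfl)
    rw [Finset.sum_range_succ]
    -- Carrying the boundary term `P (k + 1) / v k` in the statement turns Abel summation into a
    -- recursion: each step adds `P (k + 1)` times the decrease of `1 / v`.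
    have e : ∑ j ∈ Finset.range (k + 1), (P (j + 1) - P j) / v j
          + (P (k + 1 + 1) - P (k + 1)) / v (k + 1) - P (k + 1 + 1) / v (k + 1)
        = (∑ j ∈ Finset.range (k + 1), (P (j + 1) - P j) / v j - P (k + 1) / v k)
          + P (k + 1) * (1 / v k - 1 / v (k + 1)) := by ring
    rw [e]
    have hd : 0 ≤ 1 / v k - 1 / v (k + 1) :=
      sub_nonneg.2 (one_div_le_one_div_of_le hk (hv k (by omega)))
    calc _ ≤ |∑ j ∈ Finset.range (k + 1), (P (j + 1) - P j) / v j - P (k + 1) / v k|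
          + |P (k + 1) * (1 / v k - 1 / v (k + 1))| := abs_add_le _ _
      _ ≤ B * (2 / v 0 - 1 / v k) + B * (1 / v k - 1 / v (k + 1)) := by
        rw [abs_mul, abs_of_nonneg hd]
        gcongr
        exact hP _
      _ = _ := by ring

/-- Sawtooth sums along a convex sequence with increments bounded below. -/
lemma abs_sum_sawtooth_le_of_increments {w : ℕ → ℝ} {η : ℝ} (hη : 0 < η) (k : ℕ)
    (h0 : 0 < k → η ≤ w 1 - w 0)
    (hw : ∀ j, j + 1 < k → w (j + 1) - w j ≤ w (j + 2) - w (j + 1)) :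
    |∑ j ∈ Finset.range k, sawtooth (w j)| ≤ 1 / (4 * η) + 2 * (w k - w 0) + 1 := by
  obtain _ | k := k
  · simp only [Finset.range_zero, Finset.sum_empty, abs_zero, sub_self]
    positivity
  set v : ℕ → ℝ := fun j => w (j + 1) - w j with hvdef
  have hv0 : η ≤ v 0 := h0 (by omega)
  have hpos : ∀ j, j ≤ k → v 0 ≤ v j := by
    intro j
    induction j with
    | zero => intro _; exact le_rfl
    | succ j ih => intro h; exact (ih (by omega)).trans (hw j (by omega))
  have hv0' : 0 < v 0 := hη.trans_le hv0
  have hk : 0 < v k := hv0'.trans_le (hpos k le_rfl)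
  have A := abs_sum_sub_div_le (P := fun j => sawtoothPrimitive (w j)) (v := v) (B := 1 / 8)
    (fun j => abs_sawtoothPrimitive_le _) hv0' k (fun j hj => hw j (by omega))
  have A' : |∑ j ∈ Finset.range (k + 1), (sawtoothPrimitive (w (j + 1)) - sawtoothPrimitive (w j)) / v j|
      ≤ 1 / (4 * η) := by
    have h1 : |sawtoothPrimitive (w (k + 1)) / v k| ≤ 1 / 8 * (1 / v k) := by
      rw [abs_div, abs_of_pos hk, div_eq_mul_one_div]
      gcongr
      exact abs_sawtoothPrimitive_le _
    have h2 := abs_sub_abs_le_abs_sub (∑ j ∈ Finset.range (k + 1),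
      (sawtoothPrimitive (w (j + 1)) - sawtoothPrimitive (w j)) / v j)
      (sawtoothPrimitive (w (k + 1)) / v k)
    have h3 : 1 / v 0 ≤ 1 / η := one_div_le_one_div_of_le hη hv0
    have h4 : 1 / (4 * η) = 1 / 4 * (1 / η) := by field_simp
    rw [h4]
    have h5 : 1 / 8 * (2 / v 0 - 1 / v k) = 1 / 4 * (1 / v 0) - 1 / 8 * (1 / v k) := by ring
    rw [h5] at A
    linarith
  -- Each sawtooth value is replaced by a difference quotient of the primitive. The replacement
  -- errors telescope to the total change of `w` and of its ceiling.
  have Bd : |∑ j ∈ Finset.range (k + 1), (sawtooth (w j)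
      - (sawtoothPrimitive (w (j + 1)) - sawtoothPrimitive (w j)) / v j)|
      ≤ (w (k + 1) - w 0) + (⌈w (k + 1)⌉ - ⌈w 0⌉) := by
    refine (Finset.abs_sum_le_sum_abs _ _).trans ?_
    have : ∀ j ∈ Finset.range (k + 1), |sawtooth (w j)
        - (sawtoothPrimitive (w (j + 1)) - sawtoothPrimitive (w j)) / v j|
        ≤ (w (j + 1) - w j) + ((⌈w (j + 1)⌉ : ℝ) - ⌈w j⌉) := by
      intro j hj
      have hvj : 0 < v j := hv0'.trans_le (hpos j (by simp at hj; omega))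
      have := abs_sawtoothPrimitive_sub_le (y := w j) (y' := w (j + 1)) (by
        have : 0 < w (j + 1) - w j := hvj
        linarith)
      have e : sawtooth (w j) - (sawtoothPrimitive (w (j + 1)) - sawtoothPrimitive (w j)) / v j
          = -((sawtoothPrimitive (w (j + 1)) - sawtoothPrimitive (w j)
            - (w (j + 1) - w j) * sawtooth (w j)) / v j) := by
        have : w (j + 1) - w j = v j := rfl
        rw [this]; field_simp; ring
      rw [e, abs_neg, abs_div, abs_of_pos hvj, div_le_iff₀ hvj]
      calc _ ≤ _ := this
        _ = _ := by
          have : w (j + 1) - w j = v j := rfl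
          rw [this]; ring
    refine (Finset.sum_le_sum this).trans ?_
    rw [Finset.sum_add_distrib, Finset.sum_range_sub, Finset.sum_range_sub (fun j => (⌈w j⌉ : ℝ))]
  have hceil : (⌈w (k + 1)⌉ : ℝ) - ⌈w 0⌉ ≤ w (k + 1) - w 0 + 1 := by
    have := Int.ceil_lt_add_one (w (k + 1))
    have := Int.le_ceil (w 0)
    linarith
  rw [Finset.sum_sub_distrib] at Bd
  have := abs_sub_abs_le_abs_sub (∑ j ∈ Finset.range (k + 1), sawtooth (w j))
    (∑ j ∈ Finset.range (k + 1), (sawtoothPrimitive (w (j + 1)) - sawtoothPrimitive (w j)) / v j)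
  linarith

/-- Sawtooth sums along an increasing uniformly convex sequence. -/
lemma abs_sum_sawtooth_le_of_monotone {w : ℕ → ℝ} {μ : ℝ} (hμ : 0 < μ) (k : ℕ)
    (h0 : 0 < k → 0 ≤ w 1 - w 0)
    (hw : ∀ j, j + 1 < k → w (j + 1) - w j + μ ≤ w (j + 2) - w (j + 1)) :
    |∑ j ∈ Finset.range k, sawtooth (w j)| ≤ 2 + 1 / √μ + 2 * (w k - w 0) := by
  have hinc : ∀ j, j < k → (j : ℝ) * μ ≤ w (j + 1) - w j := by
    intro j
    induction j with
    | zero => intro h; simpa using h0 h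
    | succ j ih =>
      intro h
      have := ih (by omega)
      have := hw j (by omega)
      push_cast
      linarith
  have hsq : 0 < √μ := Real.sqrt_pos.2 hμ
  -- Balance: the first 1/√μ terms are bounded trivially, and afterwards every increment is at least
  -- J μ ≥ √μ, so the remaining terms also cost a multiple of 1/√μ.
  set J := ⌈1 / √μ⌉₊ with hJ
  have hJ1 : 1 / √μ ≤ J := Nat.le_ceil _
  have hJ2 : (J : ℝ) < 1 / √μ + 1 := Nat.ceil_lt_add_one (by positivity)
  have hmono : ∀ i j, i ≤ j → j ≤ k → w i ≤ w j := by
    intro i j hij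
    induction j, hij using Nat.le_induction with
    | base => intro _; exact le_rfl
    | succ j hij ih =>
      intro h
      have := ih (by omega)
      have h2 := hinc j (by omega)
      have : 0 ≤ (j : ℝ) * μ := by positivity
      linarith
  rcases le_or_gt k J with hk | hk
  · have h1 := abs_sum_sawtooth_le (Finset.range k) w
    have h2 := hmono 0 k (by omega) le_rfl
    have h3 : (k : ℝ) ≤ J := by exact_mod_cast hk
    have : 0 < 1 / √μ := by positivity
    simp at h1
    norm_num at hJ2 this ⊢
    linarith
  · obtain ⟨l, rfl⟩ := Nat.exists_eq_add_of_lt hk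
    have e : ∑ j ∈ Finset.range (J + l + 1), sawtooth (w j)
        = ∑ j ∈ Finset.range J, sawtooth (w j)
          + ∑ j ∈ Finset.range (l + 1), sawtooth (w (J + j)) := by
      rw [add_assoc, Finset.sum_range_add]
    rw [e]
    have h1 := abs_sum_sawtooth_le (Finset.range J) w
    have h2 := abs_sum_sawtooth_le_of_increments (w := fun j => w (J + j)) hsq (l + 1)
      (by
        intro _
        have h := hinc J (by omega)
        have : √μ ≤ J * μ := by
          calc √μ = 1 / √μ * μ := by
                rw [div_mul_eq_mul_div, one_mul, eq_div_iff hsq.ne', Real.mul_self_sqrt hμ.le]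
            _ ≤ J * μ := by gcongr
        show √μ ≤ w (J + 1) - w (J + 0)
        simpa using this.trans h)
      (by
        intro j hj
        have := hw (J + j) (by omega)
        show w (J + j + 1) - w (J + j) ≤ w (J + j + 2) - w (J + j + 1)
        linarith)
    have h3 := hmono 0 J (by omega) (by omega)
    have h4 : 1 / (4 * √μ) = 1 / 4 * (1 / √μ) := by field_simp
    rw [h4] at h2
    simp only [add_zero, Finset.card_range] at h1 h2
    have h5 := abs_add_le (∑ j ∈ Finset.range J, sawtooth (w j))
      (∑ j ∈ Finset.range (l + 1), sawtooth (w (J + j)))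
    have h6 : w (J + (l + 1)) = w (J + l + 1) := rfl
    rw [h6] at h2
    have h7 : 0 < 1 / √μ := by positivity
    linarith

/-- Sawtooth sums along a decreasing uniformly convex sequence. -/
lemma abs_sum_sawtooth_le_of_antitone {w : ℕ → ℝ} {μ : ℝ} (hμ : 0 < μ) (k : ℕ)
    (h0 : 0 < k → w k - w (k - 1) ≤ 0)
    (hw : ∀ j, j + 1 < k → w (j + 1) - w j + μ ≤ w (j + 2) - w (j + 1)) :
    |∑ j ∈ Finset.range k, sawtooth (w j)| ≤ 3 + 1 / √μ + 2 * (w 0 - w k) := by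
  -- Read backwards, the sequence increases and is still uniformly convex. The reversed sum runs
  -- over the indices 1 to k, and exchanging `w k` for `w 0` costs at most 1, hence 3 in place of 2.
  have h1 := abs_sum_sawtooth_le_of_monotone (w := fun j => w (k - j)) hμ k
    (by intro hk; have := h0 hk; simp only [Nat.sub_zero]; linarith)
    (by
      intro j hj
      have := hw (k - (j + 2)) (by omega)
      have e1 : k - (j + 2) + 1 = k - (j + 1) := by omega
      have e2 : k - (j + 2) + 2 = k - j := by omega
      rw [e1, e2] at this
      show w (k - (j + 1)) - w (k - j) + μ ≤ w (k - (j + 2)) - w (k - (j + 1))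
      linarith)
  simp only [Nat.sub_self, Nat.sub_zero] at h1
  have e : ∑ j ∈ Finset.range k, sawtooth (w (k - j)) = ∑ j ∈ Finset.range k, sawtooth (w (j + 1)) := by
    rw [← Finset.sum_range_reflect]
    apply Finset.sum_congr rfl
    intro j hj
    simp at hj
    congr 2; omega
  rw [e] at h1
  have e2 : ∑ j ∈ Finset.range k, sawtooth (w (j + 1)) - ∑ j ∈ Finset.range k, sawtooth (w j)
      = sawtooth (w k) - sawtooth (w 0) := by
    rw [← Finset.sum_sub_distrib, Finset.sum_range_sub (fun j => sawtooth (w j))]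
  have h3 := abs_le.1 (abs_sawtooth_le (w k))
  have h4 := abs_le.1 (abs_sawtooth_le (w 0))
  rw [abs_le] at h1 ⊢
  constructor <;> linarith

/-! ### Blocks over complete residue systems and the sum inside one Farey arc. -/

/-- Hermite's identity for a complete residue system in arithmetic progression. -/
lemma sum_ceil_add_div {q : ℕ} (hq : 0 < q) {a : ℤ} (ha : IsCoprime a q) (c : ℤ) (y : ℝ) :
    ∑ i ∈ Finset.range q, (⌈y + (a * i + c) / q⌉ : ℝ)
      = ⌈q * y⌉ + (∑ i ∈ Finset.range q, (a * i + c : ℝ) / q + ((q : ℝ) - 1) / 2) := by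
  have hq' : (0 : ℝ) < q := by exact_mod_cast hq
  have hqz : (0 : ℤ) < q := by exact_mod_cast hq
  -- For an integer m, ⌈m/q⌉ = (m + (-m mod q))/q, applied with m = ⌈q y⌉ + a i + c. As a is
  -- invertible modulo q, the residues of `z i` run once through 0, …, q - 1.
  set z : ℕ → ℤ := fun i => -(⌈q * y⌉ + (a * i + c)) with hz
  have key : ∀ i : ℕ, (⌈y + (a * i + c) / q⌉ : ℝ)
      = ((⌈q * y⌉ : ℝ) + (a * i + c)) / q + ((z i % q : ℤ) : ℝ) / q := by
    intro i
    have h1 : ⌈y + (a * i + c) / q⌉ = -(z i / (q : ℤ)) := by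
      have e : y + (a * i + c) / q = -((-(q * y + ((a * i + c : ℤ) : ℝ))) / (q : ℕ)) := by
        push_cast; field_simp
      rw [e, Int.ceil_neg, Int.floor_div_natCast, Int.floor_neg, Int.ceil_add_intCast]
    have h2 : (q : ℤ) * (z i / q) + z i % q = z i := Int.mul_ediv_add_emod _ _
    have h3 : (q : ℝ) * ((z i / (q : ℤ) : ℤ) : ℝ) + ((z i % q : ℤ) : ℝ) = z i := by exact_mod_cast h2
    rw [h1]
    push_cast
    have h4 : ((z i : ℤ) : ℝ) = -((⌈q * y⌉ : ℝ) + (a * i + c)) := by simp [hz]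
    rw [h4] at h3
    field_simp
    linarith
  have hres : ∑ i ∈ Finset.range q, ((z i % q : ℤ) : ℝ) = ∑ r ∈ Finset.range q, (r : ℝ) := by
    have hmaps : ∀ i ∈ Finset.range q, (z i % (q : ℤ)).toNat ∈ Finset.range q := by
      intro i _
      have h1 := Int.emod_nonneg (z i) hqz.ne'
      have h2 := Int.emod_lt_of_pos (z i) hqz
      simp only [Finset.mem_range]; omega
    have hinj : Set.InjOn (fun i => (z i % (q : ℤ)).toNat) (Finset.range q : Set ℕ) := by
      intro i hi j hj hij
      simp only [Finset.coe_range, Set.mem_Iio] at hi hj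
      have h1 := Int.emod_nonneg (z i) hqz.ne'
      have h2 := Int.emod_nonneg (z j) hqz.ne'
      have h3 : z i % q = z j % q := by
        have : (z i % (q : ℤ)).toNat = (z j % (q : ℤ)).toNat := hij
        omega
      have h4 : (q : ℤ) ∣ z i - z j := Int.ModEq.dvd h3.symm
      have h5 : z i - z j = a * ((j : ℤ) - i) := by simp only [hz]; ring
      rw [h5] at h4
      have h6 := ha.symm.dvd_of_dvd_mul_left h4
      have h7 : |((j : ℤ) - i)| < q := by rw [abs_lt]; constructor <;> omega
      have := Int.eq_zero_of_abs_lt_dvd h6 h7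
      omega
    refine Finset.sum_nbij (fun i => (z i % (q : ℤ)).toNat) hmaps hinj
      (Finset.surjOn_of_injOn_of_card_le _ hmaps hinj le_rfl) ?_
    intro i _
    have h1 := Int.emod_nonneg (z i) hqz.ne'
    have : (((z i % (q : ℤ)).toNat : ℤ) : ℝ) = ((z i % (q : ℤ) : ℤ) : ℝ) := by
      rw [Int.toNat_of_nonneg h1]
    rw [← this]; norm_cast
  have hgauss : ∑ r ∈ Finset.range q, (r : ℝ) = q * (q - 1) / 2 := by
    clear * -
    induction q with
    | zero => simp
    | succ n ih => rw [Finset.sum_range_succ, ih]; push_cast; ring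
  rw [Finset.sum_congr rfl fun i _ => key i, Finset.sum_add_distrib, ← Finset.sum_div _ _ (q : ℝ),
    ← Finset.sum_div _ _ (q : ℝ), hres, hgauss, Finset.sum_add_distrib, ← Finset.sum_div]
  simp only [Finset.sum_const, Finset.card_range, nsmul_eq_mul]
  field_simp
  ring

/-- A block sum over a complete residue system, with a perturbation. -/
lemma abs_sum_sawtooth_block_sub_le {q : ℕ} (hq : 0 < q) {a : ℤ} (ha : IsCoprime a q) (c : ℤ)
    {y : ℕ → ℝ} {lo hi z : ℝ} (hy : ∀ i < q, lo ≤ y i ∧ y i ≤ hi) (hz : lo ≤ z ∧ z ≤ hi) :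
    |∑ i ∈ Finset.range q, sawtooth (y i + (a * i + c) / q) - sawtooth (q * z)|
      ≤ (q * hi - q * lo) + ((⌈q * hi⌉ : ℝ) - ⌈q * lo⌉) := by
  have hq' : (0 : ℝ) < q := by exact_mod_cast hq
  -- Ceilings are monotone, so the block is squeezed between those with every `y i` equal to `lo` or
  -- to `hi`, where Hermite's identity is exact.
  have H1 := sum_ceil_add_div hq ha c lo
  have H2 := sum_ceil_add_div hq ha c hi
  have L : ∑ i ∈ Finset.range q, (⌈lo + (a * i + c) / q⌉ : ℝ)
      ≤ ∑ i ∈ Finset.range q, (⌈y i + (a * i + c) / q⌉ : ℝ) := by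
    apply Finset.sum_le_sum
    intro i hi'
    have := (hy i (by simpa using hi')).1
    exact_mod_cast Int.ceil_mono (by linarith)
  have U : ∑ i ∈ Finset.range q, (⌈y i + (a * i + c) / q⌉ : ℝ)
      ≤ ∑ i ∈ Finset.range q, (⌈hi + (a * i + c) / q⌉ : ℝ) := by
    apply Finset.sum_le_sum
    intro i hi'
    have := (hy i (by simpa using hi')).2
    exact_mod_cast Int.ceil_mono (by linarith)
  have L2 : (q : ℝ) * lo ≤ ∑ i ∈ Finset.range q, y i := by
    calc (q : ℝ) * lo = ∑ i ∈ Finset.range q, lo := by simp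
      _ ≤ _ := Finset.sum_le_sum fun i hi' => (hy i (by simpa using hi')).1
  have U2 : ∑ i ∈ Finset.range q, y i ≤ (q : ℝ) * hi := by
    calc _ ≤ ∑ i ∈ Finset.range q, hi :=
          Finset.sum_le_sum fun i hi' => (hy i (by simpa using hi')).2
      _ = _ := by simp
  have zl : (q : ℝ) * lo ≤ q * z := by gcongr; exact hz.1
  have zh : (q : ℝ) * z ≤ q * hi := by gcongr; exact hz.2
  have cl : (⌈(q : ℝ) * lo⌉ : ℝ) ≤ ⌈(q : ℝ) * z⌉ := by exact_mod_cast Int.ceil_mono zl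
  have ch : (⌈(q : ℝ) * z⌉ : ℝ) ≤ ⌈(q : ℝ) * hi⌉ := by exact_mod_cast Int.ceil_mono zh
  unfold sawtooth
  rw [Finset.sum_add_distrib, Finset.sum_sub_distrib, Finset.sum_add_distrib]
  simp only [Finset.sum_const, Finset.card_range, nsmul_eq_mul]
  rw [abs_le]; constructor <;> linarith

lemma sum_range_mul_eq_sum_sum {M : Type*} [AddCommMonoid M] (f : ℕ → M) (K q : ℕ) :
    ∑ n ∈ Finset.range (K * q), f n = ∑ j ∈ Finset.range K, ∑ i ∈ Finset.range q, f (j * q + i) := by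
  induction K with
  | zero => simp
  | succ K ih => rw [Finset.sum_range_succ, ← ih, Nat.succ_mul, Finset.sum_range_add]

lemma add_mul_le_of_forall_add_le {d : ℕ → ℝ} {lam : ℝ} {m : ℕ}
    (hd : ∀ n, n + 1 ≤ m → d n + lam ≤ d (n + 1)) (k n : ℕ) (hnk : n + k ≤ m) :
    d n + k * lam ≤ d (n + k) := by
  induction k with
  | zero => simp
  | succ k ih =>
    have := ih (by omega)
    have := hd (n + k) (by omega)
    push_cast
    rw [← add_assoc]
    linarith

/-- Sawtooth sum over full blocks of length `q`, on a stretch where the slopes are on one side of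
`a / q` and close to it. -/
lemma abs_sum_sawtooth_arc_le {φ : ℕ → ℝ} {q Q : ℕ} (hq : 0 < q) (hqQ : q ≤ Q) {a : ℤ}
    (ha : IsCoprime a q) (K : ℕ)
    (hd : ∀ n, n + 1 ≤ K * q →
      φ (n + 1) - φ n + 1 / (Q : ℝ) ^ 3 ≤ φ (n + 2) - φ (n + 1))
    (hs : (∀ n, n ≤ K * q → 0 ≤ φ (n + 1) - φ n - a / q ∧
        φ (n + 1) - φ n - a / q ≤ 1 / (q * Q)) ∨
      (∀ n, n ≤ K * q → φ (n + 1) - φ n - a / q ≤ 0 ∧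
        -(1 / (q * Q)) ≤ φ (n + 1) - φ n - a / q)) :
    |∑ n ∈ Finset.range (K * q), sawtooth (φ n)| ≤ 9 * ((Q / q : ℝ) * √(Q / q)) := by
  have hq' : (0 : ℝ) < q := by exact_mod_cast hq
  have hQ' : (0 : ℝ) < Q := by exact_mod_cast (hq.trans_le hqQ)
  have hX : (1 : ℝ) ≤ Q / q := by rw [le_div_iff₀ hq']; simpa using hqQ
  have hsX : (1 : ℝ) ≤ √(Q / q) := Real.one_le_sqrt.2 hX
  -- Without the linear part a n / q the slopes have one sign and size at most 1/(qQ). The linear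
  -- part runs through the residues modulo q on each block, so a block sum is close to the sawtooth
  -- of `w j`.
  set g : ℕ → ℝ := fun n => φ n - a / q * n with hg
  have hgd : ∀ n, g (n + 1) - g n = φ (n + 1) - φ n - a / q := by
    intro n; simp only [hg]; push_cast; ring
  set w : ℕ → ℝ := fun j => q * g (j * q) with hw
  -- the length of the stretch is controlled by the curvature
  have hlen : ((K * q : ℕ) : ℝ) * (1 / (Q : ℝ) ^ 3) ≤ 1 / (q * Q) := by
    have := add_mul_le_of_forall_add_le (d := fun n => φ (n + 1) - φ n) hd (K * q) 0 (by simp)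
    simp only [zero_add] at this
    rcases hs with hs | hs
    · have h1 := hs 0 (by omega)
      have h2 := hs (K * q) le_rfl
      simp only [zero_add] at h1
      linarith [h1.1, h2.2]
    · have h1 := hs 0 (by omega)
      have h2 := hs (K * q) le_rfl
      simp only [zero_add] at h1
      linarith [h1.2, h2.1]
  have hlen2 : ((K * q : ℕ) : ℝ) ≤ Q ^ 2 / q := by
    rw [mul_one_div, div_le_iff₀ (by positivity)] at hlen
    calc _ ≤ _ := hlen
      _ = _ := by field_simp
  have hsum : ∀ m n, g (m + n) - g m = ∑ i ∈ Finset.range n, (g (m + i + 1) - g (m + i)) := by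
    intro m n
    exact (Finset.sum_range_sub (fun i => g (m + i)) n).symm
  -- At most Q²/q terms, each slope at most 1/(qQ), and a factor q from the definition of `w`.
  have hTV : |w K - w 0| ≤ Q / q := by
    have h1 : |g (0 + K * q) - g 0| ≤ (K * q : ℕ) * (1 / (q * Q) : ℝ) := by
      rw [hsum]
      refine (Finset.abs_sum_le_sum_abs _ _).trans ?_
      calc _ ≤ ∑ i ∈ Finset.range (K * q), (1 / (q * Q) : ℝ) := by
            apply Finset.sum_le_sum
            intro i hi
            simp only [Finset.mem_range] at hi
            rw [hgd, zero_add, abs_le]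
            have hβ : (0 : ℝ) < 1 / (q * Q) := by positivity
            rcases hs with hs | hs
            · have := hs i hi.le
              constructor <;> linarith [this.1, this.2]
            · have := hs i hi.le
              constructor <;> linarith [this.1, this.2]
        _ = _ := by simp
    simp only [hw, zero_mul]
    rw [← mul_sub, abs_mul, abs_of_pos hq']
    rw [zero_add] at h1
    calc q * |g (K * q) - g 0| ≤ q * ((Q ^ 2 / q) * (1 / (q * Q) : ℝ)) := by
          gcongr
          exact h1.trans (by gcongr)
      _ = Q / q := by field_simp
  -- From one block to the next each of the q slopes grows by at least q/Q³; the sum over the block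
  -- and the factor q in `w` make it q³/Q³.
  have hconv : ∀ j, j + 1 < K →
      w (j + 1) - w j + (q : ℝ) ^ 3 / Q ^ 3 ≤ w (j + 2) - w (j + 1) := by
    intro j hj
    have e1 : w (j + 1) - w j
        = q * ∑ i ∈ Finset.range q, (φ (j * q + i + 1) - φ (j * q + i) - a / q) := by
      simp only [hw]
      rw [← mul_sub, Nat.succ_mul, hsum]
      simp only [hgd]
    have e2 : w (j + 2) - w (j + 1)
        = q * ∑ i ∈ Finset.range q,
          (φ (j * q + i + q + 1) - φ (j * q + i + q) - a / q) := by
      simp only [hw]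
      have e : (j + 2) * q = (j + 1) * q + q := by ring
      rw [← mul_sub, e, hsum]
      simp only [hgd]
      congr 1
      apply Finset.sum_congr rfl
      intro i _
      have : (j + 1) * q + i = j * q + i + q := by ring
      rw [this]
    have hb : (j + 2) * q ≤ K * q := Nat.mul_le_mul_right _ (by omega)
    have hb2 : (j + 2) * q = j * q + 2 * q := by ring
    have e3 : ∑ i ∈ Finset.range q, ((φ (j * q + i + 1) - φ (j * q + i) - a / q) + q * (1 / (Q : ℝ) ^ 3))
        ≤ ∑ i ∈ Finset.range q, (φ (j * q + i + q + 1) - φ (j * q + i + q) - a / q) := by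
      apply Finset.sum_le_sum
      intro i hi
      simp only [Finset.mem_range] at hi
      have := add_mul_le_of_forall_add_le (d := fun n => φ (n + 1) - φ n) hd q (j * q + i)
        (by omega)
      linarith
    rw [Finset.sum_add_distrib] at e3
    simp only [Finset.sum_const, Finset.card_range, nsmul_eq_mul] at e3
    rw [e1, e2]
    calc _ = q * (∑ i ∈ Finset.range q, (φ (j * q + i + 1) - φ (j * q + i) - a / q)
          + q * (q * (1 / (Q : ℝ) ^ 3))) := by ring
      _ ≤ _ := by gcongr
  have hμ : (0 : ℝ) < (q : ℝ) ^ 3 / Q ^ 3 := by positivity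
  have hμs : 1 / √((q : ℝ) ^ 3 / Q ^ 3) = (Q / q : ℝ) * √(Q / q) := by
    have : (q : ℝ) ^ 3 / Q ^ 3 = ((Q / q : ℝ) * √(Q / q))⁻¹ ^ 2 := by
      rw [inv_pow, mul_pow, Real.sq_sqrt (by positivity)]
      field_simp
    rw [this, Real.sqrt_sq (by positivity)]
    simp
  have hw_sum : |∑ j ∈ Finset.range K, sawtooth (w j)|
      ≤ 3 + (Q / q : ℝ) * √(Q / q) + 2 * (Q / q) := by
    rw [← hμs]
    rcases hs with hs | hs
    · have := abs_sum_sawtooth_le_of_monotone hμ K (by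
        intro hK
        simp only [hw]
        rw [← mul_sub, zero_mul, one_mul]
        apply mul_nonneg hq'.le
        have := hsum 0 q
        rw [zero_add] at this
        rw [this]
        apply Finset.sum_nonneg
        intro i hi
        simp only [Finset.mem_range] at hi
        rw [hgd, zero_add]
        exact (hs i (hi.le.trans (Nat.le_mul_of_pos_left _ hK))).1) hconv
      linarith [le_abs_self (w K - w 0)]
    · have := abs_sum_sawtooth_le_of_antitone hμ K (by
        intro hK
        simp only [hw]
        rw [← mul_sub]
        apply mul_nonpos_of_nonneg_of_nonpos hq'.le
        have e : K * q = (K - 1) * q + q := by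
          obtain ⟨k, rfl⟩ : ∃ k, K = k + 1 := ⟨K - 1, by omega⟩
          simp; ring
        rw [e, hsum]
        apply Finset.sum_nonpos
        intro i hi
        simp only [Finset.mem_range] at hi
        rw [hgd]
        exact (hs _ (by omega)).1) hconv
      linarith [neg_abs_le (w K - w 0)]
  -- Because `g` is monotone on the stretch, the errors of the individual blocks telescope.
  have hblock : |∑ n ∈ Finset.range (K * q), sawtooth (φ n) - ∑ j ∈ Finset.range K, sawtooth (w j)|
      ≤ |w K - w 0| + (|w K - w 0| + 1) := by
    rw [sum_range_mul_eq_sum_sum, ← Finset.sum_sub_distrib]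
    refine (Finset.abs_sum_le_sum_abs _ _).trans ?_
    have hphi : ∀ j i, φ (j * q + i) = g (j * q + i) + ((a : ℝ) * i + ((a * (j * q) : ℤ) : ℝ)) / q := by
      intro j i
      simp only [hg]; push_cast; field_simp; ring
    have hceil : ∀ x y : ℝ, |(⌈x⌉ : ℝ) - ⌈y⌉| ≤ |x - y| + 1 := by
      intro x y
      have := Int.le_ceil x
      have := Int.le_ceil y
      have := Int.ceil_lt_add_one x
      have := Int.ceil_lt_add_one y
      have := abs_le.1 (le_refl |x - y|)
      rw [abs_le]; constructor <;> linarith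
    have hbd : ∀ j i, j < K → i < q → j * q + i < K * q := by
      intro j i hj hi
      have : (j + 1) * q ≤ K * q := Nat.mul_le_mul_right _ (by omega)
      rw [Nat.succ_mul] at this
      omega
    rcases hs with hs | hs
    · have hmono : ∀ m n, m + n ≤ K * q → g m ≤ g (m + n) := by
        intro m n hmn
        rw [← sub_nonneg, hsum]
        apply Finset.sum_nonneg
        intro i hi
        simp only [Finset.mem_range] at hi
        rw [hgd]
        exact (hs _ (by omega)).1
      have hj : ∀ j ∈ Finset.range K, |∑ i ∈ Finset.range q, sawtooth (φ (j * q + i)) - sawtooth (w j)|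
          ≤ (w (j + 1) - w j) + ((⌈w (j + 1)⌉ : ℝ) - ⌈w j⌉) := by
        intro j hj
        simp only [Finset.mem_range] at hj
        simp only [hphi]
        have hb : (j + 1) * q ≤ K * q := Nat.mul_le_mul_right _ (by omega)
        have e : (j + 1) * q = j * q + q := by ring
        apply abs_sum_sawtooth_block_sub_le hq ha
        · intro i hi
          have := hbd j i hj hi
          refine ⟨hmono _ _ (by omega), ?_⟩
          have h2 := hmono (j * q + i) (q - i) (by omega)
          have e2 : j * q + i + (q - i) = (j + 1) * q := by omega
          rwa [e2] at h2
        · refine ⟨le_rfl, ?_⟩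
          rw [e]
          exact hmono _ _ (by omega)
      refine (Finset.sum_le_sum hj).trans ?_
      rw [Finset.sum_add_distrib, Finset.sum_range_sub, Finset.sum_range_sub (fun j => (⌈w j⌉ : ℝ))]
      exact add_le_add (le_abs_self _) ((le_abs_self _).trans (hceil _ _))
    · have hmono : ∀ m n, m + n ≤ K * q → g (m + n) ≤ g m := by
        intro m n hmn
        rw [← sub_nonpos, hsum]
        apply Finset.sum_nonpos
        intro i hi
        simp only [Finset.mem_range] at hi
        rw [hgd]
        exact (hs _ (by omega)).1
      have hj : ∀ j ∈ Finset.range K, |∑ i ∈ Finset.range q, sawtooth (φ (j * q + i)) - sawtooth (w j)|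
          ≤ (w j - w (j + 1)) + ((⌈w j⌉ : ℝ) - ⌈w (j + 1)⌉) := by
        intro j hj
        simp only [Finset.mem_range] at hj
        simp only [hphi]
        have hb : (j + 1) * q ≤ K * q := Nat.mul_le_mul_right _ (by omega)
        have e : (j + 1) * q = j * q + q := by ring
        apply abs_sum_sawtooth_block_sub_le hq ha
        · intro i hi
          have := hbd j i hj hi
          refine ⟨?_, hmono _ _ (by omega)⟩
          have h2 := hmono (j * q + i) (q - i) (by omega)
          have e2 : j * q + i + (q - i) = (j + 1) * q := by omega
          rwa [e2] at h2
        · refine ⟨?_, le_rfl⟩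
          rw [e]
          exact hmono _ _ (by omega)
      refine (Finset.sum_le_sum hj).trans ?_
      rw [Finset.sum_add_distrib, Finset.sum_range_sub', Finset.sum_range_sub' (fun j => (⌈w j⌉ : ℝ)),
        abs_sub_comm]
      exact add_le_add (le_abs_self _) ((le_abs_self _).trans (hceil _ _))
  have h1 := abs_sub_abs_le_abs_sub (∑ n ∈ Finset.range (K * q), sawtooth (φ n))
    (∑ j ∈ Finset.range K, sawtooth (w j))
  have h2 : (Q / q : ℝ) * 1 ≤ (Q / q : ℝ) * √(Q / q) := by gcongr
  linarith

/-- Crude bound for a single block of length `q`. -/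
lemma abs_sum_sawtooth_single_block_le {φ : ℕ → ℝ} {q : ℕ} (hq : 0 < q) {a : ℤ}
    (ha : IsCoprime a q) {β Δ : ℝ} (h0 : |φ 1 - φ 0 - a / q| ≤ β)
    (hd : ∀ i < q, φ 1 - φ 0 ≤ φ (i + 1) - φ i ∧ φ (i + 1) - φ i ≤ φ 1 - φ 0 + Δ) :
    |∑ i ∈ Finset.range q, sawtooth (φ i)| ≤ 3 / 2 + 4 * q ^ 2 * (β + Δ) := by
  have hq' : (0 : ℝ) < q := by exact_mod_cast hq
  have hβ : 0 ≤ β := (abs_nonneg _).trans h0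
  have hΔ : 0 ≤ Δ := by have := hd 0 hq; simp only [zero_add] at this; linarith [this.2]
  have h0' := abs_le.1 h0
  set g : ℕ → ℝ := fun n => φ n - a / q * n with hg
  have hgi : ∀ i, i ≤ q → |g i - g 0| ≤ i * (β + Δ) := by
    intro i
    induction i with
    | zero => simp
    | succ i ih =>
      intro hi
      have h1 := ih (by omega)
      have h2 := hd i (by omega)
      have e : g (i + 1) - g 0 = (g i - g 0) + (φ (i + 1) - φ i - a / q) := by
        simp only [hg]; push_cast; ring
      rw [e]
      refine (abs_add_le _ _).trans ?_
      have : |φ (i + 1) - φ i - a / q| ≤ β + Δ := by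
        rw [abs_le]; constructor <;> linarith [h2.1, h2.2]
      push_cast
      linarith
  have hphi : ∀ i : ℕ, φ i = g i + ((a : ℝ) * i + ((0 : ℤ) : ℝ)) / q := by
    intro i; simp only [hg]; push_cast; field_simp; ring
  -- Every slope is within β + Δ of a/q, so `g` stays within q(β + Δ) of its initial value. The
  -- resulting window of width 2q²(β + Δ) is counted once directly and once through the ceilings.
  have B := abs_sum_sawtooth_block_sub_le hq ha 0 (y := g) (lo := g 0 - q * (β + Δ))
    (hi := g 0 + q * (β + Δ)) (z := g 0)
    (by
      intro i hi
      have h1 := abs_le.1 (hgi i hi.le)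
      have h2 : (i : ℝ) * (β + Δ) ≤ q * (β + Δ) := by gcongr
      constructor <;> linarith [h1.1, h1.2])
    (by
      have : 0 ≤ q * (β + Δ) := by positivity
      constructor <;> linarith)
  simp only [← hphi] at B
  have h1 := abs_sub_abs_le_abs_sub (∑ i ∈ Finset.range q, sawtooth (φ i)) (sawtooth (q * g 0))
  have h2 := abs_sawtooth_le (q * g 0)
  have h3 := Int.ceil_lt_add_one (q * (g 0 + q * (β + Δ)))
  have h4 := Int.le_ceil (q * (g 0 - q * (β + Δ)))
  nlinarith

/-! ### Farey dissection of the slopes and the van der Corput estimate. -/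

/-- The one-sided Farey arc of order `Q` at `a / q`. -/
def fareyArc (Q : ℕ) (A : (ℕ × ℤ) × Bool) : Set ℝ :=
  if A.2 then Set.Icc ((A.1.2 : ℝ) / A.1.1) (A.1.2 / A.1.1 + 1 / (A.1.1 * Q))
  else Set.Icc ((A.1.2 : ℝ) / A.1.1 - 1 / (A.1.1 * Q)) (A.1.2 / A.1.1)

lemma fareyArc_ordConnected (Q : ℕ) (A : (ℕ × ℤ) × Bool) : (fareyArc Q A).OrdConnected := by
  unfold fareyArc
  split_ifs <;> exact Set.ordConnected_Icc

lemma abs_sub_le_of_mem_fareyArc {Q : ℕ} {A : (ℕ × ℤ) × Bool} {x : ℝ} (h : x ∈ fareyArc Q A) :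
    |x - A.1.2 / A.1.1| ≤ 1 / (A.1.1 * Q) := by
  have hβ : (0 : ℝ) ≤ 1 / (A.1.1 * Q) := by positivity
  unfold fareyArc at h
  rw [abs_le]
  split_ifs at h <;> constructor <;> linarith [h.1, h.2]

/-- Sum of the sawtooth along the passage through one Farey arc. -/
lemma exists_sum_sawtooth_passage_le {φ : ℕ → ℝ} {Q N n₀ : ℕ} {T : ℝ} {A : (ℕ × ℤ) × Bool}
    (hq : 0 < A.1.1) (hqQ : A.1.1 ≤ Q) (ha : IsCoprime A.1.2 (A.1.1 : ℤ))
    (hd : ∀ n, n + 1 < N → φ (n + 1) - φ n + 1 / (Q : ℝ) ^ 3 ≤ φ (n + 2) - φ (n + 1))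
    (hT : ∀ n < N, φ (n + 1) - φ n ≤ T) (hn₀ : n₀ < N)
    (hmem : φ (n₀ + 1) - φ n₀ ∈ fareyArc Q A) :
    ∃ n₁, n₀ < n₁ ∧ n₁ ≤ N ∧ (∀ n, n₁ ≤ n → n < N → φ (n + 1) - φ n ∉ fareyArc Q A) ∧
      |∑ n ∈ Finset.Ico n₀ n₁, sawtooth (φ n)|
        ≤ 15 * ((Q / A.1.1 : ℝ) * √(Q / A.1.1))
          + (Q + 4 * Q ^ 2 * (T - (φ (n₀ + 1) - φ n₀)))
          - (if n₁ < N then Q + 4 * Q ^ 2 * (T - (φ (n₁ + 1) - φ n₁)) else 0) := by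
  obtain ⟨⟨q, a⟩, σ⟩ := A
  simp only at hq hqQ ha ⊢
  have hq' : (0 : ℝ) < q := by exact_mod_cast hq
  have hQ' : (0 : ℝ) < Q := by exact_mod_cast (hq.trans_le hqQ)
  have hqQ' : (q : ℝ) ≤ Q := by exact_mod_cast hqQ
  have hX : (1 : ℝ) ≤ Q / q := by rw [le_div_iff₀ hq']; simpa using hqQ'
  have hsX : (1 : ℝ) ≤ √(Q / q) := Real.one_le_sqrt.2 hX
  have hXX : (1 : ℝ) ≤ Q / q * √(Q / q) := by nlinarith
  have hlam : (0 : ℝ) < 1 / (Q : ℝ) ^ 3 := by positivity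
  have hmono : ∀ m n, m ≤ n → n < N → φ (m + 1) - φ m ≤ φ (n + 1) - φ n := by
    intro m n hmn
    induction n, hmn using Nat.le_induction with
    | base => intro _; exact le_rfl
    | succ n hmn ih =>
      intro h
      have := ih (by omega)
      have := hd n h
      linarith
  -- Sampling every q-th index, the blocks up to the last sample in the arc lie entirely in it. Only
  -- the next block, during which the arc is left or the sequence ends, needs crude treatment.
  have hex : ∃ k, ¬ (n₀ + k * q < N ∧ φ (n₀ + k * q + 1) - φ (n₀ + k * q) ∈ fareyArc Q ((q, a), σ)) :=
    ⟨N, fun h => by have := Nat.le_mul_of_pos_right N hq; omega⟩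
  classical
  obtain ⟨k, hk, hkmin⟩ : ∃ k, ¬ (n₀ + k * q < N ∧
      φ (n₀ + k * q + 1) - φ (n₀ + k * q) ∈ fareyArc Q ((q, a), σ)) ∧
      ∀ j < k, (n₀ + j * q < N ∧ φ (n₀ + j * q + 1) - φ (n₀ + j * q) ∈ fareyArc Q ((q, a), σ)) :=
    ⟨Nat.find hex, Nat.find_spec hex, fun j hj => not_not.1 (Nat.find_min hex hj)⟩
  obtain _ | K := k
  · exact absurd ⟨by simpa using hn₀, by simpa using hmem⟩ hk
  obtain ⟨hKN, hKmem⟩ := hkmin K (by omega)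
  have hin : ∀ n, n ≤ K * q → φ (n₀ + n + 1) - φ (n₀ + n) ∈ fareyArc Q ((q, a), σ) := by
    intro n hn
    exact (fareyArc_ordConnected Q _).out hmem hKmem
      ⟨hmono _ _ (by omega) (by omega), hmono _ _ (by omega) (by omega)⟩
  have main := abs_sum_sawtooth_arc_le (φ := fun n => φ (n₀ + n)) hq hqQ ha K
    (fun n hn => hd (n₀ + n) (by omega))
    (by
      cases σ
      · right
        intro n hn
        have := hin n hn
        simp only [fareyArc, Bool.false_eq_true, if_false] at this
        constructor
        · show φ (n₀ + n + 1) - φ (n₀ + n) - a / q ≤ 0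
          linarith [this.2]
        · show -(1 / (q * Q : ℝ)) ≤ φ (n₀ + n + 1) - φ (n₀ + n) - a / q
          linarith [this.1]
      · left
        intro n hn
        have := hin n hn
        simp only [fareyArc, if_true] at this
        constructor
        · show 0 ≤ φ (n₀ + n + 1) - φ (n₀ + n) - a / q
          linarith [this.1]
        · show φ (n₀ + n + 1) - φ (n₀ + n) - a / q ≤ 1 / (q * Q : ℝ)
          linarith [this.2])
  have hsplit : ∀ m, n₀ + K * q ≤ m → ∑ n ∈ Finset.Ico n₀ m, sawtooth (φ n)
      = ∑ n ∈ Finset.range (K * q), sawtooth (φ (n₀ + n))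
        + ∑ n ∈ Finset.Ico (n₀ + K * q) m, sawtooth (φ n) := by
    intro m hm
    rw [← Finset.sum_Ico_consecutive _ (Nat.le_add_right n₀ (K * q)) hm, Finset.sum_Ico_eq_sum_range]
    simp
  have hE0 : 0 ≤ T - (φ (n₀ + 1) - φ n₀) := sub_nonneg.2 (hT n₀ hn₀)
  rcases lt_or_ge N (n₀ + K * q + q) with hcut | hfull
  -- The sequence ends inside the last block: fewer than Q terms remain, paid by the summand Q of
  -- the potential Q + 4Q²(T - slope). This can happen only once.
  · refine ⟨N, hn₀, le_rfl, fun n h1 h2 => absurd h1 (by omega), ?_⟩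
    rw [if_neg (lt_irrefl N), hsplit N hKN.le]
    have h2 := abs_sum_sawtooth_le (Finset.Ico (n₀ + K * q) N) φ
    have h3 : ((Finset.Ico (n₀ + K * q) N).card : ℝ) ≤ Q := by
      rw [Nat.card_Ico]
      exact_mod_cast (by omega : N - (n₀ + K * q) ≤ Q)
    refine (abs_add_le _ _).trans ?_
    have : 0 ≤ 4 * (Q : ℝ) ^ 2 * (T - (φ (n₀ + 1) - φ n₀)) := by positivity
    linarith
  · have hout : ∀ n, n₀ + K * q + q ≤ n → n < N → φ (n + 1) - φ n ∉ fareyArc Q ((q, a), σ) := by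
      intro n h1 h2 h3
      refine hk ⟨by rw [Nat.succ_mul]; omega, ?_⟩
      rw [Nat.succ_mul, ← add_assoc]
      exact (fareyArc_ordConnected Q _).out hmem h3
        ⟨hmono _ _ (by omega) (by omega), hmono _ _ (by omega) (by omega)⟩
    refine ⟨n₀ + K * q + q, by omega, hfull, hout, ?_⟩
    have hlast : φ (n₀ + K * q + (q - 1) + 1) - φ (n₀ + K * q + (q - 1)) ≤ T := hT _ (by omega)
    have hblk := abs_sum_sawtooth_single_block_le (φ := fun n => φ (n₀ + K * q + n)) hq ha
      (β := 1 / (q * Q))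
      (Δ := (φ (n₀ + K * q + (q - 1) + 1) - φ (n₀ + K * q + (q - 1)))
        - (φ (n₀ + K * q + 1) - φ (n₀ + K * q)))
      (abs_sub_le_of_mem_fareyArc hKmem)
      (by
        intro i hi
        constructor
        · exact hmono (n₀ + K * q) (n₀ + K * q + i) (by omega) (by omega)
        · have := hmono (n₀ + K * q + i) (n₀ + K * q + (q - 1)) (by omega) (by omega)
          show φ (n₀ + K * q + i + 1) - φ (n₀ + K * q + i) ≤ φ (n₀ + K * q + 1) - φ (n₀ + K * q) + _
          linarith)
    have e2 : ∑ n ∈ Finset.Ico (n₀ + K * q) (n₀ + K * q + q), sawtooth (φ n)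
        = ∑ i ∈ Finset.range q, sawtooth (φ (n₀ + K * q + i)) := by
      rw [Finset.sum_Ico_eq_sum_range]; simp
    rw [hsplit _ (Nat.le_add_right _ _), e2]
    refine (abs_add_le _ _).trans ?_
    set Δ := (φ (n₀ + K * q + (q - 1) + 1) - φ (n₀ + K * q + (q - 1)))
        - (φ (n₀ + K * q + 1) - φ (n₀ + K * q)) with hΔ
    have hΔ0 : 0 ≤ Δ := by
      have := hmono (n₀ + K * q) (n₀ + K * q + (q - 1)) (by omega) (by omega)
      linarith
    have hb2 : (4 : ℝ) * q ^ 2 * (1 / (q * Q) + Δ) ≤ 4 + 4 * Q ^ 2 * Δ := by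
      have h1 : (4 : ℝ) * q ^ 2 * (1 / (q * Q)) = 4 * (q / Q) := by field_simp
      have h2 : (q : ℝ) / Q ≤ 1 := by rw [div_le_one hQ']; exact hqQ'
      have h3 : (q : ℝ) ^ 2 * Δ ≤ Q ^ 2 * Δ := by gcongr
      rw [mul_add, h1]
      linarith
    have h0K := hmono n₀ (n₀ + K * q) (by omega) hKN
    -- The slope increase over the exit block is paid by the drop of the potential between `n₀` and
    -- the exit index, so these costs do not accumulate from arc to arc.
    have hfinal : 4 * (Q : ℝ) ^ 2 * Δ ≤ (Q + 4 * Q ^ 2 * (T - (φ (n₀ + 1) - φ n₀)))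
        - (if n₀ + K * q + q < N then Q + 4 * Q ^ 2 * (T - (φ (n₀ + K * q + q + 1)
          - φ (n₀ + K * q + q))) else (0 : ℝ)) := by
      split_ifs with hlt
      · have h4 := hmono (n₀ + K * q + (q - 1)) (n₀ + K * q + q) (by omega) hlt
        have : Δ ≤ (φ (n₀ + K * q + q + 1) - φ (n₀ + K * q + q)) - (φ (n₀ + 1) - φ n₀) := by linarith
        have : 4 * (Q : ℝ) ^ 2 * Δ ≤ 4 * (Q : ℝ) ^ 2 *
          ((φ (n₀ + K * q + q + 1) - φ (n₀ + K * q + q)) - (φ (n₀ + 1) - φ n₀)) := by gcongr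
        linarith
      · have : Δ ≤ T - (φ (n₀ + 1) - φ n₀) := by linarith
        have : 4 * (Q : ℝ) ^ 2 * Δ ≤ 4 * (Q : ℝ) ^ 2 * (T - (φ (n₀ + 1) - φ n₀)) := by gcongr
        linarith
    linarith

/-- Slopes increase and arcs are intervals, so an arc once left is never entered again. The
induction removes it from `F`. The potentials telescope, leaving only the initial one beside the
cost of the arcs. -/
lemma abs_sum_sawtooth_le_sum_arcs {φ : ℕ → ℝ} {Q N : ℕ} {T : ℝ}
    (hd : ∀ n, n + 1 < N → φ (n + 1) - φ n + 1 / (Q : ℝ) ^ 3 ≤ φ (n + 2) - φ (n + 1))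
    (hT : ∀ n < N, φ (n + 1) - φ n ≤ T) (F : Finset ((ℕ × ℤ) × Bool)) :
    ∀ n₀ < N, (∀ A ∈ F, 0 < A.1.1 ∧ A.1.1 ≤ Q ∧ IsCoprime A.1.2 (A.1.1 : ℤ)) →
    (∀ n, n₀ ≤ n → n < N → ∃ A ∈ F, φ (n + 1) - φ n ∈ fareyArc Q A) →
    |∑ n ∈ Finset.Ico n₀ N, sawtooth (φ n)|
      ≤ ∑ A ∈ F, 15 * ((Q / A.1.1 : ℝ) * √(Q / A.1.1))
        + (Q + 4 * Q ^ 2 * (T - (φ (n₀ + 1) - φ n₀))) := by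
  induction F using Finset.strongInduction with
  | H F ih =>
    intro n₀ hn₀ hF hcov
    obtain ⟨A, hA, hmem⟩ := hcov n₀ le_rfl hn₀
    obtain ⟨hq, hqQ, ha⟩ := hF A hA
    obtain ⟨n₁, h01, h1N, hout, hsum⟩ := exists_sum_sawtooth_passage_le hq hqQ ha hd hT hn₀ hmem
    rw [← Finset.sum_erase_add F _ hA, ← Finset.sum_Ico_consecutive _ h01.le h1N]
    refine (abs_add_le _ _).trans ?_
    split_ifs at hsum with hlt
    · have := ih (F.erase A) (Finset.erase_ssubset hA) n₁ hlt
        (fun B hB => hF B (Finset.mem_of_mem_erase hB))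
        (by
          intro n hn hnN
          obtain ⟨B, hB, hBm⟩ := hcov n (by omega) hnN
          refine ⟨B, Finset.mem_erase.2 ⟨?_, hB⟩, hBm⟩
          rintro rfl
          exact hout n hn hnN hBm)
      linarith
    · have h : n₁ = N := by omega
      subst h
      have : 0 ≤ ∑ B ∈ F.erase A, 15 * ((Q / B.1.1 : ℝ) * √(Q / B.1.1)) :=
        Finset.sum_nonneg fun _ _ => by positivity
      simp only [Finset.Ico_self, Finset.sum_empty, abs_zero]
      linarith

lemma sum_one_div_sqrt_le (Q : ℕ) : ∑ q ∈ Finset.Icc 1 Q, 1 / √(q : ℝ) ≤ 2 * √(Q : ℝ) := by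
  induction Q with
  | zero => simp
  | succ n ih =>
    rw [Finset.sum_Icc_succ_top (by omega)]
    have h1 : (0 : ℝ) < √((n + 1 : ℕ) : ℝ) := Real.sqrt_pos.2 (by positivity)
    have h2 : (√((n + 1 : ℕ) : ℝ)) ^ 2 = n + 1 := by rw [Real.sq_sqrt (by positivity)]; push_cast; ring
    have h3 : (√(n : ℝ)) ^ 2 = n := Real.sq_sqrt (by positivity)
    have h4 : 0 ≤ √(n : ℝ) := Real.sqrt_nonneg _
    have : 1 / √((n + 1 : ℕ) : ℝ) ≤ 2 * √((n + 1 : ℕ) : ℝ) - 2 * √(n : ℝ) := by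
      rw [div_le_iff₀ h1]
      nlinarith [sq_nonneg (√((n + 1 : ℕ) : ℝ) - √(n : ℝ))]
    linarith

lemma sum_one_div_mul_sqrt_le (Q : ℕ) :
    ∑ q ∈ Finset.Icc 1 Q, 1 / (q * √(q : ℝ)) ≤ 3 := by
  rcases Nat.eq_zero_or_pos Q with rfl | hQ
  · simp
  -- The subtracted 2/√Q is the integral of the tail; with it the induction closes.
  have : ∑ q ∈ Finset.Icc 1 Q, 1 / (q * √(q : ℝ)) ≤ 3 - 2 / √(Q : ℝ) := by
    induction Q, hQ using Nat.le_induction with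
    | base => norm_num
    | succ n hn ih =>
      rw [Finset.sum_Icc_succ_top (by omega)]
      have hn' : (0 : ℝ) < n := by exact_mod_cast hn
      have h1 : (0 : ℝ) < √((n + 1 : ℕ) : ℝ) := Real.sqrt_pos.2 (by positivity)
      have h2 : (√((n + 1 : ℕ) : ℝ)) ^ 2 = n + 1 := by rw [Real.sq_sqrt (by positivity)]; push_cast; ring
      have h3 : (√(n : ℝ)) ^ 2 = n := Real.sq_sqrt (by positivity)
      have h4 : 0 < √(n : ℝ) := Real.sqrt_pos.2 hn'
      have : 1 / (((n + 1 : ℕ) : ℝ) * √((n + 1 : ℕ) : ℝ)) ≤ 2 / √(n : ℝ) - 2 / √((n + 1 : ℕ) : ℝ) := by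
        have e : ((n + 1 : ℕ) : ℝ) = (√((n + 1 : ℕ) : ℝ)) ^ 2 := by rw [h2]; push_cast; ring
        set u := √((n + 1 : ℕ) : ℝ) with hu
        set v := √(n : ℝ) with hv
        rw [e, div_sub_div _ _ h4.ne' h1.ne', div_le_div_iff₀ (by positivity) (by positivity)]
        have huv : v ≤ u := by
          apply Real.sqrt_le_sqrt; push_cast; linarith
        have h5 : (u - v) * (u + v) = 1 := by nlinarith
        have h6 : 1 ≤ (u - v) * (2 * u) := by nlinarith
        have h7 : v * u * 1 ≤ v * u * ((u - v) * (2 * u)) := by gcongr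
        have h8 : v * u * ((u - v) * (2 * u)) ≤ (2 * u - v * 2) * (u ^ 2 * u) := by
          have : 0 ≤ (u - v) * (u * u) := by
            have : 0 ≤ u - v := by linarith
            positivity
          nlinarith
        linarith
      linarith
  have h : 0 ≤ 2 / √(Q : ℝ) := by positivity
  linarith

/-- A van der Corput type estimate for the sawtooth along a uniformly convex sequence. Only a lower
bound for the second differences and the total range of the slopes enter. -/
theorem abs_sum_sawtooth_le_of_second_difference {φ : ℕ → ℝ} {Q N : ℕ} {s L : ℝ} (hQ : 0 < Q)
    (hL : 0 ≤ L)
    (hd : ∀ n, n + 1 < N → φ (n + 1) - φ n + 1 / (Q : ℝ) ^ 3 ≤ φ (n + 2) - φ (n + 1))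
    (hs : ∀ n < N, s ≤ φ (n + 1) - φ n ∧ φ (n + 1) - φ n ≤ s + L) :
    |∑ n ∈ Finset.range N, sawtooth (φ n)| ≤ 300 * (L * Q ^ 2 + Q * √Q) := by
  have hQ' : (1 : ℝ) ≤ Q := by exact_mod_cast hQ
  have hQ0 : (0 : ℝ) < Q := by linarith
  rcases Nat.eq_zero_or_pos N with rfl | hN
  · simp only [Finset.range_zero, Finset.sum_empty, abs_zero]; positivity
  -- The fractions a/q with q ≤ Q and a within 1 of [q s, q (s + L)]; Dirichlet approximation of a
  -- slope in [s, s + L] yields no others.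
  set G : Finset (ℕ × ℤ) := (Finset.Icc 1 Q).biUnion fun q =>
    (Finset.Icc ⌈q * s - 1⌉ ⌊q * (s + L) + 1⌋).image fun a => (q, a) with hG
  have hGmem : ∀ p : ℕ × ℤ, p ∈ G ↔ (1 ≤ p.1 ∧ p.1 ≤ Q) ∧
      (⌈p.1 * s - 1⌉ ≤ p.2 ∧ p.2 ≤ ⌊p.1 * (s + L) + 1⌋) := by
    rintro ⟨q, a⟩
    simp only [hG, Finset.mem_biUnion, Finset.mem_image, Finset.mem_Icc, Prod.mk.injEq]
    constructor
    · rintro ⟨q', h1, a', h2, rfl, rfl⟩; exact ⟨h1, h2⟩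
    · rintro ⟨h1, h2⟩; exact ⟨q, h1, a, h2, rfl, rfl⟩
  classical
  set F : Finset ((ℕ × ℤ) × Bool) :=
    (G.filter fun p => IsCoprime p.2 (p.1 : ℤ)) ×ˢ Finset.univ with hF
  have hcover : ∀ n, 0 ≤ n → n < N → ∃ A ∈ F, φ (n + 1) - φ n ∈ fareyArc Q A := by
    intro n _ hn
    set x := φ (n + 1) - φ n with hx
    obtain ⟨r, hr, hrd⟩ := Real.exists_rat_abs_sub_le_and_den_le x hQ
    have hden : (0 : ℝ) < r.den := by exact_mod_cast r.den_pos
    have hr' : |x - r.num / r.den| ≤ 1 / (r.den * Q) := by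
      have e : ((r.num : ℝ) / r.den) = (r : ℝ) := by exact_mod_cast (Rat.num_div_den r)
      rw [e]
      refine hr.trans ?_
      apply one_div_le_one_div_of_le (by positivity)
      nlinarith
    have hr2 : |r.den * x - r.num| ≤ 1 := by
      have : r.den * x - r.num = r.den * (x - r.num / r.den) := by field_simp
      rw [this, abs_mul, abs_of_pos hden]
      calc (r.den : ℝ) * |x - r.num / r.den| ≤ r.den * (1 / (r.den * Q)) := by gcongr
        _ = 1 / Q := by field_simp
        _ ≤ 1 := by rw [div_le_one hQ0]; exact hQ'
    have hxs := hs n hn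
    have hpG : (r.den, r.num) ∈ G.filter fun p => IsCoprime p.2 (p.1 : ℤ) := by
      rw [Finset.mem_filter, hGmem]
      have h1 := abs_le.1 hr2
      refine ⟨⟨⟨r.den_pos, hrd⟩, ?_, ?_⟩, ?_⟩
      · rw [Int.ceil_le]
        have : (r.den : ℝ) * s ≤ r.den * x := by gcongr; exact hxs.1
        show (r.den : ℝ) * s - 1 ≤ r.num
        linarith [h1.2]
      · rw [Int.le_floor]
        have : (r.den : ℝ) * x ≤ r.den * (s + L) := by gcongr; exact hxs.2
        show (r.num : ℝ) ≤ r.den * (s + L) + 1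
        linarith [h1.1]
      · rw [Int.isCoprime_iff_nat_coprime]
        simpa using r.reduced
    have h3 := abs_le.1 hr'
    rcases le_total ((r.num : ℝ) / r.den) x with h | h
    · refine ⟨((r.den, r.num), true), Finset.mem_product.2 ⟨hpG, Finset.mem_univ _⟩, ?_⟩
      simp only [fareyArc, if_true]
      exact ⟨h, by linarith [h3.2]⟩
    · refine ⟨((r.den, r.num), false), Finset.mem_product.2 ⟨hpG, Finset.mem_univ _⟩, ?_⟩
      simp only [fareyArc, Bool.false_eq_true, if_false]
      exact ⟨by linarith [h3.1], h⟩
  have key := abs_sum_sawtooth_le_sum_arcs (T := s + L) hd (fun n hn => (hs n hn).2) F 0 hN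
    (by
      intro A hA
      have hA1 := (Finset.mem_product.1 hA).1
      rw [Finset.mem_filter, hGmem] at hA1
      exact ⟨hA1.1.1.1, hA1.1.1.2, hA1.2⟩) hcover
  rw [← Finset.range_eq_Ico] at key
  refine key.trans ?_
  -- Each denominator admits at most q L + 3 numerators once coprimality is dropped, and the two
  -- sides of a fraction double 15 to 30.
  have hcost : ∑ A ∈ F, 15 * ((Q / A.1.1 : ℝ) * √(Q / A.1.1))
      ≤ ∑ q ∈ Finset.Icc 1 Q, (q * L + 3) * (30 * ((Q / q : ℝ) * √(Q / q))) := by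
    rw [hF, Finset.sum_product]
    simp only [Finset.sum_const, Finset.card_univ, Fintype.card_bool, nsmul_eq_mul]
    calc _ ≤ ∑ p ∈ G, ((2 : ℕ) : ℝ) * (15 * ((Q / p.1 : ℝ) * √(Q / p.1))) :=
          Finset.sum_le_sum_of_subset_of_nonneg (Finset.filter_subset _ _)
            (fun _ _ _ => by positivity)
      _ ≤ ∑ q ∈ Finset.Icc 1 Q, ∑ p ∈ (Finset.Icc ⌈q * s - 1⌉ ⌊q * (s + L) + 1⌋).image
            fun a => (q, a), ((2 : ℕ) : ℝ) * (15 * ((Q / p.1 : ℝ) * √(Q / p.1))) := by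
          rw [hG, Finset.sum_biUnion]
          intro q _ q' _ hqq'
          simp only [Function.onFun]
          rw [Finset.disjoint_left]
          rintro ⟨u, v⟩ h1 h2
          simp only [Finset.mem_image, Prod.mk.injEq] at h1 h2
          obtain ⟨_, _, rfl, _⟩ := h1
          obtain ⟨_, _, h3, _⟩ := h2
          exact hqq' h3.symm
      _ ≤ _ := by
          apply Finset.sum_le_sum
          intro q hq
          rw [Finset.sum_image (fun a _ b _ h => (Prod.mk.inj h).2)]
          simp only [Finset.sum_const, nsmul_eq_mul, Int.card_Icc]
          have hc : (((⌊q * (s + L) + 1⌋ + 1 - ⌈q * s - 1⌉).toNat : ℕ) : ℝ) ≤ q * L + 3 := by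
            have h1 := Int.floor_le (q * (s + L) + 1)
            have h2 := Int.le_ceil (q * s - 1)
            have hqL : (0 : ℝ) ≤ q * L := by positivity
            rcases le_total 0 (⌊q * (s + L) + 1⌋ + 1 - ⌈q * s - 1⌉) with h | h
            · have : (((⌊q * (s + L) + 1⌋ + 1 - ⌈q * s - 1⌉).toNat : ℤ) : ℝ)
                  = ((⌊q * (s + L) + 1⌋ + 1 - ⌈q * s - 1⌉ : ℤ) : ℝ) := by rw [Int.toNat_of_nonneg h]
              have h4 : (((⌊q * (s + L) + 1⌋ + 1 - ⌈q * s - 1⌉).toNat : ℕ) : ℝ)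
                  = (((⌊q * (s + L) + 1⌋ + 1 - ⌈q * s - 1⌉).toNat : ℤ) : ℝ) := by norm_cast
              rw [h4, this]; push_cast; linarith
            · rw [Int.toNat_of_nonpos h]; simp; linarith
          calc _ ≤ (q * L + 3) * (((2 : ℕ) : ℝ) * (15 * ((Q / q : ℝ) * √(Q / q)))) := by gcongr
            _ = _ := by push_cast; ring
  -- The numerators counted by q L leave ∑ q^(-1/2) ≤ 2√Q, hence L Q²; the constant 3 leaves the
  -- bounded sum ∑ q^(-3/2), hence Q^(3/2).
  have hsum : ∑ q ∈ Finset.Icc 1 Q, (q * L + 3) * (30 * ((Q / q : ℝ) * √(Q / q)))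
      ≤ 60 * L * Q ^ 2 + 270 * (Q * √Q) := by
    have e : ∀ q ∈ Finset.Icc 1 Q, (q * L + 3) * (30 * ((Q / q : ℝ) * √(Q / q)))
        = 30 * L * (Q * √Q) * (1 / √(q : ℝ)) + 90 * (Q * √Q) * (1 / (q * √(q : ℝ))) := by
      intro q hq
      have hq0 : (0 : ℝ) < q := by
        have := (Finset.mem_Icc.1 hq).1
        exact_mod_cast this
      rw [Real.sqrt_div hQ0.le]
      have : 0 < √(q : ℝ) := Real.sqrt_pos.2 hq0
      field_simp
      ring
    rw [Finset.sum_congr rfl e, Finset.sum_add_distrib, ← Finset.mul_sum, ← Finset.mul_sum]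
    have h1 := sum_one_div_sqrt_le Q
    have h2 := sum_one_div_mul_sqrt_le Q
    calc _ ≤ 30 * L * (Q * √Q) * (2 * √Q) + 90 * (Q * √Q) * 3 := by gcongr
      _ = 60 * L * (Q * (√Q * √Q)) + 270 * (Q * √Q) := by ring
      _ = _ := by rw [Real.mul_self_sqrt hQ0.le]; ring
  have h0 := (hs 0 hN).1
  have h5 : 4 * (Q : ℝ) ^ 2 * (s + L - (φ (0 + 1) - φ 0)) ≤ 4 * (Q : ℝ) ^ 2 * L := by
    gcongr; linarith
  have h6 : (Q : ℝ) ≤ Q * √Q := by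
    have := Real.one_le_sqrt.2 hQ'
    nlinarith
  have h7 : 0 ≤ L * (Q : ℝ) ^ 2 := by positivity
  nlinarith

/-! ### From local supporting parabolas to second differences. -/

/-- If at every interior point `f` has locally a supporting parabola with leading coefficient
larger than `m₀`, then `f - m₀ x²` is convex. -/
lemma convexOn_sub_sq_of_local_support {f : ℝ → ℝ} {u v m₀ : ℝ} (hf : ContinuousOn f (Set.Icc u v))
    (h : ∀ x ∈ Set.Ioo u v, ∃ s m, m₀ < m ∧
      ∀ᶠ y in nhds x, f x + s * (y - x) + m * (y - x) ^ 2 ≤ f y) :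
    ConvexOn ℝ (Set.Icc u v) fun x => f x - m₀ * x ^ 2 := by
  set φ : ℝ → ℝ := fun x => f x - m₀ * x ^ 2 with hφ
  have hφc : ContinuousOn φ (Set.Icc u v) := hf.sub (by fun_prop)
  refine LinearOrder.convexOn_of_lt (convex_Icc u v) ?_
  intro x hx y hy hxy a b ha hb hab
  -- If `φ` rises above a chord, its excess `ψ` has a positive maximum at an interior point t. There
  -- the supporting parabola makes the average of ψ(t ± r) exceed ψ(t) by at least (m - m₀) r²,
  -- which is absurd.
  by_contra! hcon
  simp only [smul_eq_mul] at hcon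
  set A := (φ y - φ x) / (y - x) with hA
  have hAe : A * (y - x) = φ y - φ x := div_mul_cancel₀ _ (by linarith)
  set ψ : ℝ → ℝ := fun t => φ t - (φ x + A * (t - x)) with hψ
  have hsub : Set.Icc x y ⊆ Set.Icc u v := Set.Icc_subset_Icc hx.1 hy.2
  have hψc : ContinuousOn ψ (Set.Icc x y) := (hφc.mono hsub).sub (by fun_prop)
  obtain ⟨t, ht, hmax⟩ := isCompact_Icc.exists_isMaxOn (Set.nonempty_Icc.2 hxy.le) hψc
  have hz : a * x + b * y ∈ Set.Icc x y :=
    convex_Icc x y (Set.left_mem_Icc.2 hxy.le) (Set.right_mem_Icc.2 hxy.le) ha.le hb.le hab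
  have hpos : 0 < ψ t := by
    refine lt_of_lt_of_le ?_ (hmax hz)
    simp only [hψ]
    have e1 : a * x + b * y - x = b * (y - x) := by
      have : a = 1 - b := by linarith
      rw [this]; ring
    have e2 : a * φ x = φ x - b * φ x := by
      have : a = 1 - b := by linarith
      rw [this]; ring
    rw [e1]
    nlinarith
  have htx : x ≠ t := by rintro rfl; simp [hψ] at hpos
  have hty : t ≠ y := by rintro rfl; simp only [hψ] at hpos; linarith
  have hto : t ∈ Set.Ioo x y := ⟨lt_of_le_of_ne ht.1 htx, lt_of_le_of_ne ht.2 hty⟩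
  obtain ⟨s, m, hm, hloc⟩ := h t ⟨hx.1.trans_lt hto.1, hto.2.trans_le hy.2⟩
  have hnear := hloc.and (Ioo_mem_nhds hto.1 hto.2)
  obtain ⟨ε, hε, hball⟩ := Metric.eventually_nhds_iff.1 hnear
  have key : ∀ r, |r| < ε → 0 ≥ (s - 2 * m₀ * t - A) * r + (m - m₀) * r ^ 2 := by
    intro r hr
    have h1 := hball (y := t + r) (by simpa [Real.dist_eq] using hr)
    have h2 : ψ (t + r) ≤ ψ t := hmax ⟨h1.2.1.le, h1.2.2.le⟩
    simp only [hψ, hφ] at h2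
    have h3 := h1.1
    simp only [add_sub_cancel_left] at h3
    nlinarith
  have k1 := key (ε / 2) (by rw [abs_of_pos (by linarith)]; linarith)
  have k2 := key (-(ε / 2)) (by rw [abs_neg, abs_of_pos (by linarith)]; linarith)
  have : 0 < (m - m₀) * (ε / 2) ^ 2 := mul_pos (by linarith) (by positivity)
  nlinarith

/-- Midpoint convexity of `f - m₀ x²`. It stands in for Taylor's formula, so no second derivative of
`f` is needed. -/
lemma second_difference_ge_of_local_support {f : ℝ → ℝ} {x h m₀ : ℝ} (hh : 0 < h)
    (hf : ContinuousOn f (Set.Icc (x - h) (x + h)))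
    (hs : ∀ y ∈ Set.Ioo (x - h) (x + h), ∃ s m, m₀ < m ∧
      ∀ᶠ z in nhds y, f y + s * (z - y) + m * (z - y) ^ 2 ≤ f z) :
    2 * m₀ * h ^ 2 ≤ f (x + h) - 2 * f x + f (x - h) := by
  have hcv := convexOn_sub_sq_of_local_support hf hs
  have := hcv.2 (Set.left_mem_Icc.2 (by linarith)) (Set.right_mem_Icc.2 (by linarith))
    (by norm_num : (0 : ℝ) ≤ 1 / 2) (by norm_num : (0 : ℝ) ≤ 1 / 2) (by norm_num)
  simp only [smul_eq_mul] at this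
  have e : 1 / 2 * (x - h) + 1 / 2 * (x + h) = x := by ring
  rw [e] at this
  nlinarith

/-- The right derivative is a subgradient; it serves as a slope for boundary functions that are only
known to be convex. -/
lemma ConvexOn.add_rightDeriv_mul_le {f : ℝ → ℝ} {I : Set ℝ} (hf : ConvexOn ℝ I f)
    {x y : ℝ} (hxi : x ∈ interior I) (hy : y ∈ I) :
    f x + derivWithin f (Set.Ioi x) x * (y - x) ≤ f y := by
  rcases lt_trichotomy x y with h | rfl | h
  · have := hf.rightDeriv_le_slope_of_mem_interior hxi hy h
    rw [slope_def_field, le_div_iff₀ (by linarith)] at this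
    linarith
  · simp
  · have h1 := hf.slope_le_leftDeriv_of_mem_interior hy hxi h
    have h2 := hf.leftDeriv_le_rightDeriv_of_mem_interior hxi
    rw [slope_def_field, div_le_iff₀ (by linarith)] at h1
    nlinarith

lemma Finset.exists_eq_Icc_of_ordConnected {S : Finset ℤ} (hS : (S : Set ℤ).OrdConnected)
    (hne : S.Nonempty) : ∃ M : ℤ, ∃ N : ℕ, S = Finset.Icc M (M + N) := by
  refine ⟨S.min' hne, (S.max' hne - S.min' hne).toNat, ?_⟩
  have h0 := S.min'_le_max' hne
  ext n
  rw [Finset.mem_Icc, Int.toNat_of_nonneg (by omega)]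
  constructor
  · intro hn
    have := S.min'_le n hn
    have := S.le_max' n hn
    omega
  · rintro ⟨h1, h2⟩
    exact hS.out (S.min'_mem hne) (S.max'_mem hne) ⟨h1, by omega⟩

lemma sum_Icc_int_eq_sum_range {α : Type*} [AddCommMonoid α] (f : ℤ → α) (M : ℤ) (N : ℕ) :
    ∑ n ∈ Finset.Icc M (M + N), f n = ∑ i ∈ Finset.range (N + 1), f (M + i) := by
  symm
  refine Finset.sum_nbij (fun i : ℕ => M + i) ?_ ?_ ?_ (fun _ _ => rfl)
  · intro i hi
    simp only [Finset.mem_range] at hi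
    simp only [Finset.mem_Icc]; omega
  · intro i _ j _ hij
    simpa using hij
  · intro n hn
    simp only [Finset.coe_Icc, Set.mem_Icc] at hn
    refine ⟨(n - M).toNat, ?_, ?_⟩
    · simp only [Finset.coe_range, Set.mem_Iio]; omega
    · simp only; omega

/-- The van der Corput type estimate over an interval of integers, with real curvature bound. -/
lemma abs_sum_sawtooth_le_of_int {φ : ℤ → ℝ} {S : Finset ℤ} (hS : (S : Set ℤ).OrdConnected)
    {lam s L : ℝ} (hlam : 0 < lam) (hlam1 : lam ≤ 1) (hL : 0 ≤ L)
    (hd : ∀ n ∈ S, n + 2 ∈ S → lam ≤ φ (n + 2) - 2 * φ (n + 1) + φ n)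
    (hs : ∀ n ∈ S, n + 1 ∈ S → s ≤ φ (n + 1) - φ n ∧ φ (n + 1) - φ n ≤ s + L) :
    |∑ n ∈ S, sawtooth (φ n)| ≤ 1200 * (L * (1 / lam) ^ (2 / 3 : ℝ) + (1 / lam) ^ (1 / 2 : ℝ)) := by
  have hl1 : 1 ≤ 1 / lam := by rw [le_div_iff₀ hlam]; linarith
  have hl0 : 0 < 1 / lam := by linarith
  rcases S.eq_empty_or_nonempty with rfl | hne
  · simp only [Finset.sum_empty, abs_zero]; positivity
  obtain ⟨M, N, rfl⟩ := Finset.exists_eq_Icc_of_ordConnected hS hne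
  -- The order of the Farey dissection is λ^(-1/3) rounded up: this keeps 1/Q³ ≤ λ, and λ ≤ 1
  -- ensures Q ≤ 2y.
  set y := (1 / lam) ^ (1 / 3 : ℝ) with hy
  have hy1 : 1 ≤ y := Real.one_le_rpow hl1 (by norm_num)
  have hy0 : 0 < y := by linarith
  have hy2 : y ^ 2 = (1 / lam) ^ (2 / 3 : ℝ) := by
    rw [hy, ← Real.rpow_natCast, ← Real.rpow_mul hl0.le]; norm_num
  have hy3 : y ^ 3 = 1 / lam := by
    rw [hy, ← Real.rpow_natCast, ← Real.rpow_mul hl0.le]; norm_num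
  have hys : y * √y = (1 / lam) ^ (1 / 2 : ℝ) := by
    rw [hy, Real.sqrt_eq_rpow, ← Real.rpow_mul hl0.le, ← Real.rpow_add hl0]; norm_num
  set Q := ⌈y⌉₊ with hQ
  have hQy : y ≤ Q := Nat.le_ceil _
  have hQ2 : (Q : ℝ) ≤ 2 * y := by
    have : (Q : ℝ) < y + 1 := Nat.ceil_lt_add_one hy0.le
    linarith
  have hQpos : 0 < Q := Nat.ceil_pos.2 hy0
  have hQ3 : 1 / (Q : ℝ) ^ 3 ≤ lam := by
    rw [div_le_iff₀ (by positivity)]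
    calc (1 : ℝ) = lam * y ^ 3 := by rw [hy3]; field_simp
      _ ≤ lam * (Q : ℝ) ^ 3 := by gcongr
  -- N + 1 points have only N slopes; the last point is split off at cost 1/2.
  rw [sum_Icc_int_eq_sum_range, Finset.sum_range_succ]
  have main := abs_sum_sawtooth_le_of_second_difference (φ := fun i : ℕ => φ (M + i)) (N := N)
    (s := s) (L := L) hQpos hL
    (by
      intro n hn
      have := hd (M + n) (by simp only [Finset.mem_Icc]; omega)
        (by simp only [Finset.mem_Icc]; omega)
      have e1 : M + ((n + 1 : ℕ) : ℤ) = M + n + 1 := by push_cast; ring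
      have e2 : M + ((n + 2 : ℕ) : ℤ) = M + n + 2 := by push_cast; ring
      simp only [e1, e2]
      linarith)
    (by
      intro n hn
      have := hs (M + n) (by simp only [Finset.mem_Icc]; omega)
        (by simp only [Finset.mem_Icc]; omega)
      have e1 : M + ((n + 1 : ℕ) : ℤ) = M + n + 1 := by push_cast; ring
      simp only [e1]
      exact this)
  have hlast := abs_sawtooth_le (φ (M + N))
  refine (abs_add_le _ _).trans ?_
  have b1 : (Q : ℝ) ^ 2 ≤ 4 * y ^ 2 := by nlinarith
  have hsq2 : √(2 * y) ≤ 3 / 2 * √y := by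
    rw [show (3 / 2 : ℝ) = √((3 / 2) ^ 2) by rw [Real.sqrt_sq]; norm_num, ← Real.sqrt_mul (by norm_num)]
    apply Real.sqrt_le_sqrt; nlinarith
  have b2 : (Q : ℝ) * √Q ≤ 3 * (y * √y) := by
    calc (Q : ℝ) * √Q ≤ (2 * y) * √(2 * y) := by gcongr
      _ ≤ (2 * y) * (3 / 2 * √y) := by gcongr
      _ = _ := by ring
  have b3 : L * (Q : ℝ) ^ 2 ≤ L * (4 * y ^ 2) := by gcongr
  have b4 : 1 ≤ y * √y := by
    have := Real.one_le_sqrt.2 hy1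
    nlinarith
  rw [← hy2, ← hys]
  linarith

lemma card_le_of_ordConnected {S : Finset ℤ} {B : ℝ} (hB : 0 ≤ B)
    (h : ∀ m ∈ S, ∀ n ∈ S, ((n - m : ℤ) : ℝ) ≤ B) : (S.card : ℝ) ≤ B + 1 := by
  rcases S.eq_empty_or_nonempty with rfl | hne
  · simp; linarith
  have h1 := h _ (S.min'_mem hne) _ (S.max'_mem hne)
  have h2 : S ⊆ Finset.Icc (S.min' hne) (S.max' hne) := fun n hn =>
    Finset.mem_Icc.2 ⟨S.min'_le n hn, S.le_max' n hn⟩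
  have h3 := Finset.card_le_card h2
  rw [Int.card_Icc] at h3
  have h0 := S.min'_le_max' hne
  have h4 : (S.card : ℤ) ≤ S.max' hne - S.min' hne + 1 := by omega
  have h5 : (S.card : ℝ) ≤ ((S.max' hne - S.min' hne : ℤ) : ℝ) + 1 := by exact_mod_cast h4
  linarith

/-- Sawtooth sum over the integer points of a dilated arc with curvature at least `m₀`. -/
lemma abs_sum_sawtooth_dilate_le {f : ℝ → ℝ} {R t t' m₀ σ L : ℝ} (hR : 1 ≤ R) {S : Finset ℤ}
    (hS : (S : Set ℤ).OrdConnected) (hm₀ : 0 < m₀) (hm₀R : m₀ ≤ R) (hL : 0 ≤ L)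
    (hf : ∀ m ∈ S, ∀ n ∈ S, ContinuousOn f (Set.Icc ((m - t) / R) ((n - t) / R)))
    (hm : ∀ m ∈ S, ∀ n ∈ S, ∀ x ∈ Set.Ioo ((m - t) / R) ((n - t) / R), ∃ s m, m₀ < m ∧
      ∀ᶠ y in nhds x, f x + s * (y - x) + m * (y - x) ^ 2 ≤ f y)
    (hs : ∀ n ∈ S, n + 1 ∈ S → σ ≤ R * (f (((n + 1 : ℤ) - t) / R) - f ((n - t) / R)) ∧
      R * (f (((n + 1 : ℤ) - t) / R) - f ((n - t) / R)) ≤ σ + L) :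
    |∑ n ∈ S, sawtooth (R * f ((n - t) / R) + t')|
      ≤ 1200 * (L * (R / m₀) ^ (2 / 3 : ℝ) + (R / m₀) ^ (1 / 2 : ℝ)) := by
  have hR0 : 0 < R := by linarith
  have := abs_sum_sawtooth_le_of_int (φ := fun n : ℤ => R * f ((n - t) / R) + t') hS
    (lam := m₀ / R) (s := σ) (L := L) (by positivity) (by rw [div_le_one hR0]; exact hm₀R) hL
    (by
      intro n hn hn2
      have e1 : ((n + 1 : ℤ) - t) / R - 1 / R = (n - t) / R := by push_cast; ring
      have e2 : ((n + 1 : ℤ) - t) / R + 1 / R = ((n + 2 : ℤ) - t) / R := by push_cast; ring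
      have h := second_difference_ge_of_local_support (f := f) (x := ((n + 1 : ℤ) - t) / R)
        (h := 1 / R) (m₀ := m₀) (by positivity)
        (by rw [e1, e2]; exact hf n hn (n + 2) hn2)
        (by rw [e1, e2]; exact hm n hn (n + 2) hn2)
      rw [e1, e2] at h
      have h2 := mul_le_mul_of_nonneg_left h hR0.le
      have e3 : R * (2 * m₀ * (1 / R) ^ 2) = 2 * (m₀ / R) := by field_simp
      have h3 : 0 < m₀ / R := by positivity
      rw [e3] at h2
      linarith)
    (by
      intro n hn hn1
      have := hs n hn hn1
      constructor <;> linarith [this.1, this.2])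
  simpa only [one_div_div] using this

/-! ### Arcs with curvature bounded below. -/

/-- Curvature at least a constant means f'' at least a multiple of max(1, |f'|)³, so steep parts are
strongly convex. A dyadic decomposition by slope therefore gives a convergent geometric series. With
nonnegative slopes, the lower bound for |s| at the left end of a piece persists throughout it. -/
lemma abs_sum_sawtooth_le_of_curved_nonneg {f s : ℝ → ℝ} {I : Set ℝ} {c : ℝ} (hI : I.OrdConnected)
    (hfc : ContinuousOn f I) (hb : ∀ x ∈ I, |f x| ≤ 1)
    (hs : ∀ x ∈ I, ∀ y ∈ I, f x + s x * (y - x) ≤ f y) (hc : 0 < c) (hc1 : c ≤ 1)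
    (hloc : ∀ x ∈ I, ∀ᶠ y in nhds x,
      f x + s x * (y - x) + 2 * c * (max 1 |s x|) ^ 3 * (y - x) ^ 2 ≤ f y)
    {R : ℝ} (hR : 1 ≤ R) (t t' : ℝ) {S : Finset ℤ} (hS : (S : Set ℤ).OrdConnected)
    (hSI : ∀ n ∈ S, ((n : ℝ) - t) / R ∈ I) (hS0 : ∀ n ∈ S, 0 ≤ s (((n : ℝ) - t) / R)) :
    |∑ n ∈ S, sawtooth (R * f ((n - t) / R) + t')| ≤ 7500 / c * R ^ (2 / 3 : ℝ) := by
  have hR0 : 0 < R := by linarith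
  set x : ℤ → ℝ := fun n => ((n : ℝ) - t) / R with hx
  have hxmono : ∀ m n : ℤ, m ≤ n → x m ≤ x n := by
    intro m n h
    have : (m : ℝ) ≤ n := by exact_mod_cast h
    simp only [hx]; gcongr
  have hsmono : ∀ u ∈ I, ∀ v ∈ I, u < v → s u ≤ s v := by
    intro u hu v hv huv
    have h1 := hs u hu v hv
    have h2 := hs v hv u hu
    nlinarith
  have hsn : ∀ m ∈ S, ∀ n ∈ S, m ≤ n → s (x m) ≤ s (x n) := by
    intro m hm n hn h
    rcases (hxmono m n h).eq_or_lt with h | h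
    · rw [h]
    · exact hsmono _ (hSI m hm) _ (hSI n hn) h
  -- a piece on which the slopes lie in `[a, b]` and the curvature is at least `c * τ ^ 3`
  have piece : ∀ (S' : Finset ℤ) (a L τ : ℝ), S' ⊆ S → (S' : Set ℤ).OrdConnected → 0 < τ → 0 ≤ L →
      c * τ ^ 3 ≤ R → (∀ n ∈ S', a ≤ s (x n) ∧ s (x n) ≤ a + L ∧ τ ≤ max 1 |s (x n)|) →
      |∑ n ∈ S', sawtooth (R * f (x n) + t')|
        ≤ 1200 * (L * (R / (c * τ ^ 3)) ^ (2 / 3 : ℝ) + (R / (c * τ ^ 3)) ^ (1 / 2 : ℝ)) := by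
    intro S' a L τ hsub hS' hτ hL hcR hsl
    apply abs_sum_sawtooth_dilate_le hR hS' (by positivity) hcR hL (σ := a)
    · intro m hm n hn
      exact hfc.mono (hI.out (hSI m (hsub hm)) (hSI n (hsub hn)))
    · intro m hm n hn y hy
      have hyI : y ∈ I := hI.out (hSI m (hsub hm)) (hSI n (hsub hn)) ⟨hy.1.le, hy.2.le⟩
      refine ⟨s y, 2 * c * (max 1 |s y|) ^ 3, ?_, hloc y hyI⟩
      have h1 : s (x m) ≤ s y := hsmono _ (hSI m (hsub hm)) _ hyI hy.1
      have h0 : 0 ≤ s (x m) := hS0 m (hsub hm)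
      have h2 : τ ≤ max 1 |s y| := by
        refine (hsl m hm).2.2.trans ?_
        rw [abs_of_nonneg h0, abs_of_nonneg (h0.trans h1)]
        exact max_le_max le_rfl h1
      have h3 : τ ^ 3 ≤ (max 1 |s y|) ^ 3 := by gcongr
      have h4 : 0 < c * τ ^ 3 := by positivity
      have h5 : c * τ ^ 3 ≤ c * (max 1 |s y|) ^ 3 := by gcongr
      linarith
    · intro n hn hn1
      have h1 := hs _ (hSI n (hsub hn)) _ (hSI (n + 1) (hsub hn1))
      have h2 := hs _ (hSI (n + 1) (hsub hn1)) _ (hSI n (hsub hn))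
      have e : ((n + 1 : ℤ) - t) / R - (n - t) / R = 1 / R := by push_cast; ring
      have e' : (n - t) / R - ((n + 1 : ℤ) - t) / R = -(1 / R) := by push_cast; ring
      rw [e] at h1
      rw [e'] at h2
      have h3 := (hsl n hn).1
      have h4 := (hsl (n + 1) hn1).2.1
      have h1' := mul_le_mul_of_nonneg_left h1 hR0.le
      have h2' := mul_le_mul_of_nonneg_left h2 hR0.le
      have e1 : R * (f ((n - t) / R) + s ((n - t) / R) * (1 / R))
          = R * f ((n - t) / R) + s ((n - t) / R) := by field_simp
      have e2 : R * (f (((n + 1 : ℤ) - t) / R) + s (((n + 1 : ℤ) - t) / R) * (-(1 / R)))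
          = R * f (((n + 1 : ℤ) - t) / R) - s (((n + 1 : ℤ) - t) / R) := by field_simp; ring
      rw [e1] at h1'
      rw [e2] at h2'
      simp only [hx] at h3 h4
      constructor <;> linarith
  have hord : ∀ p : ℝ → Prop, (∀ a b z, p a → p b → a ≤ z → z ≤ b → p z) →
      ∀ [DecidablePred fun n : ℤ => p (s (x n))],
      ((S.filter fun n => p (s (x n)) : Finset ℤ) : Set ℤ).OrdConnected := by
    intro p hp _
    constructor
    intro m hm n hn z hz
    simp only [Finset.coe_filter, Set.mem_ofPred_eq] at hm hn ⊢
    have hzS : z ∈ S := hS.out hm.1 hn.1 hz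
    exact ⟨hzS, hp _ _ _ hm.2 hn.2 (hsn m hm.1 z hzS hz.1) (hsn z hzS n hn.1 hz.2)⟩
  have hRp : R ^ (1 / 2 : ℝ) ≤ R ^ (2 / 3 : ℝ) := Real.rpow_le_rpow_of_exponent_le hR (by norm_num)
  have hR23 : 1 ≤ R ^ (2 / 3 : ℝ) := Real.one_le_rpow hR (by norm_num)
  have hc' : (1 : ℝ) ≤ 1 / c := by rw [le_div_iff₀ hc]; linarith
  have hc23 : (1 / c) ^ (2 / 3 : ℝ) ≤ 1 / c := by
    conv_rhs => rw [← Real.rpow_one (1 / c)]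
    exact Real.rpow_le_rpow_of_exponent_le hc' (by norm_num)
  have hc12 : (1 / c) ^ (1 / 2 : ℝ) ≤ 1 / c := by
    conv_rhs => rw [← Real.rpow_one (1 / c)]
    exact Real.rpow_le_rpow_of_exponent_le hc' (by norm_num)
  -- On slopes between 2^k and 2^(k+1) one has L = 2^k and λ = c 8^k / R. The two terms decay like
  -- 2^(-k) and 2^(-3k/2); the weaker decay is kept for both.
  have cost : ∀ k : ℕ, 2 ^ k * (R / (c * (2 ^ k : ℝ) ^ 3)) ^ (2 / 3 : ℝ)
      + (R / (c * (2 ^ k : ℝ) ^ 3)) ^ (1 / 2 : ℝ) ≤ 2 / c * R ^ (2 / 3 : ℝ) * (1 / 2) ^ k := by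
    intro k
    have h2k : (0 : ℝ) < 2 ^ k := by positivity
    have h2k1 : (1 : ℝ) ≤ 2 ^ k := one_le_pow₀ (by norm_num)
    have e : R / (c * (2 ^ k : ℝ) ^ 3) = R * (1 / c) * ((2 ^ k : ℝ)⁻¹) ^ 3 := by field_simp
    have e1 : (((2 ^ k : ℝ)⁻¹) ^ 3) ^ (2 / 3 : ℝ) = ((2 ^ k : ℝ)⁻¹) ^ 2 := by
      rw [← Real.rpow_natCast, ← Real.rpow_natCast, ← Real.rpow_mul (by positivity)]; norm_num
    have e2 : (((2 ^ k : ℝ)⁻¹) ^ 3) ^ (1 / 2 : ℝ) ≤ (2 ^ k : ℝ)⁻¹ := by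
      rw [← Real.rpow_natCast, ← Real.rpow_mul (by positivity)]
      conv_rhs => rw [← Real.rpow_one (2 ^ k : ℝ)⁻¹]
      exact Real.rpow_le_rpow_of_exponent_ge (by positivity) (inv_le_one_of_one_le₀ h2k1) (by norm_num)
    rw [e, Real.mul_rpow (by positivity) (by positivity), Real.mul_rpow (by positivity) (by positivity),
      Real.mul_rpow (by positivity) (by positivity), Real.mul_rpow (by positivity) (by positivity), e1]
    have e3 : (1 / 2 : ℝ) ^ k = (2 ^ k : ℝ)⁻¹ := by rw [one_div, inv_pow]
    rw [e3]
    calc _ ≤ 2 ^ k * (R ^ (2 / 3 : ℝ) * (1 / c) * (2 ^ k : ℝ)⁻¹ ^ 2)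
          + R ^ (2 / 3 : ℝ) * (1 / c) * (2 ^ k : ℝ)⁻¹ := by gcongr
      _ = _ := by field_simp; ring
  classical
  -- The scheme runs while 8^k ≤ R, which keeps λ = c 8^k / R at most 1.
  obtain ⟨J, hJ, hJmin⟩ : ∃ J : ℕ, R < 8 ^ J ∧ ∀ k < J, (8 : ℝ) ^ k ≤ R := by
    have hex := pow_unbounded_of_one_lt R (by norm_num : (1 : ℝ) < 8)
    exact ⟨Nat.find hex, Nat.find_spec hex, fun k hk => not_lt.1 (Nat.find_min hex hk)⟩
  have h8 : ∀ k : ℕ, (8 : ℝ) ^ k = (2 ^ k : ℝ) ^ 3 := by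
    intro k; rw [← pow_mul, mul_comm, pow_mul]; norm_num
  have A : ∀ k, k ≤ J → |∑ n ∈ S.filter fun n => s (x n) < 2 ^ k, sawtooth (R * f (x n) + t')|
      ≤ 2400 / c * R ^ (2 / 3 : ℝ) + 4800 / c * R ^ (2 / 3 : ℝ) * (1 - (1 / 2) ^ k) := by
    intro k
    induction k with
    | zero =>
      intro _
      have := piece (S.filter fun n => s (x n) < 2 ^ 0) 0 1 1 (Finset.filter_subset _ _)
        (hord (fun z => z < 2 ^ 0) (fun a b z _ hb _ hz => hz.trans_lt hb)) one_pos zero_le_one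
        (by linarith)
        (by
          intro n hn
          simp only [Finset.mem_filter, pow_zero] at hn
          exact ⟨hS0 n hn.1, by linarith [hn.2], le_max_left _ _⟩)
      have h2 := cost 0
      simp only [pow_zero, sub_self, mul_zero, add_zero, mul_one, one_pow] at this h2 ⊢
      refine this.trans ?_
      calc _ ≤ 1200 * (2 / c * R ^ (2 / 3 : ℝ)) := by linarith
        _ = _ := by ring
    | succ k ih =>
      intro hk
      have ih := ih (by omega)
      have hsplit : ∑ n ∈ S.filter (fun n => s (x n) < 2 ^ (k + 1)), sawtooth (R * f (x n) + t')
          = ∑ n ∈ S.filter (fun n => s (x n) < 2 ^ k), sawtooth (R * f (x n) + t')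
            + ∑ n ∈ S.filter (fun n => 2 ^ k ≤ s (x n) ∧ s (x n) < 2 ^ (k + 1)),
              sawtooth (R * f (x n) + t') := by
        rw [← Finset.sum_filter_add_sum_filter_not (S.filter (fun n => s (x n) < 2 ^ (k + 1)))
          (fun n => s (x n) < 2 ^ k), Finset.filter_filter, Finset.filter_filter]
        have h2 : (2 : ℝ) ^ k ≤ 2 ^ (k + 1) := pow_le_pow_right₀ (by norm_num) (by omega)
        congr 1
        · apply Finset.sum_congr _ (fun _ _ => rfl)
          ext n
          simp only [Finset.mem_filter]
          exact ⟨fun h => ⟨h.1, h.2.2⟩, fun h => ⟨h.1, h.2.trans_le h2, h.2⟩⟩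
        · apply Finset.sum_congr _ (fun _ _ => rfl)
          ext n
          simp only [Finset.mem_filter, not_lt]
          tauto
      have hp := piece (S.filter fun n => 2 ^ k ≤ s (x n) ∧ s (x n) < 2 ^ (k + 1)) (2 ^ k) (2 ^ k)
        (2 ^ k) (Finset.filter_subset _ _)
        (hord (fun z => 2 ^ k ≤ z ∧ z < 2 ^ (k + 1))
          (fun a b z ha hb h1 h2 => ⟨ha.1.trans h1, h2.trans_lt hb.2⟩)) (by positivity)
        (by positivity)
        (by
          rw [← h8]
          have := hJmin k (by omega)
          have h0 : (0 : ℝ) < 8 ^ k := by positivity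
          nlinarith)
        (by
          intro n hn
          simp only [Finset.mem_filter] at hn
          refine ⟨hn.2.1, ?_, hn.2.1.trans ((le_abs_self _).trans (le_max_right _ _))⟩
          have := hn.2.2
          rw [pow_succ] at this
          linarith)
      rw [hsplit]
      refine (abs_add_le _ _).trans ?_
      have h2 := cost k
      have e : 4800 / c * R ^ (2 / 3 : ℝ) * (1 - (1 / 2) ^ (k + 1))
          = 4800 / c * R ^ (2 / 3 : ℝ) * (1 - (1 / 2) ^ k)
            + 1200 * (2 / c * R ^ (2 / 3 : ℝ) * (1 / 2) ^ k) := by rw [pow_succ]; ring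
      rw [e]
      linarith
  -- The remaining slopes exceed R^(1/3) while `f` varies by at most 2, so the points `x n` fill a
  -- length of at most 2 R^(-1/3), which is at most 2 R^(2/3) + 1 columns.
  have tail : |∑ n ∈ S.filter fun n => ¬ s (x n) < 2 ^ J, sawtooth (R * f (x n) + t')|
      ≤ 3 / 2 * R ^ (2 / 3 : ℝ) := by
    refine (abs_sum_sawtooth_le _ _).trans ?_
    have := card_le_of_ordConnected (S := S.filter fun n => ¬ s (x n) < 2 ^ J)
      (B := 2 * R ^ (2 / 3 : ℝ)) (by positivity)
      (by
        intro m hm n hn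
        simp only [Finset.mem_filter, not_lt] at hm hn
        rcases le_total n m with h | h
        · have : ((n - m : ℤ) : ℝ) ≤ 0 := by exact_mod_cast (by omega)
          linarith
        have h1 := hs _ (hSI m hm.1) _ (hSI n hn.1)
        have hm1 := abs_le.1 (hb _ (hSI m hm.1))
        have hn1 := abs_le.1 (hb _ (hSI n hn.1))
        have e : ((n : ℝ) - t) / R - (m - t) / R = ((n - m : ℤ) : ℝ) / R := by push_cast; ring
        rw [e] at h1
        have hR13 : R ^ (1 / 3 : ℝ) ≤ 2 ^ J := by
          have : (2 : ℝ) ^ J = ((8 : ℝ) ^ J) ^ (1 / 3 : ℝ) := by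
            rw [h8, ← Real.rpow_natCast _ 3, ← Real.rpow_mul (by positivity)]; norm_num
          rw [this]
          exact Real.rpow_le_rpow hR0.le hJ.le (by norm_num)
        have hd0 : 0 ≤ ((n - m : ℤ) : ℝ) / R := by
          have : (0 : ℝ) ≤ ((n - m : ℤ) : ℝ) := by exact_mod_cast (by omega)
          positivity
        have h3 : R ^ (1 / 3 : ℝ) * (((n - m : ℤ) : ℝ) / R) ≤ 2 := by
          have h4 : R ^ (1 / 3 : ℝ) * (((n - m : ℤ) : ℝ) / R)
              ≤ s ((m - t) / R) * (((n - m : ℤ) : ℝ) / R) := by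
            gcongr; exact hR13.trans hm.2
          linarith [hm1.1, hn1.2]
        have h5 : R = R ^ (1 / 3 : ℝ) * R ^ (2 / 3 : ℝ) := by
          rw [← Real.rpow_add hR0]; norm_num
        have h6 : R ^ (1 / 3 : ℝ) * (((n - m : ℤ) : ℝ) / R) = ((n - m : ℤ) : ℝ) / R ^ (2 / 3 : ℝ) := by
          have hp : 0 < R ^ (1 / 3 : ℝ) := by positivity
          have hp' : 0 < R ^ (2 / 3 : ℝ) := by positivity
          nth_rewrite 2 [h5]
          field_simp
        rw [h6, div_le_iff₀ (by positivity)] at h3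
        exact h3)
    linarith
  have hAJ := A J le_rfl
  have hfin := Finset.sum_filter_add_sum_filter_not S (fun n => s (x n) < 2 ^ J)
    (fun n => sawtooth (R * f (x n) + t'))
  show |∑ n ∈ S, sawtooth (R * f (x n) + t')| ≤ _
  rw [← hfin]
  refine (abs_add_le _ _).trans ?_
  have hpow : 0 ≤ (1 / 2 : ℝ) ^ J := by positivity
  have hpos : 0 ≤ 4800 / c * R ^ (2 / 3 : ℝ) := by positivity
  have h7 : 4800 / c * R ^ (2 / 3 : ℝ) * (1 - (1 / 2) ^ J) ≤ 4800 / c * R ^ (2 / 3 : ℝ) := by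
    nlinarith
  have h8' : 3 / 2 * R ^ (2 / 3 : ℝ) ≤ 3 / 2 * (1 / c) * R ^ (2 / 3 : ℝ) := by
    have : R ^ (2 / 3 : ℝ) * 1 ≤ R ^ (2 / 3 : ℝ) * (1 / c) := by gcongr
    linarith
  calc _ ≤ 2400 / c * R ^ (2 / 3 : ℝ) + 4800 / c * R ^ (2 / 3 : ℝ) + 3 / 2 * (1 / c) * R ^ (2 / 3 : ℝ) := by
        linarith
    _ = (2400 + 4800 + 3 / 2) * (1 / c * R ^ (2 / 3 : ℝ)) := by ring
    _ ≤ 7500 * (1 / c * R ^ (2 / 3 : ℝ)) := by gcongr; norm_num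
    _ = _ := by ring

lemma sum_neg_image {α : Type*} [AddCommMonoid α] (S : Finset ℤ) (f : ℤ → α) :
    ∑ n ∈ S.image (fun n => -n), f n = ∑ n ∈ S, f (-n) :=
  Finset.sum_image fun _ _ _ _ h => neg_injective h

lemma ordConnected_neg_image {S : Finset ℤ} (hS : (S : Set ℤ).OrdConnected) :
    ((S.image fun n => -n : Finset ℤ) : Set ℤ).OrdConnected := by
  constructor
  intro m hm n hn z hz
  simp only [Finset.coe_image, Set.mem_image, SetLike.mem_coe] at hm hn ⊢
  obtain ⟨m', hm', rfl⟩ := hm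
  obtain ⟨n', hn', rfl⟩ := hn
  exact ⟨-z, hS.out hn' hm' ⟨by have := hz.2; omega, by have := hz.1; omega⟩, by simp⟩

/-- Sawtooth sums over the integer points of a dilated curve with curvature bounded below. -/
theorem abs_sum_sawtooth_le_of_curved {f s : ℝ → ℝ} {I : Set ℝ} {c : ℝ} (hI : I.OrdConnected)
    (hfc : ContinuousOn f I) (hb : ∀ x ∈ I, |f x| ≤ 1)
    (hs : ∀ x ∈ I, ∀ y ∈ I, f x + s x * (y - x) ≤ f y) (hc : 0 < c) (hc1 : c ≤ 1)
    (hloc : ∀ x ∈ I, ∀ᶠ y in nhds x,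
      f x + s x * (y - x) + 2 * c * (max 1 |s x|) ^ 3 * (y - x) ^ 2 ≤ f y)
    {R : ℝ} (hR : 1 ≤ R) (t t' : ℝ) {S : Finset ℤ} (hS : (S : Set ℤ).OrdConnected)
    (hSI : ∀ n ∈ S, ((n : ℝ) - t) / R ∈ I) :
    |∑ n ∈ S, sawtooth (R * f ((n - t) / R) + t')| ≤ 15000 / c * R ^ (2 / 3 : ℝ) := by
  classical
  have hR0 : 0 < R := by linarith
  have hsn : ∀ m ∈ S, ∀ n ∈ S, m ≤ n → s ((m - t) / R) ≤ s ((n - t) / R) := by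
    intro m hm n hn h
    have h1 := hs _ (hSI m hm) _ (hSI n hn)
    have h2 := hs _ (hSI n hn) _ (hSI m hm)
    rcases h.eq_or_lt with rfl | h
    · exact le_rfl
    · have h3 : (m : ℝ) < n := by exact_mod_cast h
      have h4 : ((m : ℝ) - t) / R < (n - t) / R := by gcongr
      nlinarith
  rw [← Finset.sum_filter_add_sum_filter_not S (fun n : ℤ => 0 ≤ s (((n : ℝ) - t) / R))]
  refine (abs_add_le _ _).trans ?_
  have hp := abs_sum_sawtooth_le_of_curved_nonneg hI hfc hb hs hc hc1 hloc hR t t'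
    (S := S.filter fun n : ℤ => 0 ≤ s (((n : ℝ) - t) / R))
    (by
      constructor
      intro m hm n hn z hz
      simp only [Finset.coe_filter, Set.mem_ofPred_eq] at hm hn ⊢
      have hzS : z ∈ S := hS.out hm.1 hn.1 hz
      exact ⟨hzS, hm.2.trans (hsn m hm.1 z hzS hz.1)⟩)
    (fun n hn => hSI n (Finset.mem_filter.1 hn).1) (fun n hn => (Finset.mem_filter.1 hn).2)
  have hneg : ∀ n : ℤ, (((-n : ℤ) : ℝ) - -t) / R = -((n - t) / R) := by
    intro n; push_cast; ring
  -- Reflection x ↦ -x turns negative slopes into positive ones and preserves the curvature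
  -- condition.
  have hm := abs_sum_sawtooth_le_of_curved_nonneg (f := fun x => f (-x)) (s := fun x => -s (-x))
    (I := -I) (c := c)
    (by
      constructor
      intro a ha b hb' z hz
      exact hI.out hb' ha ⟨neg_le_neg hz.2, neg_le_neg hz.1⟩)
    (hfc.comp continuousOn_neg (fun x hx => hx)) (fun x hx => hb _ hx)
    (by
      intro x hx y hy
      have := hs _ hx _ hy
      linarith)
    hc hc1
    (by
      intro x hx
      have h := hloc _ hx
      have h2 : Filter.Tendsto (fun y : ℝ => -y) (nhds x) (nhds (-x)) := continuous_neg.tendsto x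
      filter_upwards [h2.eventually h] with y hy
      rw [abs_neg]
      have e : (-y - -x) ^ 2 = (y - x) ^ 2 := by ring
      rw [e] at hy
      linarith)
    hR (-t) t' (S := (S.filter fun n : ℤ => ¬ 0 ≤ s (((n : ℝ) - t) / R)).image fun n => -n)
    (by
      apply ordConnected_neg_image
      constructor
      intro m hm n hn z hz
      simp only [Finset.coe_filter, Set.mem_ofPred_eq] at hm hn ⊢
      have hzS : z ∈ S := hS.out hm.1 hn.1 hz
      exact ⟨hzS, fun h => hn.2 (h.trans (hsn z hzS n hn.1 hz.2))⟩)
    (by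
      intro n hn
      obtain ⟨m, hm, rfl⟩ := Finset.mem_image.1 hn
      rw [hneg, Set.mem_neg, neg_neg]
      exact hSI m (Finset.mem_filter.1 hm).1)
    (by
      intro n hn
      obtain ⟨m, hm, rfl⟩ := Finset.mem_image.1 hn
      rw [hneg, neg_neg]
      linarith [not_le.1 (Finset.mem_filter.1 hm).2])
  rw [sum_neg_image] at hm
  simp only [hneg, neg_neg] at hm
  calc _ ≤ 7500 / c * R ^ (2 / 3 : ℝ) + 7500 / c * R ^ (2 / 3 : ℝ) := add_le_add hp hm
    _ = _ := by ring

/-! ### The flat arc, the graph of |x|^γ. -/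

/-- The difference of the two sides has vanishing first derivative at x and second derivative
(γ(γ-1) - 4) x^(γ-2), positive for γ > 3; the second derivative test applies. -/
lemma rpow_local_support {γ x : ℝ} (hγ : 3 < γ) (hx : 0 < x) :
    ∀ᶠ y in nhds x,
      x ^ γ + γ * x ^ (γ - 1) * (y - x) + 2 * x ^ (γ - 2) * (y - x) ^ 2 ≤ y ^ γ := by
  set s := γ * x ^ (γ - 1) with hs
  set m := 2 * x ^ (γ - 2) with hm
  set F : ℝ → ℝ := fun y => y ^ γ - s * (y - x) - m * (y - x) ^ 2 with hF
  have hd : ∀ y, 0 < y → HasDerivAt F (γ * y ^ (γ - 1) - s - 2 * m * (y - x)) y := by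
    intro y hy
    have h1 := Real.hasDerivAt_rpow_const (x := y) (p := γ) (Or.inl hy.ne')
    have h2 := ((hasDerivAt_id y).sub_const x).const_mul s
    have h3 := (((hasDerivAt_id y).sub_const x).pow 2).const_mul m
    exact ((h1.sub h2).sub h3).congr_deriv (by simp; ring)
  have hde : deriv F =ᶠ[nhds x] fun y => γ * y ^ (γ - 1) - s - 2 * m * (y - x) := by
    filter_upwards [lt_mem_nhds hx] with y hy using (hd y hy).deriv
  have hdd : HasDerivAt (fun y => γ * y ^ (γ - 1) - s - 2 * m * (y - x))
      (γ * ((γ - 1) * x ^ (γ - 2)) - 2 * m) x := by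
    have h1 := (Real.hasDerivAt_rpow_const (x := x) (p := γ - 1) (Or.inl hx.ne')).const_mul γ
    have h2 := ((hasDerivAt_id x).sub_const x).const_mul (2 * m)
    refine ((h1.sub_const s).sub h2).congr_deriv ?_
    have : γ - 1 - 1 = γ - 2 := by ring
    rw [this, mul_one]
  have hmin : IsLocalMin F x := by
    apply isLocalMin_of_deriv_deriv_pos
    · rw [hde.deriv_eq, hdd.deriv, hm]
      have hp : 0 < x ^ (γ - 2) := by positivity
      have : 0 < (γ * (γ - 1) - 4) * x ^ (γ - 2) := mul_pos (by nlinarith) hp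
      linarith
    · rw [(hd x hx).deriv, hs]; ring
    · exact (hd x hx).continuousAt
  filter_upwards [hmin] with y hy
  simp only [hF, sub_self, mul_zero, ne_eq, OfNat.ofNat_ne_zero, not_false_eq_true, zero_pow,
    sub_zero] at hy
  linarith

lemma abs_rpow_local_support {γ x : ℝ} (hγ : 3 < γ) (hx : x ≠ 0) :
    ∃ s, |s| ≤ γ * |x| ^ (γ - 1) ∧ HasDerivAt (fun y => |y| ^ γ) s x ∧
      ∀ᶠ y in nhds x, |x| ^ γ + s * (y - x) + 2 * |x| ^ (γ - 2) * (y - x) ^ 2 ≤ |y| ^ γ := by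
  rcases hx.lt_or_gt with h | h
  · have hx' : 0 < -x := by linarith
    refine ⟨-(γ * (-x) ^ (γ - 1)), ?_, ?_, ?_⟩
    · rw [abs_neg, abs_of_neg h, abs_of_nonneg (by positivity)]
    · have h1 := (Real.hasDerivAt_rpow_const (x := -x) (p := γ) (Or.inl hx'.ne')).scomp x
        (hasDerivAt_neg x)
      have h2 : (fun y : ℝ => |y| ^ γ) =ᶠ[nhds x] (fun y => y ^ γ) ∘ Neg.neg := by
        filter_upwards [gt_mem_nhds h] with y hy
        simp [abs_of_neg hy]
      exact (h1.congr_of_eventuallyEq h2).congr_deriv (by simp)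
    · have h1 := rpow_local_support hγ hx'
      have h2 : Filter.Tendsto (fun y : ℝ => -y) (nhds x) (nhds (-x)) := continuous_neg.tendsto x
      filter_upwards [h2.eventually h1, gt_mem_nhds h] with y hy hy0
      rw [abs_of_neg h, abs_of_neg hy0]
      have e : (-y - -x) ^ 2 = (y - x) ^ 2 := by ring
      rw [e] at hy
      linarith
  · refine ⟨γ * x ^ (γ - 1), ?_, ?_, ?_⟩
    · rw [abs_of_pos h, abs_of_nonneg (by positivity)]
    · have h1 := Real.hasDerivAt_rpow_const (x := x) (p := γ) (Or.inl h.ne')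
      have h2 : (fun y : ℝ => |y| ^ γ) =ᶠ[nhds x] (fun y => y ^ γ) := by
        filter_upwards [lt_mem_nhds h] with y hy
        rw [abs_of_pos hy]
      exact h1.congr_of_eventuallyEq h2
    · filter_upwards [rpow_local_support hγ h, lt_mem_nhds h] with y hy hy0
      rw [abs_of_pos h, abs_of_pos hy0]
      exact hy

lemma rpow_sub_rpow_le {γ a b D : ℝ} (hγ : 1 ≤ γ) (ha : 0 ≤ a) (hab : a ≤ b) (hb : b ≤ D) :
    b ^ γ - a ^ γ ≤ γ * D ^ (γ - 1) * (b - a) := by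
  have := Convex.norm_image_sub_le_of_norm_hasDerivWithin_le (f := fun y : ℝ => y ^ γ)
    (f' := fun y => γ * y ^ (γ - 1)) (s := Set.Icc a b) (C := γ * D ^ (γ - 1)) (x := a) (y := b)
    (fun y _ => (Real.hasDerivAt_rpow_const (Or.inr hγ)).hasDerivWithinAt)
    (by
      intro y hy
      have hy0 : 0 ≤ y := ha.trans hy.1
      rw [Real.norm_of_nonneg (by positivity)]
      have : y ^ (γ - 1) ≤ D ^ (γ - 1) := Real.rpow_le_rpow hy0 (hy.2.trans hb) (by linarith)
      gcongr)
    (convex_Icc a b) ⟨le_rfl, hab⟩ ⟨hab, le_rfl⟩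
  rw [Real.norm_eq_abs, Real.norm_eq_abs, abs_of_nonneg (by linarith : 0 ≤ b - a)] at this
  exact (le_abs_self _).trans this

/-- On 2^(-k-1) < x ≤ 2^(-k) the van der Corput bound applies with u = 2^(-k-1), m₀ = u^(γ-2) and
slopes O(u^(γ-1)). The flatter the piece, the larger the λ^(-1/2) term, so the decomposition stops
at scale R^(-1/γ) and the rest is counted trivially. -/
lemma abs_sum_sawtooth_rpow_pos_le {γ : ℝ} (hγ : 3 < γ) {R : ℝ} (hR : 1 ≤ R) (t t' : ℝ)
    {S : Finset ℤ} (hS : (S : Set ℤ).OrdConnected)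
    (hSI : ∀ n ∈ S, 0 < ((n : ℝ) - t) / R ∧ ((n : ℝ) - t) / R ≤ 1) :
    |∑ n ∈ S, sawtooth (R * |((n : ℝ) - t) / R| ^ γ + t')|
      ≤ (1200 * (γ * 2 ^ (γ - 1)) + 4800 * 2 ^ ((γ - 2) / 2) + 1) * R ^ (1 - 1 / γ) := by
  have hR0 : 0 < R := by linarith
  set x : ℤ → ℝ := fun n => ((n : ℝ) - t) / R with hx
  have hxmono : ∀ m n : ℤ, m ≤ n → x m ≤ x n := by
    intro m n h
    have : (m : ℝ) ≤ n := by exact_mod_cast h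
    simp only [hx]; gcongr
  -- Halving the scale multiplies the λ^(-1/2) term by r. As r ≥ 4/3, the geometric sum is at most 4
  -- times its last term, which turns 1200 into 4800.
  set r : ℝ := 2 ^ ((γ - 2) / 2) with hr
  have hr0 : 0 < r := by positivity
  have hr1 : 4 / 3 ≤ r := by
    have h1 : (2 : ℝ) ^ (1 / 2 : ℝ) ≤ r := Real.rpow_le_rpow_of_exponent_le (by norm_num) (by linarith)
    rw [← Real.sqrt_eq_rpow] at h1
    have : (4 / 3 : ℝ) ≤ √2 := Real.le_sqrt_of_sq_le (by norm_num)
    linarith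
  have piece : ∀ (S' : Finset ℤ) (k : ℕ), S' ⊆ S → (S' : Set ℤ).OrdConnected →
      (∀ n ∈ S', (1 / 2 : ℝ) ^ (k + 1) < x n ∧ x n ≤ (1 / 2) ^ k) →
      |∑ n ∈ S', sawtooth (R * |x n| ^ γ + t')|
        ≤ 1200 * (γ * 2 ^ (γ - 1) * R ^ (2 / 3 : ℝ) * (1 / 2) ^ (k + 1)
          + R ^ (1 / 2 : ℝ) * r ^ (k + 1)) := by
    intro S' k hsub hS' hk
    set u : ℝ := (1 / 2) ^ (k + 1) with hu
    have hu0 : 0 < u := by positivity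
    have hu1 : u ≤ 1 := pow_le_one₀ (by norm_num) (by norm_num)
    have hu2 : (1 / 2 : ℝ) ^ k = 2 * u := by rw [hu, pow_succ]; ring
    have hm₀ : 0 < u ^ (γ - 2) := by positivity
    have hm₀1 : u ^ (γ - 2) ≤ 1 := Real.rpow_le_one hu0.le hu1 (by linarith)
    have h := abs_sum_sawtooth_dilate_le (f := fun y => |y| ^ γ) (t := t) (t' := t') hR hS' hm₀
      (by linarith) (L := γ * (2 * u) ^ (γ - 1)) (σ := 0) (by positivity)
      (by
        intro m _ n _
        apply Continuous.continuousOn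
        exact continuous_abs.rpow_const fun _ => Or.inr (by linarith))
      (by
        intro m hm n hn y hy
        have hy0 : u < y := (hk m hm).1.trans hy.1
        obtain ⟨s, -, -, hs⟩ := abs_rpow_local_support (x := y) hγ (by linarith)
        refine ⟨s, 2 * |y| ^ (γ - 2), ?_, hs⟩
        rw [abs_of_pos (by linarith)]
        have : u ^ (γ - 2) ≤ y ^ (γ - 2) := Real.rpow_le_rpow hu0.le hy0.le (by linarith)
        linarith)
      (by
        intro n hn hn1
        have h1 := hk n hn
        have h2 := hk (n + 1) hn1
        simp only [hx] at h1 h2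
        have hle : ((n : ℝ) - t) / R ≤ ((n + 1 : ℤ) - t) / R := hxmono n (n + 1) (by omega)
        have h0 : 0 < ((n : ℝ) - t) / R := hu0.trans h1.1
        rw [abs_of_pos h0, abs_of_pos (h0.trans_le hle)]
        have hmono : (((n : ℝ) - t) / R) ^ γ ≤ (((n + 1 : ℤ) - t) / R) ^ γ :=
          Real.rpow_le_rpow h0.le hle (by linarith)
        have hlip := rpow_sub_rpow_le (γ := γ) (by linarith) h0.le hle (h2.2.trans hu2.le)
        have e : ((n + 1 : ℤ) - t) / R - (n - t) / R = 1 / R := by push_cast; ring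
        rw [e] at hlip
        constructor
        · exact mul_nonneg hR0.le (by linarith)
        · have := mul_le_mul_of_nonneg_left hlip hR0.le
          calc _ ≤ _ := this
            _ = _ := by field_simp; ring)
    refine h.trans ?_
    have e1 : (R / u ^ (γ - 2)) ^ (2 / 3 : ℝ) = R ^ (2 / 3 : ℝ) * u ^ (-(2 / 3 * (γ - 2))) := by
      rw [Real.div_rpow hR0.le hm₀.le, ← Real.rpow_mul hu0.le, Real.rpow_neg hu0.le, div_eq_mul_inv]
      ring_nf
    have e2 : (R / u ^ (γ - 2)) ^ (1 / 2 : ℝ) = R ^ (1 / 2 : ℝ) * r ^ (k + 1) := by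
      rw [Real.div_rpow hR0.le hm₀.le, div_eq_mul_inv]
      congr 1
      have h2u : u = ((2 : ℝ) ^ (k + 1))⁻¹ := by rw [hu, one_div, inv_pow]
      have hrk : r ^ (k + 1) = ((2 : ℝ) ^ (k + 1)) ^ ((γ - 2) / 2) := by
        rw [hr, ← Real.rpow_natCast, ← Real.rpow_natCast, ← Real.rpow_mul (by norm_num),
          ← Real.rpow_mul (by norm_num), mul_comm]
      rw [← Real.rpow_mul hu0.le, h2u, Real.inv_rpow (by positivity), inv_inv, hrk]
      congr 1; ring
    have e3 : γ * (2 * u) ^ (γ - 1) * (R / u ^ (γ - 2)) ^ (2 / 3 : ℝ)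
        ≤ γ * 2 ^ (γ - 1) * R ^ (2 / 3 : ℝ) * u := by
      rw [e1, Real.mul_rpow (by norm_num) hu0.le]
      -- The total exponent is (γ + 1)/3 ≥ 1, so the first terms sum geometrically to O(R^(2/3)).
      have e4 : u ^ (γ - 1) * u ^ (-(2 / 3 * (γ - 2))) ≤ u := by
        rw [← Real.rpow_add hu0]
        conv_rhs => rw [← Real.rpow_one u]
        exact Real.rpow_le_rpow_of_exponent_ge hu0 hu1 (by linarith)
      calc _ = γ * 2 ^ (γ - 1) * R ^ (2 / 3 : ℝ) * (u ^ (γ - 1) * u ^ (-(2 / 3 * (γ - 2)))) := by ring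
        _ ≤ _ := by gcongr
    rw [e2] at *
    linarith
  classical
  have hord : ∀ p : ℝ → Prop, (∀ a b z, p a → p b → a ≤ z → z ≤ b → p z) →
      ∀ [DecidablePred fun n : ℤ => p (x n)],
      ((S.filter fun n => p (x n) : Finset ℤ) : Set ℤ).OrdConnected := by
    intro p hp _
    constructor
    intro m hm n hn z hz
    simp only [Finset.coe_filter, Set.mem_ofPred_eq] at hm hn ⊢
    exact ⟨hS.out hm.1 hn.1 hz, hp _ _ _ hm.2 hn.2 (hxmono m z hz.1) (hxmono z n hz.2)⟩
  have hγ0 : 0 < γ := by linarith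
  set E := R ^ (1 - 1 / γ) with hE
  have hγinv : 1 / γ < 1 / 3 := one_div_lt_one_div_of_lt (by norm_num) hγ
  have hE1 : 1 ≤ E := Real.one_le_rpow hR (by linarith)
  have hE23 : R ^ (2 / 3 : ℝ) ≤ E := Real.rpow_le_rpow_of_exponent_le hR (by linarith)
  obtain ⟨J, hJ, hJmin⟩ : ∃ J : ℕ, R ^ (1 / γ) < 2 ^ J ∧ ∀ k < J, (2 : ℝ) ^ k ≤ R ^ (1 / γ) := by
    have hex := pow_unbounded_of_one_lt (R ^ (1 / γ)) (by norm_num : (1 : ℝ) < 2)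
    exact ⟨Nat.find hex, Nat.find_spec hex, fun k hk => not_lt.1 (Nat.find_min hex hk)⟩
  have hR1γ : 1 ≤ R ^ (1 / γ) := Real.one_le_rpow hR (by positivity)
  have hJ2 : (2 : ℝ) ^ J ≤ 2 * R ^ (1 / γ) := by
    obtain _ | j := J
    · simp at hJ; linarith
    · rw [pow_succ]; linarith [hJmin j (by omega)]
  have A : ∀ k : ℕ, |∑ n ∈ S.filter fun n => (1 / 2) ^ k < x n, sawtooth (R * |x n| ^ γ + t')|
      ≤ 1200 * (γ * 2 ^ (γ - 1)) * R ^ (2 / 3 : ℝ) * (1 - (1 / 2) ^ k)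
        + 4800 * R ^ (1 / 2 : ℝ) * r ^ k := by
    intro k
    induction k with
    | zero =>
      have : S.filter (fun n => (1 / 2) ^ 0 < x n) = ∅ := by
        apply Finset.filter_eq_empty_iff.2
        intro n hn
        simp only [pow_zero, not_lt]
        exact (hSI n hn).2
      rw [this]
      simp only [Finset.sum_empty, abs_zero, pow_zero, sub_self, mul_zero, zero_add]
      positivity
    | succ k ih =>
      have h2 : (1 / 2 : ℝ) ^ (k + 1) ≤ (1 / 2) ^ k :=
        pow_le_pow_of_le_one (by norm_num) (by norm_num) (by omega)
      have hsplit : ∑ n ∈ S.filter (fun n => (1 / 2) ^ (k + 1) < x n), sawtooth (R * |x n| ^ γ + t')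
          = ∑ n ∈ S.filter (fun n => (1 / 2) ^ k < x n), sawtooth (R * |x n| ^ γ + t')
            + ∑ n ∈ S.filter (fun n => (1 / 2) ^ (k + 1) < x n ∧ x n ≤ (1 / 2) ^ k),
              sawtooth (R * |x n| ^ γ + t') := by
        rw [← Finset.sum_filter_add_sum_filter_not (S.filter (fun n => (1 / 2) ^ (k + 1) < x n))
          (fun n => (1 / 2) ^ k < x n), Finset.filter_filter, Finset.filter_filter]
        congr 1
        · apply Finset.sum_congr _ (fun _ _ => rfl)
          ext n
          simp only [Finset.mem_filter]
          exact ⟨fun h => ⟨h.1, h.2.2⟩, fun h => ⟨h.1, h2.trans_lt h.2, h.2⟩⟩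
        · simp only [not_lt]
      have hp := piece (S.filter fun n => (1 / 2) ^ (k + 1) < x n ∧ x n ≤ (1 / 2) ^ k) k
        (Finset.filter_subset _ _)
        (hord (fun z => (1 / 2) ^ (k + 1) < z ∧ z ≤ (1 / 2) ^ k)
          (fun a b z ha hb h1 h2 => ⟨ha.1.trans_le h1, h2.trans hb.2⟩))
        (fun n hn => (Finset.mem_filter.1 hn).2)
      rw [hsplit]
      refine (abs_add_le _ _).trans ?_
      have e1 : (1 / 2 : ℝ) ^ k = 2 * (1 / 2) ^ (k + 1) := by rw [pow_succ]; ring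
      have hrk : r ^ (k + 1) ≤ 4 * (r ^ (k + 1) - r ^ k) := by
        have : 0 < r ^ k := by positivity
        rw [pow_succ]; nlinarith
      have h3 : R ^ (1 / 2 : ℝ) * r ^ (k + 1) ≤ R ^ (1 / 2 : ℝ) * (4 * (r ^ (k + 1) - r ^ k)) := by
        gcongr
      have e2 : 1 - (1 / 2 : ℝ) ^ k = 1 - 2 * (1 / 2) ^ (k + 1) := by rw [e1]
      rw [e2] at ih
      linarith
  -- Here x ≤ R^(-1/γ), where the dilated graph rises by at most 1. Columns are merely counted, at
  -- most R^(1-1/γ) + 1 of them.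
  have tail : |∑ n ∈ S.filter fun n => ¬ (1 / 2) ^ J < x n, sawtooth (R * |x n| ^ γ + t')| ≤ E := by
    refine (abs_sum_sawtooth_le _ _).trans ?_
    have := card_le_of_ordConnected (S := S.filter fun n => ¬ (1 / 2) ^ J < x n) (B := E)
      (by linarith)
      (by
        intro m hm n hn
        simp only [Finset.mem_filter, not_lt] at hm hn
        have h1 := (hSI m hm.1).1
        have h2 := hn.2
        have e : ((n - m : ℤ) : ℝ) = R * (x n - x m) := by
          simp only [hx]; push_cast; field_simp; ring
        have h3 : x n - x m ≤ (1 / 2) ^ J := by simp only [hx] at *; linarith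
        have h4 : (1 / 2 : ℝ) ^ J ≤ (R ^ (1 / γ))⁻¹ := by
          rw [one_div, inv_pow]
          exact inv_anti₀ (by positivity) hJ.le
        rw [e, hE, Real.rpow_sub hR0, Real.rpow_one, div_eq_mul_inv]
        gcongr
        linarith)
    linarith
  have hfin := Finset.sum_filter_add_sum_filter_not S (fun n => (1 / 2) ^ J < x n)
    (fun n => sawtooth (R * |x n| ^ γ + t'))
  show |∑ n ∈ S, sawtooth (R * |x n| ^ γ + t')| ≤ _
  rw [← hfin]
  refine (abs_add_le _ _).trans ?_
  have hpow : 0 ≤ (1 / 2 : ℝ) ^ J := by positivity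
  -- At the stopping scale the van der Corput cost matches the trivial one: 1/2 + (γ - 2)/(2γ) = 1 -
  -- 1/γ.
  have hrJ : R ^ (1 / 2 : ℝ) * r ^ J ≤ r * E := by
    have h1 : r ^ J = ((2 : ℝ) ^ J) ^ ((γ - 2) / 2) := by
      rw [hr, ← Real.rpow_natCast, ← Real.rpow_natCast, ← Real.rpow_mul (by norm_num),
        ← Real.rpow_mul (by norm_num), mul_comm]
    have h2 : ((2 : ℝ) ^ J) ^ ((γ - 2) / 2) ≤ (2 * R ^ (1 / γ)) ^ ((γ - 2) / 2) :=
      Real.rpow_le_rpow (by positivity) hJ2 (by linarith)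
    rw [Real.mul_rpow (by norm_num) (by positivity), ← Real.rpow_mul hR0.le] at h2
    calc R ^ (1 / 2 : ℝ) * r ^ J ≤ R ^ (1 / 2 : ℝ) * (2 ^ ((γ - 2) / 2) * R ^ (1 / γ * ((γ - 2) / 2))) := by
          rw [h1]; gcongr
      _ = r * (R ^ (1 / 2 : ℝ) * R ^ (1 / γ * ((γ - 2) / 2))) := by rw [hr]; ring
      _ = r * E := by
          rw [← Real.rpow_add hR0, hE]
          congr 2
          field_simp
          ring
  have h1 : 1200 * (γ * 2 ^ (γ - 1)) * R ^ (2 / 3 : ℝ) * (1 - (1 / 2) ^ J)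
      ≤ 1200 * (γ * 2 ^ (γ - 1)) * E := by
    have hB : 0 ≤ 1200 * (γ * 2 ^ (γ - 1)) := by positivity
    have h2 : R ^ (2 / 3 : ℝ) * (1 - (1 / 2) ^ J) ≤ E := by
      have : 0 ≤ R ^ (2 / 3 : ℝ) := by positivity
      nlinarith
    rw [mul_assoc]
    gcongr
  have hAJ := A J
  calc _ ≤ 1200 * (γ * 2 ^ (γ - 1)) * E + 4800 * (r * E) + E := by linarith
    _ = _ := by ring

/-- Sawtooth sums over the integer points of the dilated graph of `|x| ^ γ`. -/
theorem abs_sum_sawtooth_rpow_le {γ : ℝ} (hγ : 3 < γ) : ∃ K : ℝ, 0 < K ∧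
    ∀ {R : ℝ}, 1 ≤ R → ∀ (t t' : ℝ) {S : Finset ℤ}, (S : Set ℤ).OrdConnected →
    (∀ n ∈ S, |((n : ℝ) - t) / R| ≤ 1) →
    |∑ n ∈ S, sawtooth (R * |((n : ℝ) - t) / R| ^ γ + t')| ≤ K * R ^ (1 - 1 / γ) := by
  classical
  set B : ℝ := 1200 * (γ * 2 ^ (γ - 1)) + 4800 * 2 ^ ((γ - 2) / 2) + 1 with hB
  have hB0 : 0 < B := by positivity
  refine ⟨2 * B + 1 / 2, by positivity, ?_⟩
  intro R hR t t' S hS hSI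
  have hR0 : 0 < R := by linarith
  have hx : ∀ m n : ℤ, m ≤ n → ((m : ℝ) - t) / R ≤ (n - t) / R := by
    intro m n h
    have : (m : ℝ) ≤ n := by exact_mod_cast h
    gcongr
  have hE1 : 1 ≤ R ^ (1 - 1 / γ) := by
    apply Real.one_le_rpow hR
    have : 1 / γ < 1 / 3 := one_div_lt_one_div_of_lt (by norm_num) hγ
    linarith
  have hneg : ∀ n : ℤ, (((-n : ℤ) : ℝ) - -t) / R = -((n - t) / R) := by
    intro n; push_cast; ring
  have hp := abs_sum_sawtooth_rpow_pos_le hγ hR t t' (S := S.filter fun n : ℤ => 0 < ((n : ℝ) - t) / R)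
    (by
      constructor
      intro m hm n hn z hz
      simp only [Finset.coe_filter, Set.mem_ofPred_eq] at hm hn ⊢
      exact ⟨hS.out hm.1 hn.1 hz, hm.2.trans_le (hx m z hz.1)⟩)
    (fun n hn => ⟨(Finset.mem_filter.1 hn).2,
      (le_abs_self _).trans (hSI n (Finset.mem_filter.1 hn).1)⟩)
  have hm := abs_sum_sawtooth_rpow_pos_le hγ hR (-t) t'
    (S := (S.filter fun n : ℤ => ((n : ℝ) - t) / R < 0).image fun n => -n)
    (by
      apply ordConnected_neg_image
      constructor
      intro m hm n hn z hz
      simp only [Finset.coe_filter, Set.mem_ofPred_eq] at hm hn ⊢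
      exact ⟨hS.out hm.1 hn.1 hz, (hx z n hz.2).trans_lt hn.2⟩)
    (by
      intro n hn
      obtain ⟨m, hm, rfl⟩ := Finset.mem_image.1 hn
      rw [hneg]
      have h1 := (Finset.mem_filter.1 hm).2
      exact ⟨by linarith, (neg_le_abs _).trans (hSI m (Finset.mem_filter.1 hm).1)⟩)
  rw [sum_neg_image] at hm
  simp only [hneg, abs_neg] at hm
  have h0 : |∑ n ∈ S.filter (fun n : ℤ => ((n : ℝ) - t) / R = 0),
      sawtooth (R * |((n : ℝ) - t) / R| ^ γ + t')| ≤ 1 / 2 := by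
    refine (abs_sum_sawtooth_le _ _).trans ?_
    have : (S.filter (fun n : ℤ => ((n : ℝ) - t) / R = 0)).card ≤ 1 := by
      apply Finset.card_le_one.2
      intro m hm n hn
      have h1 := (Finset.mem_filter.1 hm).2
      have h2 := (Finset.mem_filter.1 hn).2
      have h3 : (m : ℝ) = n := by
        rw [div_eq_zero_iff] at h1 h2
        have := h1.resolve_right hR0.ne'
        have := h2.resolve_right hR0.ne'
        linarith
      exact_mod_cast h3
    have : ((S.filter (fun n : ℤ => ((n : ℝ) - t) / R = 0)).card : ℝ) ≤ 1 := by exact_mod_cast this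
    linarith
  have hsplit : ∑ n ∈ S, sawtooth (R * |((n : ℝ) - t) / R| ^ γ + t')
      = ∑ n ∈ S.filter (fun n : ℤ => 0 < ((n : ℝ) - t) / R), sawtooth (R * |((n : ℝ) - t) / R| ^ γ + t')
        + (∑ n ∈ S.filter (fun n : ℤ => ((n : ℝ) - t) / R < 0),
            sawtooth (R * |((n : ℝ) - t) / R| ^ γ + t')
          + ∑ n ∈ S.filter (fun n : ℤ => ((n : ℝ) - t) / R = 0),
            sawtooth (R * |((n : ℝ) - t) / R| ^ γ + t')) := by
    simp only [Finset.sum_filter]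
    rw [← Finset.sum_add_distrib, ← Finset.sum_add_distrib]
    apply Finset.sum_congr rfl
    intro n _
    rcases lt_trichotomy (((n : ℝ) - t) / R) 0 with h | h | h
    · simp [h, h.not_gt, h.ne]
    · simp [h]
    · simp [h, h.not_gt, h.ne']
  rw [hsplit]
  refine (abs_add_le _ _).trans ((add_le_add_right (abs_add_le _ _) _).trans ?_)
  calc _ ≤ B * R ^ (1 - 1 / γ) + (B * R ^ (1 - 1 / γ) + 1 / 2) := by linarith
    _ ≤ B * R ^ (1 - 1 / γ) + (B * R ^ (1 - 1 / γ) + 1 / 2 * R ^ (1 - 1 / γ)) := by linarith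
    _ = _ := by ring

/-! ### From curvature of the boundary to supporting parabolas. -/

lemma eventually_nonneg_of_second_deriv_pos {h h' : ℝ → ℝ} {x m : ℝ}
    (hd : ∀ᶠ u in nhds x, HasDerivAt h (h' u) u) (hdd : HasDerivAt h' m x) (h0 : h x = 0)
    (h0' : h' x = 0) (hm : 0 < m) : ∀ᶠ u in nhds x, 0 ≤ h u := by
  have hde : deriv h =ᶠ[nhds x] h' := hd.mono fun u hu => hu.deriv
  have := isLocalMin_of_deriv_deriv_pos (f := h) (x₀ := x) (by rw [hde.deriv_eq, hdd.deriv]; exact hm)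
    (by rw [hd.self_of_nhds.deriv, h0']) hd.self_of_nhds.continuousAt
  rw [IsLocalMin, IsMinFilter, h0] at this
  exact this

/-- Near a boundary point with curvature at least `κ`, the boundary of a convex body lies between two
parabolas, in the coordinates adapted to a supporting line. -/
lemma exists_frontier_between_parabolas {C : Set (ℝ × ℝ)} (hcl : IsClosed C)
    {p : ℝ × ℝ} {κ : ℝ} (hκ : 0 < κ)
    (hsm : SmoothWithCurvatureGE (frontier C) p κ) {ν₁ ν₂ : ℝ} (hν : 0 < ν₁ ^ 2 + ν₂ ^ 2)
    (hsup : ∀ z ∈ C, 0 ≤ ν₁ * (z.1 - p.1) + ν₂ * (z.2 - p.2)) :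
    p ∈ C ∧ ∃ c₁ : ℝ, 0 < c₁ ∧ ∀ᶠ T in nhds (0 : ℝ), ∃ z ∈ frontier C,
      -ν₂ * (z.1 - p.1) + ν₁ * (z.2 - p.2) = T ∧
      κ / (4 * √(ν₁ ^ 2 + ν₂ ^ 2)) * T ^ 2 ≤ ν₁ * (z.1 - p.1) + ν₂ * (z.2 - p.2) ∧
      ν₁ * (z.1 - p.1) + ν₂ * (z.2 - p.2) ≤ c₁ * T ^ 2 := by
  obtain ⟨g, δ, hg, hcurv⟩ := hsm
  have hδ := hg.pos
  obtain ⟨V, -, -, hV⟩ := hg.image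
  have hfr : ∀ u ∈ Set.Ioo (-δ) δ, g u ∈ frontier C := fun u hu => by
    have : g u ∈ frontier C ∩ V := hV ▸ Set.mem_image_of_mem g hu
    exact this.1
  have hIoo : Set.Ioo (-δ) δ ∈ nhds (0 : ℝ) := Ioo_mem_nhds (by linarith) hδ
  set N := √(ν₁ ^ 2 + ν₂ ^ 2) with hN
  have hN0 : 0 < N := Real.sqrt_pos.2 hν
  have hN2 : N ^ 2 = ν₁ ^ 2 + ν₂ ^ 2 := Real.sq_sqrt hν.le
  set G₁ : ℝ → ℝ := fun u => (g u).1 with hG₁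
  set G₂ : ℝ → ℝ := fun u => (g u).2 with hG₂
  have hG₁s : ContDiffOn ℝ ∞ G₁ (Set.Ioo (-δ) δ) := hg.smooth.fst
  have hG₂s : ContDiffOn ℝ ∞ G₂ (Set.Ioo (-δ) δ) := hg.smooth.snd
  have hd1 : ∀ {G : ℝ → ℝ}, ContDiffOn ℝ ∞ G (Set.Ioo (-δ) δ) →
      ∀ᶠ u in nhds (0 : ℝ), HasDerivAt G (deriv G u) u := by
    intro G hG
    filter_upwards [hIoo] with u hu
    exact ((hG.differentiableOn (by simp)).differentiableAt (isOpen_Ioo.mem_nhds hu)).hasDerivAt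
  have hd2 : ∀ {G : ℝ → ℝ}, ContDiffOn ℝ ∞ G (Set.Ioo (-δ) δ) →
      HasDerivAt (deriv G) (deriv (deriv G) 0) 0 := by
    intro G hG
    have h1 : ContDiffOn ℝ 1 (deriv G) (Set.Ioo (-δ) δ) :=
      hG.deriv_of_isOpen isOpen_Ioo (by norm_cast)
    exact ((h1.differentiableOn (by simp)).differentiableAt hIoo).hasDerivAt
  have hp1 : G₁ 0 = p.1 := by simp only [hG₁, hg.base]
  have hp2 : G₂ 0 = p.2 := by simp only [hG₂, hg.base]
  set a₁ := deriv G₁ 0 with ha₁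
  set a₂ := deriv G₂ 0 with ha₂
  set b₁ := deriv (deriv G₁) 0 with hb₁
  set b₂ := deriv (deriv G₂) 0 with hb₂
  have ha : 0 < a₁ ^ 2 + a₂ ^ 2 := by
    by_contra hcon
    have h1 : a₁ = 0 := by nlinarith [sq_nonneg a₁, sq_nonneg a₂]
    have h2 : a₂ = 0 := by nlinarith [sq_nonneg a₁, sq_nonneg a₂]
    apply hg.regular 0 ⟨by linarith, hδ⟩
    have := ((hd1 hG₁s).self_of_nhds.prodMk (hd1 hG₂s).self_of_nhds).deriv
    have e : (fun u => (G₁ u, G₂ u)) = g := rfl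
    rw [e] at this
    rw [this, ← ha₁, ← ha₂, h1, h2]; rfl
  have hcurv' : κ * (a₁ ^ 2 + a₂ ^ 2) ^ (3 / 2 : ℝ) ≤ |a₁ * b₂ - a₂ * b₁| := by
    have h : κ ≤ |a₁ * b₂ - a₂ * b₁| / (a₁ ^ 2 + a₂ ^ 2) ^ (3 / 2 : ℝ) := hcurv
    rwa [le_div_iff₀ (by positivity)] at h
  -- the height over the supporting line
  set w : ℝ → ℝ := fun u => ν₁ * (G₁ u - p.1) + ν₂ * (G₂ u - p.2) with hw
  set w' : ℝ → ℝ := fun u => ν₁ * deriv G₁ u + ν₂ * deriv G₂ u with hw'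
  have hwd : ∀ᶠ u in nhds (0 : ℝ), HasDerivAt w (w' u) u := by
    filter_upwards [hd1 hG₁s, hd1 hG₂s] with u h1 h2
    exact ((h1.sub_const _).const_mul ν₁).add ((h2.sub_const _).const_mul ν₂)
  have hwdd : HasDerivAt w' (ν₁ * b₁ + ν₂ * b₂) 0 :=
    ((hd2 hG₁s).const_mul ν₁).add ((hd2 hG₂s).const_mul ν₂)
  have hw0 : w 0 = 0 := by simp only [hw, hp1, hp2]; ring
  have hwnn : ∀ᶠ u in nhds (0 : ℝ), 0 ≤ w u := by
    filter_upwards [hIoo] with u hu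
    exact hsup _ (hcl.frontier_subset (hfr u hu))
  -- The height over the supporting line has a local minimum at the base point, so the line is
  -- tangent to the curve.
  have hw'0 : ν₁ * a₁ + ν₂ * a₂ = 0 := by
    have hmin : IsLocalMin w 0 := by
      filter_upwards [hwnn] with u hu
      rwa [hw0]
    exact hmin.hasDerivAt_eq_zero hwd.self_of_nhds
  -- the tangential coordinate
  set τ : ℝ → ℝ := fun u => -ν₂ * (G₁ u - p.1) + ν₁ * (G₂ u - p.2) with hτ
  set τ' : ℝ → ℝ := fun u => -ν₂ * deriv G₁ u + ν₁ * deriv G₂ u with hτ'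
  have hτd : ∀ᶠ u in nhds (0 : ℝ), HasDerivAt τ (τ' u) u := by
    filter_upwards [hd1 hG₁s, hd1 hG₂s] with u h1 h2
    exact ((h1.sub_const _).const_mul (-ν₂)).add ((h2.sub_const _).const_mul ν₁)
  have hτdd : HasDerivAt τ' (-ν₂ * b₁ + ν₁ * b₂) 0 :=
    ((hd2 hG₁s).const_mul (-ν₂)).add ((hd2 hG₂s).const_mul ν₁)
  have hτ0 : τ 0 = 0 := by simp only [hτ, hp1, hp2]; ring
  have hτ'sq : (τ' 0) ^ 2 = N ^ 2 * (a₁ ^ 2 + a₂ ^ 2) := by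
    have e : (τ' 0) ^ 2 = N ^ 2 * (a₁ ^ 2 + a₂ ^ 2) - (ν₁ * a₁ + ν₂ * a₂) ^ 2 := by
      simp only [hτ', ← ha₁, ← ha₂]; rw [hN2]; ring
    rw [e, hw'0]; ring
  have hτ'0 : τ' 0 ≠ 0 := by
    intro h
    rw [h] at hτ'sq
    have : 0 < N ^ 2 * (a₁ ^ 2 + a₂ ^ 2) := by positivity
    linarith
  set m := ν₁ * b₁ + ν₂ * b₂ with hm
  -- As g' is parallel to the line, |a₁b₂ - a₂b₁| = |m| |g'| / N; the bound on curvature becomes one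
  -- on the second derivative `m` of the height.
  have hmabs : κ * N * (a₁ ^ 2 + a₂ ^ 2) ≤ |m| := by
    have e1 : N ^ 2 * (a₁ * b₂ - a₂ * b₁) = -(m * (-ν₂ * a₁ + ν₁ * a₂)) + 
        (ν₁ * a₁ + ν₂ * a₂) * (ν₁ * b₂ - ν₂ * b₁) := by
      rw [hN2, hm]; ring
    rw [hw'0, zero_mul, add_zero] at e1
    have e2 : N ^ 2 * |a₁ * b₂ - a₂ * b₁| = |m| * |τ' 0| := by
      have := congrArg abs e1
      rwa [abs_mul, abs_neg, abs_mul, abs_of_pos (by positivity : 0 < N ^ 2)] at this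
    have e3 : |τ' 0| = N * √(a₁ ^ 2 + a₂ ^ 2) := by
      rw [← Real.sqrt_sq_eq_abs, hτ'sq, Real.sqrt_mul (by positivity), Real.sqrt_sq hN0.le]
    have e4 : (a₁ ^ 2 + a₂ ^ 2) ^ (3 / 2 : ℝ) = (a₁ ^ 2 + a₂ ^ 2) * √(a₁ ^ 2 + a₂ ^ 2) := by
      rw [Real.sqrt_eq_rpow, ← Real.rpow_one_add' ha.le (by norm_num)]; norm_num
    have hs : 0 < √(a₁ ^ 2 + a₂ ^ 2) := Real.sqrt_pos.2 ha
    rw [e3] at e2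
    rw [e4] at hcurv'
    have h5 : N ^ 2 * (κ * ((a₁ ^ 2 + a₂ ^ 2) * √(a₁ ^ 2 + a₂ ^ 2)))
        ≤ |m| * (N * √(a₁ ^ 2 + a₂ ^ 2)) := by
      rw [← e2]; gcongr
    have h6 : (κ * N * (a₁ ^ 2 + a₂ ^ 2)) * (N * √(a₁ ^ 2 + a₂ ^ 2))
        ≤ |m| * (N * √(a₁ ^ 2 + a₂ ^ 2)) := by
      calc _ = N ^ 2 * (κ * ((a₁ ^ 2 + a₂ ^ 2) * √(a₁ ^ 2 + a₂ ^ 2))) := by ring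
        _ ≤ _ := h5
    exact le_of_mul_le_mul_right h6 (by positivity)
  -- comparison of the height with multiples of the squared tangential coordinate
  have hquad : ∀ c : ℝ, (∀ᶠ u in nhds (0 : ℝ), HasDerivAt (fun u => c * τ u ^ 2)
      (c * (2 * τ u * τ' u)) u) ∧
      HasDerivAt (fun u => c * (2 * τ u * τ' u)) (2 * c * (τ' 0) ^ 2) 0 := by
    intro c
    constructor
    · filter_upwards [hτd] with u hu
      exact ((hu.pow 2).const_mul c).congr_deriv (by simp)
    · refine (((hτd.self_of_nhds.const_mul 2).mul hτdd).const_mul c).congr_deriv ?_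
      rw [hτ0]; ring
  have hlow : ∀ c : ℝ, 2 * c * (τ' 0) ^ 2 < m → ∀ᶠ u in nhds (0 : ℝ), c * τ u ^ 2 ≤ w u := by
    intro c hc
    have := eventually_nonneg_of_second_deriv_pos (h := fun u => w u - c * τ u ^ 2)
      (h' := fun u => w' u - c * (2 * τ u * τ' u)) (x := 0) (m := m - 2 * c * (τ' 0) ^ 2)
      (by filter_upwards [hwd, (hquad c).1] with u h1 h2 using h1.sub h2)
      (hwdd.sub (hquad c).2) (by simp [hw0, hτ0])
      (by simp only [hτ0, hw', ← ha₁, ← ha₂, hw'0]; ring) (by linarith)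
    filter_upwards [this] with u hu
    linarith
  have hupp : ∀ c : ℝ, m < 2 * c * (τ' 0) ^ 2 → ∀ᶠ u in nhds (0 : ℝ), w u ≤ c * τ u ^ 2 := by
    intro c hc
    have := eventually_nonneg_of_second_deriv_pos (h := fun u => c * τ u ^ 2 - w u)
      (h' := fun u => c * (2 * τ u * τ' u) - w' u) (x := 0) (m := 2 * c * (τ' 0) ^ 2 - m)
      (by filter_upwards [hwd, (hquad c).1] with u h1 h2 using h2.sub h1)
      ((hquad c).2.sub hwdd) (by simp [hw0, hτ0])
      (by simp only [hτ0, hw', ← ha₁, ← ha₂, hw'0]; ring) (by linarith)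
    filter_upwards [this] with u hu
    linarith
  have hτ'pos : 0 < (τ' 0) ^ 2 := by positivity
  -- images under the tangential coordinate of neighbourhoods of `0`
  have hτopen : ∀ P : ℝ → Prop, (∀ᶠ u in nhds (0 : ℝ), P u) →
      ∀ᶠ T in nhds (0 : ℝ), ∃ u, P u ∧ τ u = T := by
    intro P hP
    have h1 : HasStrictDerivAt τ (τ' 0) 0 := by
      have hτs : ContDiffAt ℝ ∞ τ 0 := by
        have h1 := hG₁s.contDiffAt hIoo
        have h2 := hG₂s.contDiffAt hIoo
        exact (contDiffAt_const.mul (h1.sub contDiffAt_const)).add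
          (contDiffAt_const.mul (h2.sub contDiffAt_const))
      have := hτs.hasStrictDerivAt (by simp)
      rwa [hτd.self_of_nhds.deriv] at this
    have h2 := h1.map_nhds_eq hτ'0
    rw [hτ0] at h2
    rw [← h2]
    exact Filter.image_mem_map hP
  -- The curvature is unsigned. A negative `m` would carry the curve below the supporting line.
  have hmpos : 0 < m := by
    by_contra hcon
    have hmneg : m < 0 := by
      have : 0 < κ * N * (a₁ ^ 2 + a₂ ^ 2) := by positivity
      rcases (not_lt.1 hcon).eq_or_lt with h | h
      · rw [h, abs_zero] at hmabs; linarith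
      · exact h
    obtain ⟨c, hc1, hc2⟩ : ∃ c : ℝ, c < 0 ∧ m < 2 * c * (τ' 0) ^ 2 := by
      refine ⟨m / (4 * (τ' 0) ^ 2), div_neg_of_neg_of_pos hmneg (by positivity), ?_⟩
      have : 2 * (m / (4 * (τ' 0) ^ 2)) * (τ' 0) ^ 2 = m / 2 := by field_simp; ring
      rw [this]; linarith
    have h1 := hτopen (fun u => 0 ≤ w u ∧ w u ≤ c * τ u ^ 2) (hwnn.and (hupp c hc2))
    obtain ⟨ε, hε, hball⟩ := Metric.eventually_nhds_iff.1 h1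
    obtain ⟨u, ⟨hu1, hu2⟩, hu3⟩ := hball (y := ε / 2)
      (by rw [Real.dist_eq, sub_zero, abs_of_pos (by linarith)]; linarith)
    rw [hu3] at hu2
    nlinarith [sq_pos_of_pos (by linarith : 0 < ε / 2)]
  rw [abs_of_pos hmpos] at hmabs
  -- Then 2 c₀ τ'(0)² is half the lower bound for `m`, which leaves the strict margin needed by
  -- `hlow`.
  set c₀ := κ / (4 * N) with hc₀
  have hc₀pos : 0 < c₀ := by positivity
  have hc₀m : 2 * c₀ * (τ' 0) ^ 2 < m := by
    rw [hτ'sq]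
    have : 2 * c₀ * (N ^ 2 * (a₁ ^ 2 + a₂ ^ 2)) = κ * N * (a₁ ^ 2 + a₂ ^ 2) / 2 := by
      rw [hc₀]; field_simp; norm_num
    rw [this]
    have : 0 < κ * N * (a₁ ^ 2 + a₂ ^ 2) := by positivity
    linarith
  obtain ⟨c₁, hc₁pos, hc₁m⟩ : ∃ c : ℝ, 0 < c ∧ m < 2 * c * (τ' 0) ^ 2 := by
    refine ⟨m / (τ' 0) ^ 2, by positivity, ?_⟩
    have : 2 * (m / (τ' 0) ^ 2) * (τ' 0) ^ 2 = 2 * m := by field_simp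
    rw [this]; linarith
  refine ⟨by rw [← hg.base]; exact hcl.frontier_subset (hfr 0 ⟨by linarith, hδ⟩), c₁, hc₁pos, ?_⟩
  have hcurve := hτopen (fun u => u ∈ Set.Ioo (-δ) δ ∧ c₀ * τ u ^ 2 ≤ w u ∧ w u ≤ c₁ * τ u ^ 2)
    (Filter.Eventually.and hIoo ((hlow c₀ hc₀m).and (hupp c₁ hc₁m)))
  filter_upwards [hcurve] with T hT
  obtain ⟨u, ⟨huδ, hu1, hu2⟩, hu3⟩ := hT
  rw [hu3] at hu1 hu2
  exact ⟨g u, hfr u huδ, hu3, hu1, hu2⟩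

/-- If the boundary lies above a parabola along a supporting line, so does the whole convex body. -/
lemma eventually_parabola_le_of_frontier {C : Set (ℝ × ℝ)} (hC : Convex ℝ C)
    {p q : ℝ × ℝ} (hp : p ∈ C) (hq : q ∈ interior C) {ν₁ ν₂ c₀ c₁ : ℝ} (hν : 0 < ν₁ ^ 2 + ν₂ ^ 2)
    (hc₀pos : 0 < c₀) (hc₁pos : 0 < c₁)
    (hsup : ∀ z ∈ C, 0 ≤ ν₁ * (z.1 - p.1) + ν₂ * (z.2 - p.2))
    (hcurve : ∀ᶠ T in nhds (0 : ℝ), ∃ z ∈ frontier C,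
      -ν₂ * (z.1 - p.1) + ν₁ * (z.2 - p.2) = T ∧
      c₀ * T ^ 2 ≤ ν₁ * (z.1 - p.1) + ν₂ * (z.2 - p.2) ∧
      ν₁ * (z.1 - p.1) + ν₂ * (z.2 - p.2) ≤ c₁ * T ^ 2) :
    ∀ᶠ z in nhds p, z ∈ C → c₀ / 4 * (-ν₂ * (z.1 - p.1) + ν₁ * (z.2 - p.2)) ^ 2
      ≤ ν₁ * (z.1 - p.1) + ν₂ * (z.2 - p.2) := by
  set n : ℝ × ℝ → ℝ := fun z => ν₁ * (z.1 - p.1) + ν₂ * (z.2 - p.2) with hn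
  set T : ℝ × ℝ → ℝ := fun z => -ν₂ * (z.1 - p.1) + ν₁ * (z.2 - p.2) with hT
  have hnq : 0 < n q := by
    have hcont : ContinuousAt (fun e : ℝ => ((q.1 - e * ν₁, q.2 - e * ν₂) : ℝ × ℝ)) 0 := by fun_prop
    have hmem : ∀ᶠ e in nhds (0 : ℝ), ((q.1 - e * ν₁, q.2 - e * ν₂) : ℝ × ℝ) ∈ C := by
      apply hcont.eventually
      simp only [zero_mul, sub_zero]
      exact mem_interior_iff_mem_nhds.1 hq
    obtain ⟨ε, hε, hball⟩ := Metric.eventually_nhds_iff.1 hmem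
    have h1 := hsup _ (hball (y := ε / 2)
      (by rw [Real.dist_eq, sub_zero, abs_of_pos (by linarith)]; linarith))
    simp only at h1
    have h2 : 0 < ε / 2 * (ν₁ ^ 2 + ν₂ ^ 2) := by positivity
    simp only [hn]
    linarith
  have hTtend : Filter.Tendsto T (nhds p) (nhds 0) := by
    have : Continuous T := by fun_prop
    have h := this.tendsto p
    simpa [hT] using h
  have hThalf : Filter.Tendsto (fun z => T z / 2) (nhds p) (nhds 0) := by
    simpa using hTtend.div_const 2
  have hsmall : ∀ ε : ℝ, 0 < ε → ∀ᶠ z in nhds p, |T z| < ε := by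
    intro ε hε
    have := hTtend.abs
    rw [abs_zero] at this
    exact this.eventually (gt_mem_nhds hε)
  set M := |T q| + 1 with hM
  have hM0 : 0 < M := by positivity
  filter_upwards [hThalf.eventually hcurve, hsmall (n q / (2 * M * c₀)) (by positivity),
    hsmall (n q / (2 * M * c₁)) (by positivity), hsmall 1 one_pos] with z hz h1 h2 h3 hzC
  -- Suppose z in C lies under the smaller parabola. The boundary point w with half its tangential
  -- coordinate has height at least c₀ T(z)²/4 > n(z), hence lies strictly above the midpoint of p
  -- and z. Then w is a convex combination of p, z and q with positive weight on the interior point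
  -- q, hence interior itself: a contradiction.
  by_contra hcon
  push Not at hcon
  replace hcon : n z < c₀ / 4 * T z ^ 2 := hcon
  have hnz : 0 ≤ n z := hsup z hzC
  have hTz : T z ≠ 0 := by
    intro h; rw [h] at hcon; linarith
  have hTzp : 0 < |T z| := abs_pos.2 hTz
  obtain ⟨w, hwf, hw3, hw1, hw2⟩ := hz
  replace hw1 : c₀ * (T z / 2) ^ 2 ≤ n w := hw1
  replace hw2 : n w ≤ c₁ * (T z / 2) ^ 2 := hw2
  replace hw3 : T w = T z / 2 := hw3
  have hTq : |T q| ≤ M := by rw [hM]; linarith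
  have hTsq : T z ^ 2 = |T z| ^ 2 := (sq_abs _).symm
  -- Determinant of the system w - p = β(z - p) + θ(q - p) in the coordinates T and n, up to the
  -- factor T z. It is at least n(q)/2 near p, and the upper parabola makes θ small enough for all
  -- weights to be nonnegative.
  set D := n q - T q * (n z / T z) with hD
  have hDbd : |T q * (n z / T z)| ≤ n q / 2 := by
    rw [abs_mul, abs_div, abs_of_nonneg hnz]
    have h4 : n z / |T z| ≤ c₀ * |T z| := by
      rw [div_le_iff₀ hTzp]
      have : 0 ≤ c₀ * T z ^ 2 := by positivity
      have e : c₀ * |T z| * |T z| = c₀ * T z ^ 2 := by rw [hTsq]; ring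
      linarith
    rw [lt_div_iff₀ (by positivity)] at h1
    calc |T q| * (n z / |T z|) ≤ M * (c₀ * |T z|) := by gcongr
      _ ≤ n q / 2 := by linarith
  have hDlow : n q / 2 ≤ D := by linarith [le_abs_self (T q * (n z / T z))]
  have hDpos : 0 < D := by linarith
  set ξ := n w - n z / 2 with hξ
  have hξpos : 0 < ξ := by
    have : 0 ≤ c₀ * T z ^ 2 := by positivity
    rw [hξ]; linarith
  have hξle : ξ ≤ c₁ * |T z| ^ 2 / 4 := by rw [hξ, ← hTsq]; linarith
  set θ := ξ / D with hθ
  have hθpos : 0 < θ := by positivity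
  have hθle : θ * M ≤ |T z| / 4 := by
    rw [hθ, div_mul_eq_mul_div, div_le_iff₀ hDpos]
    rw [lt_div_iff₀ (by positivity)] at h2
    calc ξ * M ≤ (c₁ * |T z| ^ 2 / 4) * M := by gcongr
      _ = |T z| / 4 * (|T z| * M * c₁) := by ring
      _ ≤ |T z| / 4 * (n q / 2) := by gcongr; linarith
      _ ≤ |T z| / 4 * D := by gcongr
  have hθ4 : θ ≤ 1 / 4 := by
    have : θ * 1 ≤ θ * M := by
      gcongr; rw [hM]; linarith [abs_nonneg (T q)]
    linarith
  set β := 1 / 2 - θ * (T q / T z) with hβ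
  have hβbd : |θ * (T q / T z)| ≤ 1 / 4 := by
    rw [abs_mul, abs_of_pos hθpos, abs_div, mul_div_assoc', div_le_iff₀ hTzp]
    have : θ * |T q| ≤ θ * M := by gcongr
    linarith
  have hβ' := abs_le.1 hβbd
  have hβ0 : 0 ≤ β := by rw [hβ]; linarith [hβ'.2]
  have hα0 : 0 ≤ 1 - θ - β := by rw [hβ]; linarith [hβ'.1]
  have hcoordT : T w = β * T z + θ * T q := by
    rw [hw3, hβ]; field_simp; ring
  have hcoordn : n w = β * n z + θ * n q := by
    have h5 : θ * D = ξ := div_mul_cancel₀ _ hDpos.ne'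
    have h6 : β * n z + θ * n q = n z / 2 + θ * D := by rw [hβ, hD]; field_simp; ring
    rw [h6, h5, hξ]; ring
  have e1 : w.1 - p.1 = β * (z.1 - p.1) + θ * (q.1 - p.1) := by
    have h7 : (ν₁ ^ 2 + ν₂ ^ 2) * (w.1 - p.1) = (ν₁ ^ 2 + ν₂ ^ 2) * (β * (z.1 - p.1) + θ * (q.1 - p.1)) := by
      simp only [hT, hn] at hcoordT hcoordn
      linear_combination (-ν₂) * hcoordT + ν₁ * hcoordn
    exact mul_left_cancel₀ hν.ne' h7
  have e2 : w.2 - p.2 = β * (z.2 - p.2) + θ * (q.2 - p.2) := by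
    have h7 : (ν₁ ^ 2 + ν₂ ^ 2) * (w.2 - p.2) = (ν₁ ^ 2 + ν₂ ^ 2) * (β * (z.2 - p.2) + θ * (q.2 - p.2)) := by
      simp only [hT, hn] at hcoordT hcoordn
      linear_combination ν₁ * hcoordT + ν₂ * hcoordn
    exact mul_left_cancel₀ hν.ne' h7
  have h1θ : 0 < 1 - θ := by linarith
  have hr : ((1 - θ - β) / (1 - θ)) • p + (β / (1 - θ)) • z ∈ C :=
    hC hp hzC (by positivity) (by positivity) (by field_simp; ring)
  have hint : w ∈ interior C := by
    apply hC.openSegment_interior_self_subset_interior hq hr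
    refine ⟨θ, 1 - θ, hθpos, h1θ, by ring, ?_⟩
    apply Prod.ext
    · simp only [Prod.fst_add, Prod.smul_fst, smul_eq_mul]
      field_simp
      linarith
    · simp only [Prod.snd_add, Prod.smul_snd, smul_eq_mul]
      field_simp
      linarith
  exact hwf.2 hint

/-- A boundary point of a convex body at which the boundary is smooth with curvature at least `κ`
has locally a supporting parabola with respect to any supporting line. -/
theorem eventually_quadratic_support {C : Set (ℝ × ℝ)} (hC : Convex ℝ C) (hcl : IsClosed C)
    {q : ℝ × ℝ} (hq : q ∈ interior C) {p : ℝ × ℝ} {κ : ℝ} (hκ : 0 < κ)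
    (hsm : SmoothWithCurvatureGE (frontier C) p κ) {ν₁ ν₂ : ℝ} (hν : 0 < ν₁ ^ 2 + ν₂ ^ 2)
    (hsup : ∀ z ∈ C, 0 ≤ ν₁ * (z.1 - p.1) + ν₂ * (z.2 - p.2)) :
    ∀ᶠ z in nhds p, z ∈ C →
      κ / 32 * √(ν₁ ^ 2 + ν₂ ^ 2) * ((z.1 - p.1) ^ 2 + (z.2 - p.2) ^ 2)
        ≤ ν₁ * (z.1 - p.1) + ν₂ * (z.2 - p.2) := by
  obtain ⟨hpC, c₁, hc₁, hcurve⟩ := exists_frontier_between_parabolas hcl hκ hsm hν hsup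
  set N := √(ν₁ ^ 2 + ν₂ ^ 2) with hN
  have hN0 : 0 < N := Real.sqrt_pos.2 hν
  have hN2 : N ^ 2 = ν₁ ^ 2 + ν₂ ^ 2 := Real.sq_sqrt hν.le
  set c₀ := κ / (4 * N) with hc₀
  have hc₀pos : 0 < c₀ := by positivity
  have hmain := eventually_parabola_le_of_frontier hC hpC hq hν hc₀pos hc₁ hsup hcurve
  set n : ℝ × ℝ → ℝ := fun z => ν₁ * (z.1 - p.1) + ν₂ * (z.2 - p.2) with hn
  set T : ℝ × ℝ → ℝ := fun z => -ν₂ * (z.1 - p.1) + ν₁ * (z.2 - p.2) with hT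
  have hTn : ∀ z, T z ^ 2 + n z ^ 2 = N ^ 2 * ((z.1 - p.1) ^ 2 + (z.2 - p.2) ^ 2) := by
    intro z; simp only [hT, hn]; rw [hN2]; ring
  have hntend : Filter.Tendsto n (nhds p) (nhds 0) := by
    have : Continuous n := by fun_prop
    have h := this.tendsto p
    simpa [hn] using h
  have hnsmall : ∀ᶠ z in nhds p, n z < 1 / (c₀ / 4) := hntend.eventually (gt_mem_nhds (by positivity))
  -- Near p the height dominates (c₀/4) n², so T² may be completed to T² + n² = N²|z - p|² at the
  -- cost of a factor 2; this gives (κ/(16N)) N²/2 = κN/32.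
  filter_upwards [hmain, hnsmall] with z h1 h2 hzC
  have h3 : c₀ / 4 * T z ^ 2 ≤ n z := h1 hzC
  have h4 : 0 ≤ n z := hsup z hzC
  rw [lt_div_iff₀ (by positivity)] at h2
  have h5 : c₀ / 4 * n z ^ 2 ≤ n z := by nlinarith
  have h6 : c₀ / 4 * (T z ^ 2 + n z ^ 2) ≤ 2 * n z := by linarith
  rw [hTn] at h6
  have h7 : c₀ / 4 * (N ^ 2 * ((z.1 - p.1) ^ 2 + (z.2 - p.2) ^ 2))
      = 2 * (κ / 32 * N * ((z.1 - p.1) ^ 2 + (z.2 - p.2) ^ 2)) := by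
    rw [hc₀]; field_simp; ring
  rw [h7] at h6
  show _ ≤ n z
  linarith

/-! ### The body as a region between two graphs. -/

/-- The region between the graphs of `f` and `h` over `[a, b]`. -/
def profileRegion (a b : ℝ) (f h : ℝ → ℝ) : Set (ℝ × ℝ) :=
  {z | z.1 ∈ Set.Icc a b ∧ f z.1 ≤ z.2 ∧ z.2 ≤ h z.1}

lemma mem_profileRegion {a b : ℝ} {f h : ℝ → ℝ} {z : ℝ × ℝ} :
    z ∈ profileRegion a b f h ↔ z.1 ∈ Set.Icc a b ∧ f z.1 ≤ z.2 ∧ z.2 ≤ h z.1 := Iff.rfl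

/-- A planar convex body is the region between a convex and a concave graph. -/
lemma exists_profile {C : Set (ℝ × ℝ)} (hc : IsCompact C) (hC : Convex ℝ C) (hne : C.Nonempty) :
    ∃ a b f h, C = profileRegion a b f h ∧ (∀ x ∈ Set.Icc a b, f x ≤ h x) ∧
      ConvexOn ℝ (Set.Icc a b) f ∧ ConcaveOn ℝ (Set.Icc a b) h := by
  have hfst : IsConnected (Prod.fst '' C) :=
    ⟨hne.image _, (hC.isPreconnected).image _ continuous_fst.continuousOn⟩
  set a := sInf (Prod.fst '' C)
  set b := sSup (Prod.fst '' C)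
  have hab : Prod.fst '' C = Set.Icc a b := eq_Icc_of_connected_compact hfst (hc.image continuous_fst)
  set f : ℝ → ℝ := fun x => sInf {y | (x, y) ∈ C} with hf
  set h : ℝ → ℝ := fun x => sSup {y | (x, y) ∈ C} with hh
  have hslice : ∀ x ∈ Set.Icc a b, {y | (x, y) ∈ C} = Set.Icc (f x) (h x) := by
    intro x hx
    rw [← hab] at hx
    obtain ⟨z, hz, rfl⟩ := hx
    have hcomp : IsCompact {y | (z.1, y) ∈ C} := by
      have : {y | (z.1, y) ∈ C} = Prod.snd '' (C ∩ Prod.fst ⁻¹' {z.1}) := by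
        ext y
        simp only [Set.mem_ofPred_eq, Set.mem_image, Set.mem_inter_iff, Set.mem_preimage,
          Set.mem_singleton_iff, Prod.exists, exists_eq_right]
      rw [this]
      exact (hc.inter_right (isClosed_singleton.preimage continuous_fst)).image continuous_snd
    have hconv : Convex ℝ {y | (z.1, y) ∈ C} := by
      intro y₁ hy₁ y₂ hy₂ s t hs ht hst
      have := hC hy₁ hy₂ hs ht hst
      simp only [Prod.smul_mk, Prod.mk_add_mk] at this
      have e : s • z.1 + t • z.1 = z.1 := by rw [← add_smul, hst, one_smul]
      rw [e] at this
      exact this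
    exact eq_Icc_of_connected_compact ⟨⟨z.2, hz⟩, hconv.isPreconnected⟩ hcomp
  have hCeq : C = profileRegion a b f h := by
    ext z
    rw [mem_profileRegion]
    constructor
    · intro hz
      have hx : z.1 ∈ Set.Icc a b := hab ▸ Set.mem_image_of_mem _ hz
      have : z.2 ∈ {y | (z.1, y) ∈ C} := hz
      rw [hslice _ hx] at this
      exact ⟨hx, this⟩
    · rintro ⟨hx, hy⟩
      have : z.2 ∈ Set.Icc (f z.1) (h z.1) := hy
      rw [← hslice _ hx] at this
      exact this
  have hfh : ∀ x ∈ Set.Icc a b, f x ≤ h x := by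
    intro x hx
    have hx' := hx
    rw [← hab] at hx'
    obtain ⟨z, hz, rfl⟩ := hx'
    have : z.2 ∈ {y | (z.1, y) ∈ C} := hz
    rw [hslice _ hx] at this
    exact this.1.trans this.2
  refine ⟨a, b, f, h, hCeq, hfh, ⟨convex_Icc a b, ?_⟩, ⟨convex_Icc a b, ?_⟩⟩
  · intro x hx y hy s t hs ht hst
    have h1 : (x, f x) ∈ C := by rw [hCeq]; exact ⟨hx, le_rfl, hfh x hx⟩
    have h2 : (y, f y) ∈ C := by rw [hCeq]; exact ⟨hy, le_rfl, hfh y hy⟩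
    have h3 := hC h1 h2 hs ht hst
    rw [hCeq] at h3
    exact h3.2.1
  · intro x hx y hy s t hs ht hst
    have h1 : (x, h x) ∈ C := by rw [hCeq]; exact ⟨hx, hfh x hx, le_rfl⟩
    have h2 : (y, h y) ∈ C := by rw [hCeq]; exact ⟨hy, hfh y hy, le_rfl⟩
    have h3 := hC h1 h2 hs ht hst
    rw [hCeq] at h3
    exact h3.2.2

lemma mem_interior_profileRegion {a b : ℝ} {f h : ℝ → ℝ} (hf : ConvexOn ℝ (Set.Icc a b) f)
    (hh : ConcaveOn ℝ (Set.Icc a b) h) {z : ℝ × ℝ} (hz : z.1 ∈ Set.Ioo a b) (h1 : f z.1 < z.2)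
    (h2 : z.2 < h z.1) : z ∈ interior (profileRegion a b f h) := by
  have hfc : ContinuousAt f z.1 := by
    have := hf.continuousOn_interior
    rw [interior_Icc] at this
    exact this.continuousAt (isOpen_Ioo.mem_nhds hz)
  have hhc : ContinuousAt h z.1 := by
    have := hh.continuousOn_interior
    rw [interior_Icc] at this
    exact this.continuousAt (isOpen_Ioo.mem_nhds hz)
  rw [mem_interior_iff_mem_nhds]
  have t1 : Filter.Tendsto Prod.fst (nhds z) (nhds z.1) := continuous_fst.tendsto z
  have t2 : Filter.Tendsto Prod.snd (nhds z) (nhds z.2) := continuous_snd.tendsto z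
  filter_upwards [t1.eventually (isOpen_Ioo.mem_nhds hz),
    (hfc.tendsto.comp t1).eventually_lt t2 h1,
    t2.eventually_lt (hhc.tendsto.comp t1) h2] with w hw1 hw2 hw3
  exact ⟨⟨hw1.1.le, hw1.2.le⟩, hw2.le, hw3.le⟩

lemma mem_frontier_of_lower {a b : ℝ} {f h : ℝ → ℝ} {x : ℝ} (hx : x ∈ Set.Icc a b) (hfh : f x ≤ h x) :
    (x, f x) ∈ frontier (profileRegion a b f h) := by
  refine ⟨subset_closure ⟨hx, le_rfl, hfh⟩, fun hint => ?_⟩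
  have hcont : ContinuousAt (fun y : ℝ => ((x, y) : ℝ × ℝ)) (f x) := by fun_prop
  have := hcont.eventually (mem_interior_iff_mem_nhds.1 hint)
  obtain ⟨ε, hε, hball⟩ := Metric.eventually_nhds_iff.1 this
  have h1 := hball (y := f x - ε / 2) (by
    have e : f x - ε / 2 - f x = -(ε / 2) := by ring
    rw [Real.dist_eq, e, abs_neg, abs_of_pos (by linarith)]; linarith)
  have := h1.2.1
  simp only at this
  linarith

lemma mem_frontier_of_upper {a b : ℝ} {f h : ℝ → ℝ} {x : ℝ} (hx : x ∈ Set.Icc a b) (hfh : f x ≤ h x) :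
    (x, h x) ∈ frontier (profileRegion a b f h) := by
  refine ⟨subset_closure ⟨hx, hfh, le_rfl⟩, fun hint => ?_⟩
  have hcont : ContinuousAt (fun y : ℝ => ((x, y) : ℝ × ℝ)) (h x) := by fun_prop
  have := hcont.eventually (mem_interior_iff_mem_nhds.1 hint)
  obtain ⟨ε, hε, hball⟩ := Metric.eventually_nhds_iff.1 this
  have h1 := hball (y := h x + ε / 2) (by
    have e : h x + ε / 2 - h x = ε / 2 := by ring
    rw [Real.dist_eq, e, abs_of_pos (by linarith)]; linarith)
  have := h1.2.2
  simp only at this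
  linarith

/-- Curvature of the boundary in terms of the functions whose graphs bound the body: `e = 1` for the
lower and `e = -1` for the upper boundary. -/
lemma eventually_parabola_le_profile {C : Set (ℝ × ℝ)} (hC : Convex ℝ C) (hcl : IsClosed C)
    {q : ℝ × ℝ} (hq : q ∈ interior C) {e : ℝ} (he : e ^ 2 = 1) {φ : ℝ → ℝ} {a b x s κ : ℝ}
    (hCφ : ∀ z ∈ C, z.1 ∈ Set.Icc a b ∧ φ z.1 ≤ e * z.2)
    (hφC : ∀ y ∈ Set.Icc a b, (y, e * φ y) ∈ C)
    (hx : x ∈ Set.Ioo a b) (hφc : ContinuousAt φ x)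
    (hs : ∀ y ∈ Set.Icc a b, φ x + s * (y - x) ≤ φ y) (hκ : 0 < κ)
    (hsm : SmoothWithCurvatureGE (frontier C) (x, e * φ x) κ) :
    ∀ᶠ y in nhds x, φ x + s * (y - x) + κ / 128 * (max 1 |s|) ^ 3 * (y - x) ^ 2 ≤ φ y := by
  have hee : ∀ r : ℝ, e * (e * r) = r := fun r => by rw [← mul_assoc, ← sq, he, one_mul]
  have hX := eventually_quadratic_support hC hcl hq hκ hsm (ν₁ := -s) (ν₂ := e)
    (by rw [he]; positivity)
    (by
      intro z hz
      obtain ⟨h1, h2⟩ := hCφ z hz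
      have h3 := hs z.1 h1
      simp only
      rw [mul_sub e, hee]
      linarith)
  have hcont : ContinuousAt (fun y => ((y, e * φ y) : ℝ × ℝ)) x :=
    continuousAt_id.prodMk (continuousAt_const.mul hφc)
  have hX' := hcont.eventually hX
  set σ := max 1 |s| with hσ
  have hσ1 : 1 ≤ σ := le_max_left _ _
  have hσs : |s| ≤ σ := le_max_right _ _
  have hσ0 : 0 < σ := by linarith
  have hN : σ ≤ √((-s) ^ 2 + e ^ 2) := by
    rw [he]
    apply Real.le_sqrt_of_sq_le
    rcases max_choice 1 |s| with h | h
    · rw [hσ, h]; nlinarith [sq_nonneg s]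
    · rw [hσ, h, sq_abs]; linarith [neg_sq s]
  have hσ2 : σ ^ 2 ≤ 1 + s ^ 2 := by
    rcases max_choice 1 |s| with h | h
    · rw [hσ, h]; nlinarith [sq_nonneg s]
    · rw [hσ, h, sq_abs]; linarith
  have hnear : ∀ᶠ y in nhds x, s ≠ 0 → |y - x| < 64 * |s| / (κ * σ ^ 3) := by
    by_cases hs0 : s = 0
    · exact Filter.Eventually.of_forall fun y h => absurd hs0 h
    · have hpos : 0 < 64 * |s| / (κ * σ ^ 3) := by
        have := abs_pos.2 hs0
        positivity
      filter_upwards [Metric.ball_mem_nhds x hpos] with y hy _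
      simpa [Real.dist_eq] using hy
  filter_upwards [hX', hnear, isOpen_Ioo.mem_nhds hx] with y h1 h2 hy
  have hyI : y ∈ Set.Icc a b := ⟨hy.1.le, hy.2.le⟩
  have h3 := h1 (hφC y hyI)
  have e1 : -s * (y - x) + e * (e * φ y - e * φ x) = φ y - φ x - s * (y - x) := by
    rw [mul_sub e, hee, hee]; ring
  have e2 : (e * φ y - e * φ x) ^ 2 = (φ y - φ x) ^ 2 := by
    rw [← mul_sub, mul_pow, he, one_mul]
  rw [e1, e2] at h3
  -- If φ changes by at least |s||y - x|/2, the squared distance is at least σ²(y - x)²/4, and the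
  -- normal of length at least σ supplies the third power. Otherwise the graph leaves its tangent
  -- linearly, which beats any quadratic close to x.
  rcases le_or_gt (|s| * |y - x| / 2) |φ y - φ x| with hcase | hcase
  · have h4 : s ^ 2 * (y - x) ^ 2 / 4 ≤ (φ y - φ x) ^ 2 := by
      have := pow_le_pow_left₀ (by positivity) hcase 2
      rw [sq_abs, div_pow, mul_pow, sq_abs, sq_abs] at this
      linarith
    have h5 : σ ^ 2 / 4 * (y - x) ^ 2 ≤ (y - x) ^ 2 + (φ y - φ x) ^ 2 := by
      nlinarith [sq_nonneg (y - x)]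
    have h6 : κ / 32 * σ * (σ ^ 2 / 4 * (y - x) ^ 2)
        ≤ κ / 32 * √((-s) ^ 2 + e ^ 2) * ((y - x) ^ 2 + (φ y - φ x) ^ 2) := by gcongr
    have h7 : κ / 32 * σ * (σ ^ 2 / 4 * (y - x) ^ 2) = κ / 128 * σ ^ 3 * (y - x) ^ 2 := by ring
    linarith
  · have hs0 : s ≠ 0 := by
      rintro rfl
      simp only [abs_zero, zero_mul, zero_div] at hcase
      exact absurd hcase (not_lt.2 (abs_nonneg _))
    have h4 := h2 hs0
    rw [lt_div_iff₀ (by positivity)] at h4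
    have h5 : |s| * |y - x| / 2 ≤ φ y - φ x - s * (y - x) := by
      have h6 := hs y hyI
      have h7 : |s * (y - x)| ≤ |φ y - φ x| + |φ y - φ x - s * (y - x)| := by
        have := abs_sub (φ y - φ x) (φ y - φ x - s * (y - x))
        rwa [sub_sub_cancel] at this
      rw [abs_mul, abs_of_nonneg (by linarith : 0 ≤ φ y - φ x - s * (y - x))] at h7
      linarith
    have h8 : κ / 128 * σ ^ 3 * (y - x) ^ 2 ≤ |s| * |y - x| / 2 := by
      rw [← sq_abs (y - x)]
      have := mul_le_mul_of_nonneg_right h4.le (abs_nonneg (y - x))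
      nlinarith
    linarith

/-- Near a vertical supporting line the body is contained in a parabola. -/
lemma exists_sq_le_of_vertical_support {C : Set (ℝ × ℝ)} (hC : Convex ℝ C) (hcl : IsClosed C)
    {q : ℝ × ℝ} (hq : q ∈ interior C) {p : ℝ × ℝ} (hp : p ∈ C) {e κ : ℝ} (he : e ^ 2 = 1)
    (hdiam : ∀ z ∈ C, dist z p ≤ 1) (hsup : ∀ z ∈ C, 0 ≤ e * (z.1 - p.1)) (hκ : 0 < κ)
    (hsm : SmoothWithCurvatureGE (frontier C) p κ) :
    ∃ K : ℝ, 0 < K ∧ ∀ z ∈ C, (z.2 - p.2) ^ 2 ≤ K * (e * (z.1 - p.1)) := by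
  have hX := eventually_quadratic_support hC hcl hq hκ hsm (ν₁ := e) (ν₂ := 0)
    (by rw [he]; norm_num) (fun z hz => by simpa using hsup z hz)
  obtain ⟨ε, hε, hball⟩ := Metric.eventually_nhds_iff.1 hX
  -- The homothety of ratio θ towards p maps C into the part of C within ε of p, which makes the
  -- local estimate global.
  set θ := min 1 (ε / 2) with hθ
  have hθ0 : 0 < θ := lt_min one_pos (by linarith)
  have hθ1 : θ ≤ 1 := min_le_left _ _
  have hθε : θ < ε := (min_le_right _ _).trans_lt (by linarith)
  refine ⟨32 / (κ * θ), by positivity, fun z hz => ?_⟩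
  have hw : (1 - θ) • p + θ • z ∈ C := hC hp hz (by linarith) hθ0.le (by ring)
  have hd : dist ((1 - θ) • p + θ • z) p < ε := by
    have e1 : (1 - θ) • p + θ • z - p = θ • (z - p) := by
      rw [sub_smul, one_smul, smul_sub]; abel
    rw [dist_eq_norm, e1, norm_smul, Real.norm_of_nonneg hθ0.le, ← dist_eq_norm]
    calc θ * dist z p ≤ θ * 1 := by gcongr; exact hdiam z hz
      _ < ε := by linarith
  have h1 := hball hd hw
  simp only [Prod.fst_add, Prod.smul_fst, Prod.snd_add, Prod.smul_snd, smul_eq_mul] at h1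
  rw [he] at h1
  have e1 : (1 - θ) * p.1 + θ * z.1 - p.1 = θ * (z.1 - p.1) := by ring
  have e2 : (1 - θ) * p.2 + θ * z.2 - p.2 = θ * (z.2 - p.2) := by ring
  have e3 : √(1 + 0 ^ 2 : ℝ) = 1 := by norm_num
  rw [e1, e2, e3] at h1
  have h2 : κ / 32 * (θ * (z.2 - p.2)) ^ 2 ≤ e * (θ * (z.1 - p.1)) := by
    have : 0 ≤ κ / 32 * (θ * (z.1 - p.1)) ^ 2 := by positivity
    linarith
  rw [div_mul_eq_mul_div, le_div_iff₀ (by positivity)]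
  have h3 : θ * ((z.2 - p.2) ^ 2 * (κ * θ)) ≤ θ * (32 * (e * (z.1 - p.1))) := by linarith
  exact le_of_mul_le_mul_left h3 hθ0

/-- Strict midpoint convexity of |x|^γ; it prevents the concave upper boundary from coinciding with
the flat graph on any interval. -/
lemma two_mul_abs_rpow_lt {γ : ℝ} (hγ : 1 < γ) (x : ℝ) {r : ℝ} (hr : r ≠ 0) :
    2 * |x| ^ γ < |x + r| ^ γ + |x - r| ^ γ := by
  have hx : |x| ≤ 1 / 2 * |x + r| + 1 / 2 * |x - r| := by
    have := abs_add_le (x + r) (x - r)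
    have e : x + r + (x - r) = 2 * x := by ring
    rw [e, abs_mul, abs_two] at this
    linarith
  by_cases h : |x + r| = |x - r|
  · have hx0 : x = 0 := by
      rcases abs_eq_abs.1 h with h | h
      · exact absurd (by linarith : r = 0) hr
      · linarith
    subst hx0
    have h1 : 0 < |r| ^ γ := Real.rpow_pos_of_pos (abs_pos.2 hr) _
    simp only [abs_zero, zero_add, zero_sub, abs_neg]
    rw [Real.zero_rpow (by linarith)]
    linarith
  · have h1 := (strictConvexOn_rpow hγ).2 (abs_nonneg (x + r)) (abs_nonneg (x - r)) h
      (by norm_num : (0 : ℝ) < 1 / 2) (by norm_num : (0 : ℝ) < 1 / 2) (by norm_num)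
    simp only [smul_eq_mul] at h1
    have h2 : |x| ^ γ ≤ (1 / 2 * |x + r| + 1 / 2 * |x - r|) ^ γ :=
      Real.rpow_le_rpow (abs_nonneg _) hx (by linarith)
    linarith

/-- Analytic description of a body `C_γ` by the functions bounding it from below and above. -/
structure IsFlatProfile (γ : ℝ) (C : Set (ℝ × ℝ)) (a b : ℝ) (f h : ℝ → ℝ) (ε c K : ℝ) : Prop where
  eq : C = profileRegion a b f h
  le : ∀ x ∈ Set.Icc a b, f x ≤ h x
  convex : ConvexOn ℝ (Set.Icc a b) f
  concave : ConcaveOn ℝ (Set.Icc a b) h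
  bounds : ∀ x ∈ Set.Icc a b, |x| ≤ 1 ∧ |f x| ≤ 1 ∧ |h x| ≤ 1
  pos : 0 < ε
  left : a < -ε
  right : ε < b
  flat : ∀ x, |x| ≤ ε → f x = |x| ^ γ
  curv_pos : 0 < c
  curv_le : c ≤ 1
  lower : ∀ x ∈ Set.Ioo a b, ε ≤ |x| → ∀ᶠ y in nhds x, f x + derivWithin f (Set.Ioi x) x * (y - x)
    + 2 * c * (max 1 |derivWithin f (Set.Ioi x) x|) ^ 3 * (y - x) ^ 2 ≤ f y
  upper : ∀ x ∈ Set.Ioo a b, ∀ᶠ y in nhds x,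
    -h x + derivWithin (fun z => -h z) (Set.Ioi x) x * (y - x)
    + 2 * c * (max 1 |derivWithin (fun z => -h z) (Set.Ioi x) x|) ^ 3 * (y - x) ^ 2 ≤ -h y
  left_end : ∀ x ∈ Set.Icc a b, h x - f x ≤ K * √(x - a)
  right_end : ∀ x ∈ Set.Icc a b, h x - f x ≤ K * √(b - x)

/-- A boundary point in ½U lies in U, where the boundary is the explicit graph; any other has
curvature at least κ. The upper boundary over the open base interval and the vertical tangent points
always fall in the second case, so only the lower boundary meets the flat point. -/
lemma exists_isFlatProfile {γ : ℝ} (hγ : 3 < γ) {C : Set (ℝ × ℝ)} (hC : IsFlatPointBody γ C) :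
    ∃ a b f h ε c K, IsFlatProfile γ C a b f h ε c K := by
  obtain ⟨U, hUo, hUc, hU0, hgraph, κ, hκ, hsm⟩ := hC.boundary
  have hcl := hC.compact.isClosed
  have hγ0 : 0 < γ := by linarith
  have hhalf : (1 / 2 : ℝ) • U ⊆ U := by
    rintro _ ⟨z, hz, rfl⟩
    have := hUc hU0 hz (by norm_num : (0 : ℝ) ≤ 1 / 2) (by norm_num : (0 : ℝ) ≤ 1 / 2) (by norm_num)
    simpa using this
  have hmemC : ∀ z ∈ U, z.2 = |z.1| ^ γ → z ∈ frontier C := by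
    intro z hz h
    have : z ∈ frontier C ∩ U := by rw [hgraph]; exact ⟨h, hz⟩
    exact this.1
  have hcurve : Continuous fun x : ℝ => ((x, |x| ^ γ) : ℝ × ℝ) :=
    continuous_id.prodMk (continuous_abs.rpow_const fun _ => Or.inr hγ0.le)
  -- a neighbourhood of the flat point
  obtain ⟨r, hr, hrU⟩ : ∃ r : ℝ, 0 < r ∧ ∀ x, |x| < r → (x, |x| ^ γ) ∈ U := by
    have h0 : ((0 : ℝ), |(0 : ℝ)| ^ γ) ∈ U := by
      rw [abs_zero, Real.zero_rpow hγ0.ne']; exact hU0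
    have := hcurve.continuousAt.eventually (hUo.mem_nhds h0)
    obtain ⟨r, hr, hball⟩ := Metric.eventually_nhds_iff.1 this
    exact ⟨r, hr, fun x hx => hball (by simpa [Real.dist_eq] using hx)⟩
  have h00 : ((0 : ℝ), (0 : ℝ)) ∈ frontier C := hmemC _ hU0 (by simp [Real.zero_rpow hγ0.ne'])
  have hne : C.Nonempty := ⟨_, hcl.frontier_subset h00⟩
  obtain ⟨a, b, f, h, hCeq, hfh, hf, hh⟩ := exists_profile hC.compact hC.convex hne
  have hnh : ConvexOn ℝ (Set.Icc a b) fun x => -h x := hh.neg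
  set ε := r / 2 with hε
  have hε0 : 0 < ε := by positivity
  have hcurveC : ∀ x, |x| ≤ ε → (x, |x| ^ γ) ∈ frontier C := fun x hx =>
    hmemC _ (hrU x (by linarith)) rfl
  have hcurveP : ∀ x, |x| < r → x ∈ Set.Icc a b ∧ f x ≤ |x| ^ γ ∧ |x| ^ γ ≤ h x := by
    intro x hx
    have := hcl.frontier_subset (hmemC _ (hrU x hx) rfl)
    rw [hCeq] at this
    exact this
  have hleft : a < -ε := by
    have := (hcurveP (-(3 / 2 * ε)) (by rw [abs_neg, abs_of_pos (by positivity)]; linarith)).1.1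
    linarith
  have hright : ε < b := by
    have := (hcurveP (3 / 2 * ε) (by rw [abs_of_pos (by positivity)]; linarith)).1.2
    linarith
  have hab : a < b := by linarith
  have hIoo : ∀ x, |x| ≤ ε → x ∈ Set.Ioo a b := fun x hx => by
    have := abs_le.1 hx
    constructor <;> linarith [this.1, this.2]
  have hIcc : ∀ {x}, x ∈ Set.Ioo a b → x ∈ Set.Icc a b := fun hx => ⟨hx.1.le, hx.2.le⟩
  -- an interior point
  obtain ⟨q, hq⟩ : ∃ q, q ∈ interior C := by
    refine ⟨(0, ε ^ γ / 2), ?_⟩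
    rw [hCeq]
    have h0 : (0 : ℝ) ∈ Set.Ioo a b := hIoo 0 (by simpa using hε0.le)
    have hεp : 0 < ε ^ γ := by positivity
    refine mem_interior_profileRegion hf hh h0 ?_ ?_
    · have := (hcurveP 0 (by simpa using hr)).2.1
      rw [abs_zero, Real.zero_rpow hγ0.ne'] at this
      simp only
      linarith
    · have h1 := hcurveP ε (by rw [abs_of_pos hε0]; linarith)
      have h2 := hcurveP (-ε) (by rw [abs_neg, abs_of_pos hε0]; linarith)
      have h3 := hh.2 h1.1 h2.1 (by norm_num : (0 : ℝ) ≤ 1 / 2) (by norm_num : (0 : ℝ) ≤ 1 / 2)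
        (by norm_num)
      rw [abs_of_pos hε0] at h1
      rw [abs_neg, abs_of_pos hε0] at h2
      simp only [smul_eq_mul] at h3 ⊢
      have e : 1 / 2 * ε + 1 / 2 * -ε = 0 := by ring
      rw [e] at h3
      linarith [h1.2.2, h2.2.2]
  have hfc : ∀ x ∈ Set.Ioo a b, ContinuousAt f x := fun x hx => by
    have := hf.continuousOn_interior
    rw [interior_Icc] at this
    exact this.continuousAt (isOpen_Ioo.mem_nhds hx)
  have hhc : ∀ x ∈ Set.Ioo a b, ContinuousAt h x := fun x hx => by
    have := hh.continuousOn_interior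
    rw [interior_Icc] at this
    exact this.continuousAt (isOpen_Ioo.mem_nhds hx)
  have hlowfr : ∀ x ∈ Set.Icc a b, (x, f x) ∈ frontier C := fun x hx => by
    rw [hCeq]; exact mem_frontier_of_lower hx (hfh x hx)
  have huppfr : ∀ x ∈ Set.Icc a b, (x, h x) ∈ frontier C := fun x hx => by
    rw [hCeq]; exact mem_frontier_of_upper hx (hfh x hx)
  have hgraphU : ∀ z ∈ frontier C, z ∈ U → z.2 = |z.1| ^ γ := by
    intro z hz hzU
    have : z ∈ frontier C ∩ U := ⟨hz, hzU⟩
    rw [hgraph] at this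
    exact this.1
  -- the lower boundary agrees with the graph inside `U`
  have hlowU : ∀ x ∈ Set.Ioo a b, (x, f x) ∈ U → f =ᶠ[nhds x] fun y => |y| ^ γ := by
    intro x hx hxU
    have hcont : ContinuousAt (fun y => ((y, f y) : ℝ × ℝ)) x := continuousAt_id.prodMk (hfc x hx)
    filter_upwards [hcont.eventually (hUo.mem_nhds hxU), isOpen_Ioo.mem_nhds hx] with y hy hyI
    exact hgraphU _ (hlowfr y (hIcc hyI)) hy
  -- the upper boundary does not meet `U`
  have huppU : ∀ x ∈ Set.Ioo a b, (x, h x) ∉ U := by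
    intro x hx hxU
    have hcont : ContinuousAt (fun y => ((y, h y) : ℝ × ℝ)) x := continuousAt_id.prodMk (hhc x hx)
    have hev : ∀ᶠ y in nhds x, y ∈ Set.Ioo a b ∧ h y = |y| ^ γ := by
      filter_upwards [hcont.eventually (hUo.mem_nhds hxU), isOpen_Ioo.mem_nhds hx] with y hy hyI
      exact ⟨hyI, hgraphU _ (huppfr y (hIcc hyI)) hy⟩
    obtain ⟨ρ, hρ, hball⟩ := Metric.eventually_nhds_iff.1 hev
    have h1 := hball (y := x + ρ / 2) (by
      rw [Real.dist_eq, add_sub_cancel_left, abs_of_pos (by positivity)]; linarith)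
    have h2 := hball (y := x - ρ / 2) (by
      have e : x - ρ / 2 - x = -(ρ / 2) := by ring
      rw [Real.dist_eq, e, abs_neg, abs_of_pos (by positivity)]; linarith)
    have h3 := hball (y := x) (by simpa using hρ)
    have h4 := hh.2 (hIcc h1.1) (hIcc h2.1) (by norm_num : (0 : ℝ) ≤ 1 / 2)
      (by norm_num : (0 : ℝ) ≤ 1 / 2) (by norm_num)
    simp only [smul_eq_mul] at h4
    have e : 1 / 2 * (x + ρ / 2) + 1 / 2 * (x - ρ / 2) = x := by ring
    rw [e, h1.2, h2.2, h3.2] at h4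
    have h5 := two_mul_abs_rpow_lt (γ := γ) (by linarith) x (r := ρ / 2) (by positivity)
    linarith
  -- A point of the explicit graph is a frontier point in U. It is not on the upper boundary, and
  -- strictly above the lower one it would be interior.
  have hflat : ∀ x, |x| ≤ ε → f x = |x| ^ γ := by
    intro x hx
    have hfr := hcurveC x hx
    have hP := hcurveP x (by linarith)
    by_contra hne'
    have h1 : f x < |x| ^ γ := lt_of_le_of_ne hP.2.1 hne'
    have h2 : |x| ^ γ < h x := by
      refine lt_of_le_of_ne hP.2.2 fun heq => ?_
      apply huppU x (hIoo x hx)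
      rw [← heq]
      exact hrU x (by linarith)
    apply hfr.2
    rw [hCeq]
    exact mem_interior_profileRegion hf hh (hIoo x hx) h1 h2
  have hbounds : ∀ x ∈ Set.Icc a b, |x| < 1 / 2 ∧ |f x| < 1 / 2 ∧ |h x| < 1 / 2 := by
    intro x hx
    have h1 := hC.subset_square (hcl.frontier_subset (hlowfr x hx))
    have h2 := hC.subset_square (hcl.frontier_subset (huppfr x hx))
    simp only [Set.mem_prod, Set.mem_Ioo] at h1 h2
    refine ⟨abs_lt.2 ⟨?_, ?_⟩, abs_lt.2 ⟨?_, ?_⟩, abs_lt.2 ⟨?_, ?_⟩⟩ <;> linarith [h1.1.1, h1.1.2, h1.2.1, h1.2.2, h2.2.1, h2.2.2]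
  have hsubf : ∀ x ∈ Set.Ioo a b, ∀ y ∈ Set.Icc a b,
      f x + derivWithin f (Set.Ioi x) x * (y - x) ≤ f y := fun x hx y hy =>
    hf.add_rightDeriv_mul_le (by rwa [interior_Icc]) hy
  have hsubh : ∀ x ∈ Set.Ioo a b, ∀ y ∈ Set.Icc a b,
      -h x + derivWithin (fun z => -h z) (Set.Ioi x) x * (y - x) ≤ -h y := fun x hx y hy =>
    hnh.add_rightDeriv_mul_le (by rwa [interior_Icc]) hy
  -- κ/256 matches the factor κ/128 of the curved case. The last term serves graph points with |x| ≥
  -- ε, where slopes are at most γ and the parabola coefficient is 2|x|^(γ-2).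
  set c := min 1 (min (κ / 256) (ε ^ (γ - 2) / γ ^ 3)) with hc
  have hc0 : 0 < c := lt_min one_pos (lt_min (by positivity) (by positivity))
  have hcκ : 2 * c ≤ κ / 128 := by
    have : c ≤ κ / 256 := (min_le_right _ _).trans (min_le_left _ _)
    linarith
  have hcε : c ≤ ε ^ (γ - 2) / γ ^ 3 := (min_le_right _ _).trans (min_le_right _ _)
  have hlower : ∀ x ∈ Set.Ioo a b, ε ≤ |x| → ∀ᶠ y in nhds x,
      f x + derivWithin f (Set.Ioi x) x * (y - x)
        + 2 * c * (max 1 |derivWithin f (Set.Ioi x) x|) ^ 3 * (y - x) ^ 2 ≤ f y := by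
    intro x hx hεx
    set s := derivWithin f (Set.Ioi x) x with hs
    by_cases hxU : (x, f x) ∈ (1 / 2 : ℝ) • U
    · have hev := hlowU x hx (hhalf hxU)
      have hx0 : x ≠ 0 := by
        rintro rfl; rw [abs_zero] at hεx; linarith
      obtain ⟨s', hs', hd, hloc⟩ := abs_rpow_local_support hγ hx0
      have hfd : HasDerivAt f s' x := hd.congr_of_eventuallyEq hev
      have hss : s = s' := by
        rw [hs]
        exact hfd.hasDerivWithinAt.derivWithin (uniqueDiffWithinAt_Ioi x)
      have hx1 : |x| ≤ 1 := by linarith [(hbounds x (hIcc hx)).1]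
      have hsγ : max 1 |s| ≤ γ := by
        refine max_le (by linarith) ?_
        rw [hss]
        refine hs'.trans ?_
        have : |x| ^ (γ - 1) ≤ 1 := Real.rpow_le_one (abs_nonneg _) hx1 (by linarith)
        nlinarith
      have hcoef : 2 * c * (max 1 |s|) ^ 3 ≤ 2 * |x| ^ (γ - 2) := by
        have h1 : (max 1 |s|) ^ 3 ≤ γ ^ 3 := by gcongr
        have h2 : c * γ ^ 3 ≤ ε ^ (γ - 2) := by rwa [le_div_iff₀ (by positivity)] at hcε
        have h3 : ε ^ (γ - 2) ≤ |x| ^ (γ - 2) := Real.rpow_le_rpow hε0.le hεx (by linarith)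
        have h4 : c * (max 1 |s|) ^ 3 ≤ c * γ ^ 3 := by gcongr
        linarith
      filter_upwards [hloc, hev] with y h1 h2
      rw [h2, hev.self_of_nhds, hss]
      rw [hss] at hcoef
      have := mul_le_mul_of_nonneg_right hcoef (sq_nonneg (y - x))
      linarith
    · have h1 := eventually_parabola_le_profile hC.convex hcl hq (e := 1) (by norm_num) (φ := f)
        (a := a) (b := b) (x := x) (s := s) (κ := κ)
        (by intro z hz; rw [hCeq] at hz; exact ⟨hz.1, by rw [one_mul]; exact hz.2.1⟩)
        (by intro y hy; rw [one_mul]; exact hcl.frontier_subset (hlowfr y hy))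
        hx (hfc x hx) (hsubf x hx) hκ
        (by rw [one_mul]; exact hsm _ ⟨hlowfr x (hIcc hx), hxU⟩)
      filter_upwards [h1] with y hy
      have h2 : 2 * c * (max 1 |s|) ^ 3 * (y - x) ^ 2 ≤ κ / 128 * (max 1 |s|) ^ 3 * (y - x) ^ 2 := by
        gcongr
      linarith
  have hupper : ∀ x ∈ Set.Ioo a b, ∀ᶠ y in nhds x,
      -h x + derivWithin (fun z => -h z) (Set.Ioi x) x * (y - x)
        + 2 * c * (max 1 |derivWithin (fun z => -h z) (Set.Ioi x) x|) ^ 3 * (y - x) ^ 2 ≤ -h y := by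
    intro x hx
    set s := derivWithin (fun z => -h z) (Set.Ioi x) x with hs
    have h1 := eventually_parabola_le_profile hC.convex hcl hq (e := -1) (by norm_num)
      (φ := fun z => -h z) (a := a) (b := b) (x := x) (s := s) (κ := κ)
      (by intro z hz; rw [hCeq] at hz; exact ⟨hz.1, by linarith [hz.2.2]⟩)
      (by
        intro y hy
        have e : (-1 : ℝ) * -h y = h y := by ring
        rw [e]; exact hcl.frontier_subset (huppfr y hy))
      hx (hhc x hx).neg (hsubh x hx) hκ
      (by
        have e : (-1 : ℝ) * -h x = h x := by ring
        rw [e]; exact hsm _ ⟨huppfr x (hIcc hx), fun hU => huppU x hx (hhalf hU)⟩)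
    filter_upwards [h1] with y hy
    have h2 : 2 * c * (max 1 |s|) ^ 3 * (y - x) ^ 2 ≤ κ / 128 * (max 1 |s|) ^ 3 * (y - x) ^ 2 := by
      gcongr
    linarith
  -- the two points with vertical tangent
  have hend : ∀ p ∈ frontier C, p.1 ≠ 0 → ∀ e : ℝ, e ^ 2 = 1 → (∀ z ∈ C, 0 ≤ e * (z.1 - p.1)) →
      ∃ K : ℝ, 0 < K ∧ ∀ z ∈ C, (z.2 - p.2) ^ 2 ≤ K * (e * (z.1 - p.1)) := by
    intro p hp hp0 e he hsup
    refine exists_sq_le_of_vertical_support hC.convex hcl hq (hcl.frontier_subset hp) he ?_ hsup hκ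
      (hsm p ⟨hp, fun hpU => ?_⟩)
    · intro z hz
      have h1 := hC.subset_square hz
      have h2 := hC.subset_square (hcl.frontier_subset hp)
      simp only [Set.mem_prod, Set.mem_Ioo] at h1 h2
      rw [Prod.dist_eq, max_le_iff, Real.dist_eq, Real.dist_eq, abs_le, abs_le]
      refine ⟨⟨?_, ?_⟩, ?_, ?_⟩ <;> linarith [h1.1.1, h1.1.2, h1.2.1, h1.2.2, h2.1.1, h2.1.2, h2.2.1, h2.2.2]
    -- If p were in U, the boundary near it would be a graph extending to both sides of the vertical
    -- line through p, which therefore could not be supporting.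
    · have hpU' := hhalf hpU
      have hp2 := hgraphU p hp hpU'
      have hpe : p = (p.1, |p.1| ^ γ) := Prod.ext rfl hp2
      rw [hpe] at hpU'
      have := hcurve.continuousAt.eventually (hUo.mem_nhds hpU')
      obtain ⟨ρ, hρ, hball⟩ := Metric.eventually_nhds_iff.1 this
      have h1 := hball (y := p.1 - e * (ρ / 2)) (by
        have e1 : p.1 - e * (ρ / 2) - p.1 = -(e * (ρ / 2)) := by ring
        have e2 : |e| = 1 := by
          rcases sq_eq_one_iff.1 he with h | h <;> simp [h]
        rw [Real.dist_eq, e1, abs_neg, abs_mul, e2, one_mul, abs_of_pos (by positivity)]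
        linarith)
      have h2 := hsup _ (hcl.frontier_subset (hmemC _ h1 rfl))
      simp only at h2
      have e3 : e * (p.1 - e * (ρ / 2) - p.1) = -(e ^ 2 * (ρ / 2)) := by ring
      rw [e3, he] at h2
      linarith
  obtain ⟨K₁, hK₁, hKl⟩ := hend (a, f a) (hlowfr a ⟨le_rfl, hab.le⟩) (by simp only; linarith) 1
    (by norm_num) (by intro z hz; rw [hCeq] at hz; simp only; linarith [hz.1.1])
  obtain ⟨K₂, hK₂, hKr⟩ := hend (b, f b) (hlowfr b ⟨hab.le, le_rfl⟩) (by simp only; linarith) (-1)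
    (by norm_num) (by intro z hz; rw [hCeq] at hz; simp only; linarith [hz.1.2])
  have hspread : ∀ {y z v B d M : ℝ}, (y - v) ^ 2 ≤ B * d → (z - v) ^ 2 ≤ B * d → 0 < B → 0 ≤ d →
      √B ≤ M → z - y ≤ 2 * M * √d := by
    intro y z v B d M h1 h2 hB hd hM
    have h3 := Real.abs_le_sqrt h1
    have h4 := Real.abs_le_sqrt h2
    rw [Real.sqrt_mul hB.le] at h3 h4
    have h5 : √B * √d ≤ M * √d := by gcongr
    have := abs_le.1 h3
    have := abs_le.1 h4
    linarith [(abs_le.1 h3).1, (abs_le.1 h4).2]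
  refine ⟨a, b, f, h, ε, c, 2 * max √K₁ √K₂, hCeq, hfh, hf, hh, ?_, hε0, hleft, hright, hflat, hc0,
    min_le_left _ _, hlower, hupper, ?_, ?_⟩
  · intro x hx
    have := hbounds x hx
    refine ⟨?_, ?_, ?_⟩ <;> linarith [this.1, this.2.1, this.2.2]
  · intro x hx
    have h1 := hKl _ (hcl.frontier_subset (hlowfr x hx))
    have h2 := hKl _ (hcl.frontier_subset (huppfr x hx))
    simp only [one_mul] at h1 h2
    exact hspread h1 h2 hK₁ (sub_nonneg.2 hx.1) (le_max_left _ _)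
  · intro x hx
    have h1 := hKr _ (hcl.frontier_subset (hlowfr x hx))
    have h2 := hKr _ (hcl.frontier_subset (huppfr x hx))
    have e : (-1 : ℝ) * (x - b) = b - x := by ring
    simp only [e] at h1 h2
    exact hspread h1 h2 hK₂ (sub_nonneg.2 hx.2) (le_max_right _ _)

/-! ### Riemann sums of concave functions. -/

/-- Midpoint inequality for integrals of concave functions. -/
lemma ConcaveOn.integral_le_midpoint {F : ℝ → ℝ} {c : ℝ}
    (hF : ConcaveOn ℝ (Set.Icc (c - 1 / 2) (c + 1 / 2)) F)
    (hi : IntervalIntegrable F volume (c - 1 / 2) (c + 1 / 2)) :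
    ∫ x in (c - 1 / 2)..(c + 1 / 2), F x ≤ F c := by
  have hi' : IntervalIntegrable (fun x => F (2 * c - x)) volume (c - 1 / 2) (c + 1 / 2) := by
    have := (hi.comp_sub_left (2 * c)).symm
    convert this using 1 <;> ring
  have e : ∫ x in (c - 1 / 2)..(c + 1 / 2), F (2 * c - x) = ∫ x in (c - 1 / 2)..(c + 1 / 2), F x := by
    rw [intervalIntegral.integral_comp_sub_left]
    congr 1 <;> ring
  have hle : ∫ x in (c - 1 / 2)..(c + 1 / 2), (F x + F (2 * c - x)) ≤
      ∫ _ in (c - 1 / 2)..(c + 1 / 2), 2 * F c := by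
    refine intervalIntegral.integral_mono_on (by linarith) (hi.add hi') (by simp) fun x hx => ?_
    have hx2 : 2 * c - x ∈ Set.Icc (c - 1 / 2) (c + 1 / 2) :=
      ⟨by linarith [hx.2], by linarith [hx.1]⟩
    have := hF.2 hx hx2 (by norm_num : (0 : ℝ) ≤ 1 / 2) (by norm_num : (0 : ℝ) ≤ 1 / 2) (by norm_num)
    simp only [smul_eq_mul] at this
    rw [show 1 / 2 * x + 1 / 2 * (2 * c - x) = c by ring] at this
    linarith
  rw [intervalIntegral.integral_add hi hi', e, intervalIntegral.integral_const, smul_eq_mul] at hle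
  linarith

/-- Trapezoid inequality for integrals of concave functions. -/
lemma ConcaveOn.trapezoid_le_integral {F : ℝ → ℝ} {c : ℝ}
    (hF : ConcaveOn ℝ (Set.Icc c (c + 1)) F) (hi : IntervalIntegrable F volume c (c + 1)) :
    (F c + F (c + 1)) / 2 ≤ ∫ x in c..(c + 1), F x := by
  have hi' : IntervalIntegrable (fun x => F (2 * c + 1 - x)) volume c (c + 1) := by
    have := (hi.comp_sub_left (2 * c + 1)).symm
    convert this using 1 <;> ring
  have e : ∫ x in c..(c + 1), F (2 * c + 1 - x) = ∫ x in c..(c + 1), F x := by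
    rw [intervalIntegral.integral_comp_sub_left]
    congr 1 <;> ring
  have hle : ∫ _ in c..(c + 1), (F c + F (c + 1)) ≤
      ∫ x in c..(c + 1), (F x + F (2 * c + 1 - x)) := by
    refine intervalIntegral.integral_mono_on (by linarith) (by simp) (hi.add hi') fun x hx => ?_
    have h0 : c ∈ Set.Icc c (c + 1) := ⟨le_rfl, by linarith⟩
    have h1 : c + 1 ∈ Set.Icc c (c + 1) := ⟨by linarith, le_rfl⟩
    have hx1 : 0 ≤ x - c := by linarith [hx.1]
    have hx2 : 0 ≤ c + 1 - x := by linarith [hx.2]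
    have e1 := hF.2 h0 h1 hx2 hx1 (by ring)
    have e2 := hF.2 h0 h1 hx1 hx2 (by ring)
    simp only [smul_eq_mul] at e1 e2
    rw [show (c + 1 - x) * c + (x - c) * (c + 1) = x by ring] at e1
    rw [show (x - c) * c + (c + 1 - x) * (c + 1) = 2 * c + 1 - x by ring] at e2
    linarith
  rw [intervalIntegral.integral_add hi hi', e, intervalIntegral.integral_const, smul_eq_mul] at hle
  linarith

/-- The error of a Riemann sum of a concave function vanishing like a square root at both ends. -/
lemma abs_sum_sub_integral_le {F : ℝ → ℝ} {A B M : ℝ} (hAB : A ≤ B)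
    (hF : ConcaveOn ℝ (Set.Icc A B) F) (h0 : ∀ x ∈ Set.Icc A B, 0 ≤ F x)
    (hi : IntervalIntegrable F volume A B)
    (hl : ∀ x ∈ Set.Icc A B, F x ≤ M * √(x - A)) (hr : ∀ x ∈ Set.Icc A B, F x ≤ M * √(B - x))
    (hM : 0 ≤ M) :
    |∑ n ∈ Finset.Icc ⌈A⌉ ⌊B⌋, F n - ∫ x in A..B, F x| ≤ 8 * M := by
  have hsub : ∀ {x y : ℝ}, A ≤ x → x ≤ y → y ≤ B → IntervalIntegrable F volume x y := by
    intro x y hx hxy hy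
    refine hi.mono_set ?_
    rw [Set.uIcc_of_le hxy, Set.uIcc_of_le hAB]
    exact Set.Icc_subset_Icc hx hy
  have hsqrt : ∀ x : ℝ, x ≤ 2 → √x ≤ 2 := fun x hx =>
    (Real.sqrt_le_sqrt hx).trans (by rw [Real.sqrt_le_left (by norm_num)]; norm_num)
  have hl2 : ∀ x ∈ Set.Icc A B, x ≤ A + 2 → F x ≤ 2 * M := fun x hx hx2 =>
    (hl x hx).trans (by nlinarith [hsqrt (x - A) (by linarith)])
  have hr2 : ∀ x ∈ Set.Icc A B, B - 2 ≤ x → F x ≤ 2 * M := fun x hx hx2 =>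
    (hr x hx).trans (by nlinarith [hsqrt (B - x) (by linarith)])
  have hint : ∀ {x y : ℝ}, A ≤ x → x ≤ y → y ≤ B → (∀ z ∈ Set.Icc x y, F z ≤ 2 * M) →
      ∫ z in x..y, F z ≤ (y - x) * (2 * M) := by
    intro x y hx hxy hy hz
    have := intervalIntegral.integral_mono_on hxy (hsub hx hxy hy)
      (intervalIntegrable_const (c := 2 * M)) hz
    rwa [intervalIntegral.integral_const, smul_eq_mul] at this
  have hpos : ∀ {x y : ℝ}, A ≤ x → x ≤ y → y ≤ B → 0 ≤ ∫ z in x..y, F z := by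
    intro x y hx hxy hy
    exact intervalIntegral.integral_nonneg hxy fun z hz => h0 z ⟨hx.trans hz.1, hz.2.trans hy⟩
  have hA1 := Int.le_ceil A
  have hA2 := Int.ceil_lt_add_one A
  have hB1 := Int.floor_le B
  have hB2 := Int.lt_floor_add_one B
  rcases lt_or_ge ⌈A⌉ ⌊B⌋ with hlt | hge
  · obtain ⟨N, hN⟩ := Int.eq_ofNat_of_zero_le (a := ⌊B⌋ - ⌈A⌉ - 1) (by omega)
    obtain ⟨m, hm⟩ : ∃ m, m = ⌈A⌉ := ⟨_, rfl⟩
    rw [← hm] at hA1 hA2 hN ⊢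
    have hBe : ⌊B⌋ = m + ((N + 1 : ℕ) : ℤ) := by push_cast; omega
    rw [hBe] at hB1 hB2 ⊢
    push_cast at hB1 hB2
    rw [sum_Icc_int_eq_sum_range (fun n : ℤ => F n)]
    push_cast
    have hk : ∀ k ∈ Finset.range (N + 1), (k : ℝ) ≤ N := fun k hk => by
      exact_mod_cast Nat.lt_succ_iff.1 (Finset.mem_range.1 hk)
    have hN0 : (0 : ℝ) ≤ N := N.cast_nonneg
    -- The trapezoid rule bounds the sum from above by the integral plus half the end values. The
    -- midpoint rule below bounds the inner integral by the interior terms. What is left lies within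
    -- 2 of an end, where F ≤ 2M.
    have hup : ∑ k ∈ Finset.range (N + 1), (F (m + k) + F (m + k + 1)) / 2 ≤
        ∫ x in (m : ℝ)..(m + N + 1), F x := by
      have e := intervalIntegral.sum_integral_adjacent_intervals (f := F) (μ := volume)
        (a := fun k : ℕ => (m : ℝ) + k) (n := N + 1) (fun k hk' => by
          have := hk k (Finset.mem_range.2 hk')
          refine hsub ?_ ?_ ?_ <;> push_cast <;> linarith [(Nat.cast_nonneg k : (0 : ℝ) ≤ k)])
      push_cast at e
      rw [add_zero, ← add_assoc] at e
      rw [← e]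
      refine Finset.sum_le_sum fun k hk' => ?_
      have := hk k hk'
      have hk0 : (0 : ℝ) ≤ k := k.cast_nonneg
      rw [← add_assoc]
      refine ConcaveOn.trapezoid_le_integral (hF.subset (Set.Icc_subset_Icc ?_ ?_)
        (convex_Icc _ _)) (hsub ?_ ?_ ?_) <;> linarith
    have hlow : ∫ x in (m + 1 / 2 : ℝ)..(m + N + 1 / 2), F x ≤
        ∑ k ∈ Finset.range N, F (m + k + 1) := by
      have hk2 : ∀ k < N, (k : ℝ) + 1 ≤ N := fun k hk => by exact_mod_cast hk
      have e := intervalIntegral.sum_integral_adjacent_intervals (f := F) (μ := volume)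
        (a := fun k : ℕ => (m : ℝ) + k + 1 / 2) (n := N) (fun k hk' => by
          have := hk2 k hk'
          refine hsub ?_ ?_ ?_ <;> push_cast <;> linarith [(Nat.cast_nonneg k : (0 : ℝ) ≤ k)])
      push_cast at e
      rw [add_zero] at e
      rw [← e]
      refine Finset.sum_le_sum fun k hk' => ?_
      have := hk2 k (Finset.mem_range.1 hk')
      have hk0 : (0 : ℝ) ≤ k := k.cast_nonneg
      have hmid := ConcaveOn.integral_le_midpoint (F := F) (c := m + k + 1)
        (hF.subset (Set.Icc_subset_Icc (by linarith) (by linarith)) (convex_Icc _ _))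
        (hsub (by linarith) (by linarith) (by linarith))
      rwa [show (m : ℝ) + k + 1 - 1 / 2 = m + k + 1 / 2 by ring,
        show (m : ℝ) + k + 1 + 1 / 2 = m + (k + 1) + 1 / 2 by ring] at hmid
    have s1 : ∫ x in A..B, F x = (∫ x in A..(m : ℝ), F x) + (∫ x in (m : ℝ)..(m + N + 1), F x)
        + ∫ x in (m + N + 1 : ℝ)..B, F x := by
      rw [intervalIntegral.integral_add_adjacent_intervals, intervalIntegral.integral_add_adjacent_intervals]
      all_goals refine hsub ?_ ?_ ?_ <;> linarith
    have s2 : ∫ x in A..B, F x = (∫ x in A..(m + 1 / 2 : ℝ), F x)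
        + (∫ x in (m + 1 / 2 : ℝ)..(m + N + 1 / 2), F x)
        + ∫ x in (m + N + 1 / 2 : ℝ)..B, F x := by
      rw [intervalIntegral.integral_add_adjacent_intervals, intervalIntegral.integral_add_adjacent_intervals]
      all_goals refine hsub ?_ ?_ ?_ <;> linarith
    have p1 := hpos (x := A) (y := m) le_rfl hA1 (by linarith)
    have p2 := hpos (x := m + N + 1) (y := B) (by linarith) (by linarith) le_rfl
    have q1 := hint (x := A) (y := m + 1 / 2) le_rfl (by linarith) (by linarith) fun z hz =>
      hl2 z ⟨hz.1, by linarith [hz.2]⟩ (by linarith [hz.2])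
    have q2 := hint (x := m + N + 1 / 2) (y := B) (by linarith) (by linarith) le_rfl fun z hz =>
      hr2 z ⟨by linarith [hz.1], hz.2⟩ (by linarith [hz.1])
    have f1 := hl2 m ⟨hA1, by linarith⟩ (by linarith)
    have f2 := hr2 (m + N + 1) ⟨by linarith, by linarith⟩ (by linarith)
    have f3 := h0 m ⟨hA1, by linarith⟩
    have f4 := h0 (m + N + 1) ⟨by linarith, by linarith⟩
    have q1' : (m + 1 / 2 - A) * (2 * M) ≤ 3 * M := by nlinarith
    have q2' : (B - (m + N + 1 / 2)) * (2 * M) ≤ 3 * M := by nlinarith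
    have t1 : ∑ k ∈ Finset.range (N + 1 + 1), F (m + k) =
        ∑ k ∈ Finset.range (N + 1), F (m + k) + F (m + N + 1) := by
      rw [Finset.sum_range_succ]; push_cast; rw [add_assoc (m : ℝ)]
    have t2 : ∑ k ∈ Finset.range (N + 1 + 1), F (m + k) =
        ∑ k ∈ Finset.range (N + 1), F (m + k + 1) + F m := by
      rw [Finset.sum_range_succ']; push_cast; simp only [add_assoc, add_zero]
    have t3 : ∑ k ∈ Finset.range (N + 1), F (m + k + 1) =
        ∑ k ∈ Finset.range N, F (m + k + 1) + F (m + N + 1) := Finset.sum_range_succ _ _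
    rw [← Finset.sum_div, Finset.sum_add_distrib] at hup
    rw [abs_le]
    constructor <;> linarith
  -- At most one integer in [A, B], so B - A < 2 and both quantities are O(M).
  · have hfl : ((⌊B⌋ : ℤ) : ℝ) ≤ ⌈A⌉ := by exact_mod_cast hge
    have hle := hint (x := A) (y := B) le_rfl hAB le_rfl fun z hz =>
      hl2 z hz (by linarith [hz.2])
    have hle' : (B - A) * (2 * M) ≤ 4 * M := by nlinarith
    have hp := hpos (x := A) (y := B) le_rfl hAB le_rfl
    have hs : 0 ≤ ∑ n ∈ Finset.Icc ⌈A⌉ ⌊B⌋, F n ∧ ∑ n ∈ Finset.Icc ⌈A⌉ ⌊B⌋, F n ≤ 2 * M := by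
      rcases hge.lt_or_eq with hlt | heq
      · rw [Finset.Icc_eq_empty (not_le.2 hlt), Finset.sum_empty]
        exact ⟨le_rfl, by linarith⟩
      · have hm : (⌈A⌉ : ℝ) ∈ Set.Icc A B := ⟨hA1, by rw [← heq]; exact hB1⟩
        rw [heq, Finset.Icc_self, Finset.sum_singleton]
        exact ⟨h0 _ hm, hl2 _ hm (by linarith)⟩
    rw [abs_le]
    constructor <;> linarith [hs.1, hs.2]

/-! ### Counting by columns. -/

/-- Counting the lattice points of a dilated and translated region column by column. -/
lemma ncard_smul_add_inter_integerPoints {a b : ℝ} {f h : ℝ → ℝ}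
    (hfh : ∀ x ∈ Set.Icc a b, f x ≤ h x) {R : ℝ} (hR : 0 < R) (t : ℝ × ℝ) :
    (((R • profileRegion a b f h + {t}) ∩ integerPoints).ncard : ℝ) =
      ∑ n ∈ Finset.Icc ⌈R * a + t.1⌉ ⌊R * b + t.1⌋,
        ((⌊R * h ((n - t.1) / R) + t.2⌋ : ℝ) - ⌈R * f ((n - t.1) / R) + t.2⌉ + 1) := by
  set P : Finset (Σ _ : ℤ, ℤ) := (Finset.Icc ⌈R * a + t.1⌉ ⌊R * b + t.1⌋).sigma fun n =>
    Finset.Icc ⌈R * f ((n - t.1) / R) + t.2⌉ ⌊R * h ((n - t.1) / R) + t.2⌋ with hP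
  have hcol : ∀ n : ℤ, n ∈ Finset.Icc ⌈R * a + t.1⌉ ⌊R * b + t.1⌋ ↔
      ((n : ℝ) - t.1) / R ∈ Set.Icc a b := by
    intro n
    rw [Finset.mem_Icc, Int.ceil_le, Int.le_floor, Set.mem_Icc, le_div_iff₀ hR, div_le_iff₀ hR]
    constructor <;> rintro ⟨h1, h2⟩ <;> constructor <;> linarith
  have hset : (R • profileRegion a b f h + {t}) ∩ integerPoints =
      (fun q : Σ _ : ℤ, ℤ => (((q.1 : ℝ), (q.2 : ℝ)) : ℝ × ℝ)) '' (P : Set (Σ _ : ℤ, ℤ)) := by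
    ext z
    constructor
    · rintro ⟨hz, ⟨n, m⟩, rfl⟩
      rw [Set.add_singleton, Set.mem_image] at hz
      obtain ⟨w, ⟨u, hu, rfl⟩, hw⟩ := hz
      refine ⟨⟨n, m⟩, ?_, rfl⟩
      obtain ⟨h1, h2, h3⟩ := mem_profileRegion.1 hu
      have e1 : R * u.1 + t.1 = n := congrArg Prod.fst hw
      have e2 : R * u.2 + t.2 = m := congrArg Prod.snd hw
      have e3 : ((n : ℝ) - t.1) / R = u.1 := by rw [← e1]; field_simp; ring
      rw [Finset.mem_coe, hP, Finset.mem_sigma]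
      refine ⟨(hcol n).2 (e3 ▸ h1), ?_⟩
      simp only [Finset.mem_Icc, Int.ceil_le, Int.le_floor, e3, ← e2]
      constructor <;> nlinarith
    · rintro ⟨⟨n, m⟩, hq, rfl⟩
      rw [Finset.mem_coe, hP, Finset.mem_sigma] at hq
      obtain ⟨h1, h2⟩ := hq
      simp only [Finset.mem_Icc, Int.ceil_le, Int.le_floor] at h2
      refine ⟨?_, ⟨(n, m), rfl⟩⟩
      rw [Set.add_singleton, Set.mem_image]
      refine ⟨_, Set.smul_mem_smul_set (a := R) (b := (((n - t.1) / R, (m - t.2) / R) : ℝ × ℝ))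
        (mem_profileRegion.2 ⟨(hcol n).1 h1, ?_, ?_⟩), ?_⟩
      · rw [le_div_iff₀ hR]; linarith [h2.1]
      · rw [div_le_iff₀ hR]; linarith [h2.2]
      · refine Prod.ext ?_ ?_ <;> simp <;> field_simp <;> ring
  rw [hset, Set.ncard_image_of_injective, Set.ncard_coe_finset, hP, Finset.card_sigma]
  · push_cast
    refine Finset.sum_congr rfl fun n hn => ?_
    have hx := mul_le_mul_of_nonneg_left (hfh _ ((hcol n).1 hn)) hR.le
    have h1 := Int.ceil_lt_add_one (R * f ((n - t.1) / R) + t.2)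
    have h2 := Int.lt_floor_add_one (R * h ((n - t.1) / R) + t.2)
    -- Since f ≤ h, the column formula is never negative: a column without lattice points gives
    -- exactly 0.
    have h3 : ⌈R * f ((n - t.1) / R) + t.2⌉ < ⌊R * h ((n - t.1) / R) + t.2⌋ + 2 := by
      exact_mod_cast (by linarith : (⌈R * f ((n - t.1) / R) + t.2⌉ : ℝ) <
        ⌊R * h ((n - t.1) / R) + t.2⌋ + 2)
    rw [Int.card_Icc]
    have h4 : (((⌊R * h ((n - t.1) / R) + t.2⌋ + 1 - ⌈R * f ((n - t.1) / R) + t.2⌉).toNat : ℤ) : ℝ)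
        = ((⌊R * h ((n - t.1) / R) + t.2⌋ + 1 - ⌈R * f ((n - t.1) / R) + t.2⌉ : ℤ) : ℝ) := by
      rw [Int.toNat_of_nonneg (by omega)]
    rw [Int.cast_natCast] at h4
    rw [h4]
    push_cast
    ring
  · rintro ⟨n, m⟩ ⟨n', m'⟩ heq
    simp only [Prod.mk.injEq, Int.cast_inj] at heq
    rw [heq.1, heq.2]

/-- The identity is exact even at integers, where `sawtooth` takes the value 1/2; lattice points on
the boundary are thus counted correctly. -/
lemma floor_sub_ceil_add_one (x y : ℝ) :
    (⌊y⌋ : ℝ) - ⌈x⌉ + 1 = (y - x) + (sawtooth x + sawtooth (-y)) := by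
  rw [sawtooth, sawtooth, Int.ceil_neg]
  push_cast
  ring

/-- The area of the region between two graphs. -/
lemma volume_profileRegion {a b : ℝ} {f h : ℝ → ℝ} (hab : a ≤ b)
    (hfh : ∀ x ∈ Set.Icc a b, f x ≤ h x) (hm : MeasurableSet (profileRegion a b f h))
    (hi : IntervalIntegrable (fun x => h x - f x) volume a b) :
    (volume (profileRegion a b f h)).toReal = ∫ x in a..b, (h x - f x) := by
  have e : volume (profileRegion a b f h) = ∫⁻ x in Set.Icc a b, ENNReal.ofReal (h x - f x) := by
    rw [Measure.volume_eq_prod, Measure.prod_apply hm, ← lintegral_indicator measurableSet_Icc]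
    refine lintegral_congr fun x => ?_
    by_cases hx : x ∈ Set.Icc a b
    · rw [Set.indicator_of_mem hx, ← Real.volume_Icc]
      congr 1
      ext y
      rw [Set.mem_preimage, mem_profileRegion]
      exact ⟨fun h => h.2, fun h => ⟨hx, h⟩⟩
    · rw [Set.indicator_of_notMem hx, ← measure_empty (μ := (volume : Measure ℝ))]
      congr 1
      ext y
      rw [Set.mem_preimage, mem_profileRegion]
      exact ⟨fun h => absurd h.1 hx, fun h => h.elim⟩
  rw [e, intervalIntegral.integral_of_le hab, ← integral_Icc_eq_integral_Ioc,
    integral_eq_lintegral_of_nonneg_ae]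
  · filter_upwards [ae_restrict_mem measurableSet_Icc] with x hx
    simpa using hfh x hx
  · rw [intervalIntegrable_iff_integrableOn_Icc_of_le hab] at hi
    exact hi.aestronglyMeasurable

lemma ConcaveOn.intervalIntegrable {F : ℝ → ℝ} {a b M : ℝ} (hab : a ≤ b)
    (hF : ConcaveOn ℝ (Set.Icc a b) F) (hM : ∀ x ∈ Set.Icc a b, |F x| ≤ M) :
    IntervalIntegrable F volume a b := by
  rw [intervalIntegrable_iff_integrableOn_Ioo_of_le hab]
  have hc : ContinuousOn F (Set.Ioo a b) := by
    have := hF.continuousOn_interior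
    rwa [interior_Icc] at this
  refine IntegrableOn.of_bound (by simp) (hc.aestronglyMeasurable measurableSet_Ioo) M ?_
  filter_upwards [ae_restrict_mem measurableSet_Ioo] with x hx
  exact hM x (Set.Ioo_subset_Icc_self hx)

namespace IsFlatProfile

variable {γ : ℝ} {C : Set (ℝ × ℝ)} {a b : ℝ} {f h : ℝ → ℝ} {ε c K : ℝ}

lemma lt (P : IsFlatProfile γ C a b f h ε c K) : a < b := by linarith [P.left, P.pos, P.right]

/-- The column lengths of the dilated body sum to its area, up to a square root error. -/
lemma abs_sum_lengths_sub_le (P : IsFlatProfile γ C a b f h ε c K) (hC : MeasurableSet C)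
    {R : ℝ} (hR : 1 ≤ R) (t : ℝ) :
    |∑ n ∈ Finset.Icc ⌈R * a + t⌉ ⌊R * b + t⌋, R * (h ((n - t) / R) - f ((n - t) / R))
      - R ^ 2 * (volume C).toReal| ≤ 8 * (|K| * √R) := by
  have hR0 : 0 < R := by linarith
  have hab := P.lt
  have hconc : ConcaveOn ℝ (Set.Icc a b) fun x => h x - f x := P.concave.sub P.convex
  have hint : IntervalIntegrable (fun x => h x - f x) volume a b :=
    hconc.intervalIntegrable (M := 2) hab.le fun x hx => by
      have := P.bounds x hx
      exact (abs_sub _ _).trans (by linarith [this.2.1, this.2.2])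
  have hmem : ∀ x ∈ Set.Icc (R * a + t) (R * b + t), (x - t) / R ∈ Set.Icc a b := by
    intro x hx
    rw [Set.mem_Icc, le_div_iff₀ hR0, div_le_iff₀ hR0]
    constructor <;> linarith [hx.1, hx.2]
  have hconc' : ConcaveOn ℝ (Set.Icc (R * a + t) (R * b + t))
      fun x => R * (h ((x - t) / R) - f ((x - t) / R)) := by
    refine ⟨convex_Icc _ _, fun x hx y hy u v hu hv huv => ?_⟩
    have := hconc.2 (hmem x hx) (hmem y hy) hu hv huv
    simp only [smul_eq_mul] at this ⊢
    rw [show u * ((x - t) / R) + v * ((y - t) / R) = (u * x + v * y - t) / R by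
      field_simp; linear_combination (-t) * huv] at this
    nlinarith
  -- Dilation by R turns the square-root rate |K| at the ends into |K|√R, the source of the O(√R)
  -- error.
  have hsq : ∀ {y : ℝ}, R * (|K| * √(y / R)) = |K| * √R * √y := by
    intro y
    rw [Real.sqrt_div' _ hR0.le]
    have := Real.mul_self_sqrt hR0.le
    have hp := Real.sqrt_pos.2 hR0
    field_simp
    linear_combination (-|K| * √y) * this
  have hK : ∀ {z : ℝ}, K * √z ≤ |K| * √z := fun {z} =>
    mul_le_mul_of_nonneg_right (le_abs_self K) (Real.sqrt_nonneg z)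
  have e : ∫ x in (R * a + t)..(R * b + t), R * (h ((x - t) / R) - f ((x - t) / R)) =
      R ^ 2 * (volume C).toReal := by
    have hvol := volume_profileRegion hab.le P.le (P.eq ▸ hC) hint
    rw [← P.eq] at hvol
    rw [hvol, intervalIntegral.integral_const_mul]
    have := intervalIntegral.integral_comp_div_sub (a := R * a + t) (b := R * b + t)
      (fun x => h x - f x) hR0.ne' (t / R)
    simp only [← sub_div] at this
    rw [this, smul_eq_mul, add_sub_cancel_right, add_sub_cancel_right,
      mul_div_cancel_left₀ _ hR0.ne', mul_div_cancel_left₀ _ hR0.ne']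
    ring
  rw [← e]
  refine abs_sum_sub_integral_le (F := fun x => R * (h ((x - t) / R) - f ((x - t) / R)))
    (by nlinarith) hconc' ?_ ?_ ?_ ?_ (by positivity)
  · exact fun x hx => mul_nonneg hR0.le (sub_nonneg.2 (P.le _ (hmem x hx)))
  · refine hconc'.intervalIntegrable (M := R * 2) (by nlinarith) fun x hx => ?_
    have := P.bounds _ (hmem x hx)
    rw [abs_mul, abs_of_pos hR0]
    exact mul_le_mul_of_nonneg_left ((abs_sub _ _).trans (by linarith [this.2.1, this.2.2])) hR0.le
  · intro x hx
    rw [← hsq, show (x - (R * a + t)) / R = (x - t) / R - a by field_simp; ring]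
    exact mul_le_mul_of_nonneg_left ((P.left_end _ (hmem x hx)).trans hK) hR0.le
  · intro x hx
    rw [← hsq, show (R * b + t - x) / R = b - (x - t) / R by field_simp; ring]
    exact mul_le_mul_of_nonneg_left ((P.right_end _ (hmem x hx)).trans hK) hR0.le

end IsFlatProfile

/-! ### Sawtooth sums along the boundary and the final bound. -/

lemma ordConnected_filter_div_mem {S : Finset ℤ} (hS : (S : Set ℤ).OrdConnected) {R : ℝ}
    (hR : 0 < R) (t : ℝ) {I : Set ℝ} (hI : I.OrdConnected) [DecidablePred fun n : ℤ => ((n : ℝ) - t) / R ∈ I] :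
    ((S.filter fun n : ℤ => ((n : ℝ) - t) / R ∈ I : Finset ℤ) : Set ℤ).OrdConnected := by
  have hmono : Monotone fun n : ℤ => ((n : ℝ) - t) / R := fun m n hmn =>
    div_le_div_of_nonneg_right (sub_le_sub_right (Int.cast_le.2 hmn) t) hR.le
  rw [Finset.coe_filter]
  exact hS.inter (hI.preimage_mono hmono)

open Classical in
/-- `abs_sum_sawtooth_le_of_curved` with the endpoints of the interval allowed. -/
lemma abs_sum_sawtooth_le_of_curved_Icc {f s : ℝ → ℝ} {a b c : ℝ}
    (hfc : ContinuousOn f (Set.Ioo a b)) (hb : ∀ x ∈ Set.Ioo a b, |f x| ≤ 1)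
    (hs : ∀ x ∈ Set.Ioo a b, ∀ y ∈ Set.Ioo a b, f x + s x * (y - x) ≤ f y) (hc : 0 < c) (hc1 : c ≤ 1)
    (hloc : ∀ x ∈ Set.Ioo a b, ∀ᶠ y in nhds x,
      f x + s x * (y - x) + 2 * c * (max 1 |s x|) ^ 3 * (y - x) ^ 2 ≤ f y)
    {R : ℝ} (hR : 1 ≤ R) (t t' : ℝ) {S : Finset ℤ} (hS : (S : Set ℤ).OrdConnected)
    (hSI : ∀ n ∈ S, ((n : ℝ) - t) / R ∈ Set.Icc a b) :
    |∑ n ∈ S, sawtooth (R * f ((n - t) / R) + t')| ≤ 15000 / c * R ^ (2 / 3 : ℝ) + 1 := by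
  have hR0 : 0 < R := by linarith
  have hinj : ∀ {m n : ℤ}, ((m : ℝ) - t) / R = (n - t) / R → m = n := fun {m n} h => by
    rw [div_left_inj' hR0.ne', sub_left_inj, Int.cast_inj] at h
    exact h
  -- The one-sided slopes are controlled only at interior points; at most two columns hit the
  -- endpoints and cost 1/2 each.
  rw [← Finset.sum_filter_add_sum_filter_not S fun n : ℤ => ((n : ℝ) - t) / R ∈ Set.Ioo a b]
  refine (abs_add_le _ _).trans (add_le_add ?_ ?_)
  · exact abs_sum_sawtooth_le_of_curved Set.ordConnected_Ioo hfc hb hs hc hc1 hloc hR t t'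
      (ordConnected_filter_div_mem hS hR0 t Set.ordConnected_Ioo) fun n hn => (Finset.mem_filter.1 hn).2
  · refine (abs_sum_sawtooth_le _ _).trans ?_
    have hcard : (S.filter fun n : ℤ => ¬ ((n : ℝ) - t) / R ∈ Set.Ioo a b).card ≤ 2 := by
      have hsub : (S.filter fun n : ℤ => ¬ ((n : ℝ) - t) / R ∈ Set.Ioo a b) ⊆
          (S.filter fun n : ℤ => ((n : ℝ) - t) / R = a) ∪
            S.filter fun n : ℤ => ((n : ℝ) - t) / R = b := by
        intro n hn
        obtain ⟨hn1, hn2⟩ := Finset.mem_filter.1 hn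
        have h := hSI n hn1
        rw [Finset.mem_union, Finset.mem_filter, Finset.mem_filter]
        rcases h.1.eq_or_lt with h1 | h1
        · exact Or.inl ⟨hn1, h1.symm⟩
        · rcases h.2.eq_or_lt with h2 | h2
          · exact Or.inr ⟨hn1, h2⟩
          · exact absurd ⟨h1, h2⟩ hn2
      have h1 : ∀ z : ℝ, (S.filter fun n : ℤ => ((n : ℝ) - t) / R = z).card ≤ 1 := fun z =>
        Finset.card_le_one.2 fun m hm n hn => hinj
          ((Finset.mem_filter.1 hm).2.trans (Finset.mem_filter.1 hn).2.symm)
      have := (Finset.card_le_card hsub).trans (Finset.card_union_le _ _)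
      linarith [h1 a, h1 b]
    have : ((S.filter fun n : ℤ => ¬ ((n : ℝ) - t) / R ∈ Set.Ioo a b).card : ℝ) ≤ 2 := by
      exact_mod_cast hcard
    linarith

namespace IsFlatProfile

variable {γ : ℝ} {C : Set (ℝ × ℝ)} {a b : ℝ} {f h : ℝ → ℝ} {ε c K : ℝ}

lemma abs_sum_sawtooth_upper_le (P : IsFlatProfile γ C a b f h ε c K) {R : ℝ} (hR : 1 ≤ R)
    (t t' : ℝ) {S : Finset ℤ} (hS : (S : Set ℤ).OrdConnected)
    (hSI : ∀ n ∈ S, ((n : ℝ) - t) / R ∈ Set.Icc a b) :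
    |∑ n ∈ S, sawtooth (R * (-h ((n - t) / R)) + t')| ≤ 15000 / c * R ^ (2 / 3 : ℝ) + 1 := by
  have hconv : ConvexOn ℝ (Set.Icc a b) fun z => -h z := P.concave.neg
  have hcont := hconv.continuousOn_interior
  rw [interior_Icc] at hcont
  refine abs_sum_sawtooth_le_of_curved_Icc (f := fun z => -h z) hcont (fun x hx => ?_)
    (fun x hx y hy => ?_) P.curv_pos P.curv_le P.upper hR t t' hS hSI
  · rw [abs_neg]
    exact (P.bounds x (Set.Ioo_subset_Icc_self hx)).2.2
  · exact hconv.add_rightDeriv_mul_le (by rwa [interior_Icc]) (Set.Ioo_subset_Icc_self hy)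

lemma abs_sum_sawtooth_lower_le_of_subset (P : IsFlatProfile γ C a b f h ε c K) {a' b' : ℝ}
    (ha : a ≤ a') (hb : b' ≤ b) (hε : ∀ x ∈ Set.Ioo a' b', ε ≤ |x|) {R : ℝ} (hR : 1 ≤ R)
    (t t' : ℝ) {S : Finset ℤ} (hS : (S : Set ℤ).OrdConnected)
    (hSI : ∀ n ∈ S, ((n : ℝ) - t) / R ∈ Set.Icc a' b') :
    |∑ n ∈ S, sawtooth (R * f ((n - t) / R) + t')| ≤ 15000 / c * R ^ (2 / 3 : ℝ) + 1 := by
  have hcont := P.convex.continuousOn_interior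
  rw [interior_Icc] at hcont
  have hsub : Set.Ioo a' b' ⊆ Set.Ioo a b := Set.Ioo_subset_Ioo ha hb
  refine abs_sum_sawtooth_le_of_curved_Icc (hcont.mono hsub) (fun x hx => ?_)
    (fun x hx y hy => ?_) P.curv_pos P.curv_le (fun x hx => P.lower x (hsub hx) (hε x hx)) hR t t' hS hSI
  · exact (P.bounds x (Set.Ioo_subset_Icc_self (hsub hx))).2.1
  · exact P.convex.add_rightDeriv_mul_le (by rw [interior_Icc]; exact hsub hx)
      (Set.Ioo_subset_Icc_self (hsub hy))

-- The lower boundary has two curved stretches, left of -ε and right of ε, and the explicit flat arc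
-- between them; only the last contributes the exponent 1 - 1/γ.
open Classical in
lemma exists_abs_sum_sawtooth_lower_le (P : IsFlatProfile γ C a b f h ε c K) (hγ : 3 < γ) :
    ∃ L : ℝ, 0 < L ∧ ∀ {R : ℝ}, 1 ≤ R → ∀ (t t' : ℝ) {S : Finset ℤ}, (S : Set ℤ).OrdConnected →
      (∀ n ∈ S, ((n : ℝ) - t) / R ∈ Set.Icc a b) →
      |∑ n ∈ S, sawtooth (R * f ((n - t) / R) + t')| ≤
        2 * (15000 / c * R ^ (2 / 3 : ℝ) + 1) + L * R ^ (1 - 1 / γ) := by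
  obtain ⟨L, hL, hflat⟩ := abs_sum_sawtooth_rpow_le hγ
  refine ⟨L, hL, fun {R} hR t t' {S} hS hSI => ?_⟩
  have hR0 : 0 < R := by linarith
  have hε := P.pos
  have hεa := P.left
  have hεb := P.right
  set x : ℤ → ℝ := fun n => ((n : ℝ) - t) / R with hx
  set S₁ := S.filter fun n => x n ∈ Set.Iio (-ε) with hS₁
  set T := S.filter fun n => ¬ x n ∈ Set.Iio (-ε) with hT
  have hT' : (T : Set ℤ).OrdConnected := by
    have : T = S.filter fun n => x n ∈ Set.Ici (-ε) :=
      Finset.filter_congr fun n _ => by rw [Set.mem_Iio, Set.mem_Ici, not_lt]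
    rw [this]
    exact ordConnected_filter_div_mem hS hR0 t Set.ordConnected_Ici
  set S₂ := T.filter fun n => x n ∈ Set.Ioi ε with hS₂
  set S₃ := T.filter fun n => ¬ x n ∈ Set.Ioi ε with hS₃
  have hS₃' : (S₃ : Set ℤ).OrdConnected := by
    have : S₃ = T.filter fun n => x n ∈ Set.Iic ε :=
      Finset.filter_congr fun n _ => by rw [Set.mem_Ioi, Set.mem_Iic, not_lt]
    rw [this]
    exact ordConnected_filter_div_mem hT' hR0 t Set.ordConnected_Iic
  have b₁ : |∑ n ∈ S₁, sawtooth (R * f (x n) + t')| ≤ 15000 / c * R ^ (2 / 3 : ℝ) + 1 := by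
    refine P.abs_sum_sawtooth_lower_le_of_subset (a' := a) (b' := -ε) le_rfl (by linarith)
      (fun y hy => ?_) hR t t' (ordConnected_filter_div_mem hS hR0 t Set.ordConnected_Iio) fun n hn => ?_
    · rw [abs_of_neg (by linarith [hy.2])]; linarith [hy.2]
    · obtain ⟨hn1, hn2⟩ := Finset.mem_filter.1 hn
      exact ⟨(hSI n hn1).1, (Set.mem_Iio.1 hn2).le⟩
  have b₂ : |∑ n ∈ S₂, sawtooth (R * f (x n) + t')| ≤ 15000 / c * R ^ (2 / 3 : ℝ) + 1 := by
    refine P.abs_sum_sawtooth_lower_le_of_subset (a' := ε) (b' := b) (by linarith) le_rfl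
      (fun y hy => ?_) hR t t' (ordConnected_filter_div_mem hT' hR0 t Set.ordConnected_Ioi) fun n hn => ?_
    · rw [abs_of_pos (by linarith [hy.1])]; exact hy.1.le
    · obtain ⟨hn1, hn2⟩ := Finset.mem_filter.1 hn
      exact ⟨(Set.mem_Ioi.1 hn2).le, (hSI n (Finset.mem_filter.1 hn1).1).2⟩
  have habs : ∀ n ∈ S₃, |x n| ≤ ε := fun n hn => by
    obtain ⟨hn1, hn2⟩ := Finset.mem_filter.1 hn
    have hn3 := (Finset.mem_filter.1 hn1).2
    exact abs_le.2 ⟨not_lt.1 hn3, not_lt.1 hn2⟩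
  have b₃ : |∑ n ∈ S₃, sawtooth (R * f (x n) + t')| ≤ L * R ^ (1 - 1 / γ) := by
    rw [Finset.sum_congr rfl fun n hn => by rw [P.flat _ (habs n hn)]]
    exact hflat hR t t' hS₃' fun n hn =>
      (P.bounds _ (hSI n (Finset.mem_filter.1 (Finset.mem_filter.1 hn).1).1)).1
  have e : ∑ n ∈ S, sawtooth (R * f (x n) + t') = ∑ n ∈ S₁, sawtooth (R * f (x n) + t')
      + (∑ n ∈ S₂, sawtooth (R * f (x n) + t') + ∑ n ∈ S₃, sawtooth (R * f (x n) + t')) := by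
    rw [hS₂, hS₃, Finset.sum_filter_add_sum_filter_not, hS₁, hT, Finset.sum_filter_add_sum_filter_not]
  rw [e]
  refine (abs_add_le _ _).trans ?_
  have := abs_add_le (∑ n ∈ S₂, sawtooth (R * f (x n) + t')) (∑ n ∈ S₃, sawtooth (R * f (x n) + t'))
  linarith

end IsFlatProfile

/-- The pointwise bound for the discrepancy function. -/
theorem exists_abs_discrepancy_le {γ : ℝ} (hγ : 3 < γ) {C : Set (ℝ × ℝ)} (hC : IsFlatPointBody γ C) :
    ∃ c : ℝ, 0 < c ∧ ∀ (R : ℝ), 1 ≤ R → ∀ t, |discrepancy C R t| ≤ c * R ^ (1 - 1 / γ) := by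
  obtain ⟨a, b, f, h, ε, c, K, P⟩ := exists_isFlatProfile hγ hC
  obtain ⟨L, hL, hlow⟩ := P.exists_abs_sum_sawtooth_lower_le hγ
  have hc := P.curv_pos
  refine ⟨3 * (15000 / c + 1) + L + 8 * |K|, by positivity, fun R hR t => ?_⟩
  have hR0 : 0 < R := by linarith
  -- This is where R^(2/3) from the curved parts is absorbed by the flat contribution.
  have hγ' : 1 / γ ≤ 1 / 3 := one_div_le_one_div_of_le (by norm_num) hγ.le
  have r1 : R ^ (2 / 3 : ℝ) ≤ R ^ (1 - 1 / γ) := Real.rpow_le_rpow_of_exponent_le hR (by linarith)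
  have r2 : √R ≤ R ^ (1 - 1 / γ) := by
    rw [Real.sqrt_eq_rpow]
    exact Real.rpow_le_rpow_of_exponent_le hR (by linarith)
  have r3 : 1 ≤ R ^ (1 - 1 / γ) := Real.one_le_rpow hR (by linarith)
  set S := Finset.Icc ⌈R * a + t.1⌉ ⌊R * b + t.1⌋ with hSdef
  have hS : (S : Set ℤ).OrdConnected := by
    rw [hSdef, Finset.coe_Icc]
    exact Set.ordConnected_Icc
  have hSI : ∀ n ∈ S, ((n : ℝ) - t.1) / R ∈ Set.Icc a b := by
    intro n hn
    rw [hSdef, Finset.mem_Icc, Int.ceil_le, Int.le_floor] at hn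
    rw [Set.mem_Icc, le_div_iff₀ hR0, div_le_iff₀ hR0]
    constructor <;> linarith [hn.1, hn.2]
  have e : discrepancy C R t =
      (∑ n ∈ S, R * (h ((n - t.1) / R) - f ((n - t.1) / R)) - R ^ 2 * (volume C).toReal)
      + (∑ n ∈ S, sawtooth (R * f ((n - t.1) / R) + t.2)
        + ∑ n ∈ S, sawtooth (R * (-h ((n - t.1) / R)) + -t.2)) := by
    have hcount := ncard_smul_add_inter_integerPoints P.le hR0 t
    rw [← P.eq] at hcount
    rw [discrepancy, hcount, ← Finset.sum_add_distrib, neg_add_eq_sub, sub_add_eq_add_sub,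
      ← Finset.sum_add_distrib]
    congr 1
    refine Finset.sum_congr rfl fun n _ => ?_
    rw [floor_sub_ceil_add_one, show -(R * h ((n - t.1) / R) + t.2) =
      R * (-h ((n - t.1) / R)) + -t.2 by ring]
    ring
  have b1 := P.abs_sum_lengths_sub_le hC.compact.isClosed.measurableSet hR t.1
  have b2 := hlow hR t.1 t.2 hS hSI
  have b3 := P.abs_sum_sawtooth_upper_le hR t.1 (-t.2) hS hSI
  have s1 : 15000 / c * R ^ (2 / 3 : ℝ) ≤ 15000 / c * R ^ (1 - 1 / γ) :=
    mul_le_mul_of_nonneg_left r1 (by positivity)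
  have s2 := mul_le_mul_of_nonneg_left r2 (abs_nonneg K)
  rw [e]
  refine (abs_add_le _ _).trans ((add_le_add le_rfl (abs_add_le _ _)).trans ?_)
  linarith

lemma volume_torusSquare : volume torusSquare = 1 := by
  rw [torusSquare, Measure.volume_eq_prod, Measure.prod_prod, Real.volume_Ico]
  norm_num

/-- The torus has total mass 1, so the pointwise bound passes to every exponent with no factor
depending on `p`. -/
lemma discrepancyNorm_le {C : Set (ℝ × ℝ)} {R M : ℝ} (hM : ∀ t, |discrepancy C R t| ≤ M) {p : ℝ≥0∞}
    (hp : 1 ≤ p) : discrepancyNorm p C R ≤ ENNReal.ofReal M := by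
  rw [discrepancyNorm]
  split_ifs with htop
  · exact iSup₂_le fun t _ => ENNReal.ofReal_le_ofReal (hM t)
  · have hp0 : 0 < p.toReal := ENNReal.toReal_pos (by positivity) htop
    calc (∫⁻ t in torusSquare, ENNReal.ofReal |discrepancy C R t| ^ p.toReal) ^ (1 / p.toReal)
        ≤ (∫⁻ _ in torusSquare, ENNReal.ofReal M ^ p.toReal) ^ (1 / p.toReal) := by
          refine ENNReal.rpow_le_rpow (lintegral_mono fun t => ?_) (by positivity)
          exact ENNReal.rpow_le_rpow (ENNReal.ofReal_le_ofReal (hM t)) hp0.le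
      _ = ENNReal.ofReal M := by
          rw [setLIntegral_const, volume_torusSquare, mul_one, ← ENNReal.rpow_mul,
            mul_one_div_cancel hp0.ne', ENNReal.rpow_one]

theorem mainTheorem6 (γ : ℝ) (hγ : 3 < γ) (C : Set (ℝ × ℝ)) (hC : IsFlatPointBody γ C) :
    ∃ c : ℝ, 0 < c ∧ ∀ (p : ℝ≥0∞) (R : ℝ), 1 ≤ p → 1 ≤ R →
      discrepancyNorm p C R ≤ ENNReal.ofReal (c * R ^ (1 - 1 / γ)) := by
  obtain ⟨c, hc, hle⟩ := exists_abs_discrepancy_le hγ hC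
  exact ⟨c, hc, fun p R hp hR => discrepancyNorm_le (hle R hR) hp⟩
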